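/- A polygon $P$ is a straight-line embedded cycle in the plane: it has at least three pairwise distinct corners, in cyclic order, and no edge meets the relative interior of another edge (collinear consecutive corners and vertical edges are allowed). $\mathrm{Int}(P)$ is the bounded region enclosed by $P$ (without $P$), and $\mathrm{area}(P)$ its area. Two sets overlap if they meet and neither contains the other. Let $\mathcal P$ be a finite set of polygons with pairwise different interiors no two of which overlap (so interiors are disjoint or nested; polygons may share boundary points). The nesting forest of $\mathcal P$ is the Hasse diagram of $\{\mathrm{Int}(P)\mid P\in\mathcal P\}$ with respect to inclusion, with $\mathrm{Int}(P)$ identified with $P$; its roots are the polygons with inclusion-maximal interior, and the parent of $P$ is the $Q$ with $\mathrm{Int}(P)\subsetneq\mathrm{Int}(Q)$ and no $R\in\mathcal P$ with $\mathrm{Int}(P)\subsetneq\mathrm{Int}(R)\subsetneq\mathrm{Int}(Q)$. For an edge $e$ let $\hat I(e)=[\min_{v\in e}v_x,\max_{v\in e}v_x)$. A segment of $P$ is a subpath $S$ of the cycle $P$. It is outstretched if $\hat I(e)\cap\hat I(f)=\emptyset$ for all distinct edges $e,f$ of $S$ and its terminal edges are not vertical; it is maximal outstretched if it has at least one edge and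 is not properly contained in another outstretched segment of $P$. Let $\min(S)_x,\max(S)_x$ be the extreme $x$-coordinates of the vertices of $S$ and $\hat I(S)=[\min(S)_x,\max(S)_x)$. For $\xi\in\hat I(S)$ let $y_S(\xi)$ and $\Delta_S(\xi)$ be the height at $\xi$ and the slope of the unique edge $e$ of $S$ with $\xi\in\hat I(e)$. The parity $\varpi(S,P)$ is $0$ if for all $\xi\in(\min(S)_x,\max(S)_x)$ the number of maximal outstretched segments $S'$ of $P$ with $\xi\in\hat I(S')$ and $y_{S'}(\xi)\ge y_S(\xi)$ is even, and $1$ otherwise. On the pairs $(S,P)$ with $P\in\mathcal P$, $S$ maximal outstretched in $P$ and $\xi\in\hat I(S)$, write $(S',P')\lessdot_\xi(S,P)$ if $y_{S'}(\xi)>y_S(\xi)$; or these are equal and $\Delta_{S'}(\xi)>\Delta_S(\xi)$; or both are equal and either $\varpi(S',P')=0$ and $\varpi(S,P)=1$, or both parities are $1$ and $\mathrm{area}(P)<\mathrm{area}(P')$, or both parities are $0$ and $\mathrm{area}(P)>\mathrm{area}(P')$. In the insertion order, $(S,P)$ precedes $(S',P')$ if $\min(S)_x<\min(S')_x$, or if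 $\min(S)_x=\min(S')_x=:\xi$ and $(S,P)\lessdot_\xi(S',P')$. The algorithm NestingForest computes, for each $P\in\mathcal P$, its maximal outstretched segments $S$, their parities and $\mathrm{area}(P)$. It sorts all pairs $(S,P)$ by insertion order (insertion list) and also by increasing $\max(S)_x$ (removal list), and merges the two lists by $\min(S)_x$ for insertions and $\max(S)_x$ for removals, removals first at equal positions. Starting from an empty search tree, it processes the merged list. At a removal, $(S,P)$ is deleted from the tree. At an insertion, $(S,P)$ is inserted into the tree by comparisons with respect to $\lessdot_\xi$, $\xi=\min(S)_x$; if moreover $(S,P)$ is the first pair of $P$ in insertion order, then $\mathrm{parent}(P)$ is set to $\emptyset$ if $(S,P)$ is the minimum of the tree, and otherwise, $(S',P')$ being its predecessor in the tree, to $P'$ if $\varpi(S',P')=1$ and to the current value of $\mathrm{parent}(P')$ if $\varpi(S',P')=0$. It returns the forest defined by $\mathrm{parent}$. **Theorem.** For every such $\mathcal P$, the algorithm NestingForest correctly computes the nesting forest of $\mathcal P$: the returned forest is the nesting forest, and for every $P\in\mathcal P$ the value $\mathrm{parent}(P)$ is defined, equals $\emptyset$ if $P$ is a root, and is the parent of $P$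 otherwise. -/

import Mathlib

/-- A polygon in the plane: a straight-line embedded cycle with `extra + 3` corners, listed in
cyclic order (addition of indices in `Fin (extra + 3)` is cyclic). The corners are pairwise
distinct, and no edge meets the relative interior of another edge. Three consecutive corners may
lie on a line, and edges may be vertical. -/
structure SimplePolygon where
  extra : ℕ
  vertex : Fin (extra + 3) → ℝ × ℝ
  injective : Function.Injective vertex
  planar : ∀ i j, i ≠ j → Disjoint (openSegment ℝ (vertex i) (vertex (i + 1)))
    (segment ℝ (vertex j) (vertex (j + 1)))

namespace SimplePolygon

/-- Corners are indexed by `P.Idx`; the edge with index `i` joins corner `i` to corner `i + 1`. -/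
abbrev Idx (P : SimplePolygon) : Type := Fin (P.extra + 3)

/-- The polygon as a closed curve: the union of its edges. -/
def curve (P : SimplePolygon) : Set (ℝ × ℝ) :=
  ⋃ i : P.Idx, segment ℝ (P.vertex i) (P.vertex (i + 1))

/-- `Int(P)`, the bounded region enclosed by `P` (without the curve itself): the points off the
curve whose connected component in the complement of the curve is bounded. -/
def inside (P : SimplePolygon) : Set (ℝ × ℝ) :=
  {p | p ∉ P.curve ∧ Bornology.IsBounded (connectedComponentIn P.curveᶜ p)}

/-- The area enclosed by `P`. -/
noncomputable def area (P : SimplePolygon) : ℝ :=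
  (MeasureTheory.volume P.inside).toReal

/-- The half-open interval `[min(e)_x, max(e)_x)` of the edge with index `e`; it is empty exactly
for vertical edges. -/
noncomputable def edgeIco (P : SimplePolygon) (e : P.Idx) : Set ℝ :=
  Set.Ico (min (P.vertex e).1 (P.vertex (e + 1)).1) (max (P.vertex e).1 (P.vertex (e + 1)).1)

/-- The edge with index `e` is vertical. -/
def VerticalEdge (P : SimplePolygon) (e : P.Idx) : Prop :=
  (P.vertex e).1 = (P.vertex (e + 1)).1

/-- The slope of the edge with index `e` (meaningful for non-vertical edges). -/
noncomputable def edgeSlope (P : SimplePolygon) (e : P.Idx) : ℝ :=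
  ((P.vertex (e + 1)).2 - (P.vertex e).2) / ((P.vertex (e + 1)).1 - (P.vertex e).1)

/-- The height at `ξ` of the line through the edge with index `e` (for non-vertical edges). -/
noncomputable def edgeHeight (P : SimplePolygon) (e : P.Idx) (ξ : ℝ) : ℝ :=
  (P.vertex e).2 + P.edgeSlope e * (ξ - (P.vertex e).1)

/-- A segment of `P`, i.e. a subpath of the cycle. The pair `(i, k)` is the path with `k` edges
that runs through the corners `i, i + 1, …, i + k`. Since a path in a cycle with `n` corners has
at most `n - 1` edges, every subpath is represented by exactly one pair. -/
abbrev Seg (P : SimplePolygon) : Type := P.Idx × P.Idx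

/-- `V(S)`, as a set of indices of corners. -/
def segVerts (P : SimplePolygon) (S : P.Seg) : Finset P.Idx :=
  (Finset.range ((S.2 : ℕ) + 1)).image fun j => S.1 + Fin.ofNat (P.extra + 3) j

/-- `E(S)`, as a set of indices of edges. -/
def segEdges (P : SimplePolygon) (S : P.Seg) : Finset P.Idx :=
  (Finset.range (S.2 : ℕ)).image fun j => S.1 + Fin.ofNat (P.extra + 3) j

theorem segVerts_nonempty (P : SimplePolygon) (S : P.Seg) : (P.segVerts S).Nonempty :=
  Finset.Nonempty.image (Finset.nonempty_range_iff.mpr (Nat.succ_ne_zero _)) _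

/-- `S ⊆ S'` as subgraphs of the cycle. -/
def SubSeg (P : SimplePolygon) (S S' : P.Seg) : Prop :=
  P.segVerts S ⊆ P.segVerts S' ∧ P.segEdges S ⊆ P.segEdges S'

/-- Property (O): the half-open intervals of distinct edges of `S` are disjoint. -/
def PropertyO (P : SimplePolygon) (S : P.Seg) : Prop :=
  ∀ e ∈ P.segEdges S, ∀ f ∈ P.segEdges S, e ≠ f → Disjoint (P.edgeIco e) (P.edgeIco f)

/-- `S` is outstretched: it satisfies (O), and its terminal edges (the edges at the two ends `S.1`
and `S.1 + S.2` of the path) are not vertical. -/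
def Outstretched (P : SimplePolygon) (S : P.Seg) : Prop :=
  P.PropertyO S ∧
    ∀ e ∈ P.segEdges S, (e = S.1 ∨ e + 1 = S.1 + S.2) → ¬ P.VerticalEdge e

/-- `S` is a maximal outstretched segment of `P` (with at least one edge: a corner between two
vertical edges, taken as a path without edges, is not counted). -/
def MaxOutstretched (P : SimplePolygon) (S : P.Seg) : Prop :=
  (P.segEdges S).Nonempty ∧ P.Outstretched S ∧
    ¬ ∃ S' : P.Seg, P.Outstretched S' ∧ P.SubSeg S S' ∧ ¬ P.SubSeg S' S

/-- `min(S)_x` -/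
noncomputable def minX (P : SimplePolygon) (S : P.Seg) : ℝ :=
  (P.segVerts S).inf' (P.segVerts_nonempty S) fun i => (P.vertex i).1

/-- `max(S)_x` -/
noncomputable def maxX (P : SimplePolygon) (S : P.Seg) : ℝ :=
  (P.segVerts S).sup' (P.segVerts_nonempty S) fun i => (P.vertex i).1

open Classical in
/-- The edge of `S` whose half-open interval contains `ξ`. For an outstretched segment `S` and
`ξ ∈ [min(S)_x, max(S)_x)` it exists and is unique; otherwise the value is irrelevant. -/
noncomputable def edgeAt (P : SimplePolygon) (S : P.Seg) (ξ : ℝ) : P.Idx :=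
  if h : ∃ e ∈ P.segEdges S, ξ ∈ P.edgeIco e then h.choose else S.1

/-- The height of `S` at `ξ`. -/
noncomputable def yVal (P : SimplePolygon) (S : P.Seg) (ξ : ℝ) : ℝ :=
  P.edgeHeight (P.edgeAt S ξ) ξ

/-- The slope of `S` at `ξ`. -/
noncomputable def slopeAt (P : SimplePolygon) (S : P.Seg) (ξ : ℝ) : ℝ :=
  P.edgeSlope (P.edgeAt S ξ)

/-- The set `N_{ξ,S}` of the maximal outstretched segments of `P` that meet the sweep-line at `ξ`
and do not lie below `S` there (`S` included). -/
def segsAbove (P : SimplePolygon) (ξ : ℝ) (S : P.Seg) : Set P.Seg :=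
  {S' | P.MaxOutstretched S' ∧ ξ ∈ Set.Ico (P.minX S') (P.maxX S') ∧ P.yVal S ξ ≤ P.yVal S' ξ}

open Classical in
/-- The parity of a maximal outstretched segment of `P`: it is `0` if `N_{ξ,S}` has an even number
of elements for all `ξ` in the open interval of `S`, and `1` otherwise. -/
noncomputable def parity (P : SimplePolygon) (S : P.Seg) : ℕ :=
  if ∀ ξ ∈ Set.Ioo (P.minX S) (P.maxX S), Even (P.segsAbove ξ S).ncard then 0 else 1

open Classical in
/-- A list of all maximal outstretched segments of `P`. -/
noncomputable def maxSegs (P : SimplePolygon) : List P.Seg :=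
  ((List.finRange (P.extra + 3)).product (List.finRange (P.extra + 3))).filter
    fun S => P.MaxOutstretched S

end SimplePolygon

/-- A pair `(S, P)` of a segment and the polygon to which it is considered to belong. -/
abbrev PolySeg : Type := Σ P : SimplePolygon, P.Seg

namespace PolySeg

noncomputable def minX (s : PolySeg) : ℝ := s.1.minX s.2

noncomputable def maxX (s : PolySeg) : ℝ := s.1.maxX s.2

noncomputable def yVal (s : PolySeg) (ξ : ℝ) : ℝ := s.1.yVal s.2 ξ

noncomputable def slopeAt (s : PolySeg) (ξ : ℝ) : ℝ := s.1.slopeAt s.2 ξ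

noncomputable def parity (s : PolySeg) : ℕ := s.1.parity s.2

/-- The relation `(S', P') ⋖_ξ (S, P)` on the maximal outstretched segments that meet the
sweep-line at `ξ`; it orders them from top to bottom. -/
def Before (ξ : ℝ) (s' s : PolySeg) : Prop :=
  s'.yVal ξ > s.yVal ξ ∨
    (s'.yVal ξ = s.yVal ξ ∧
      (s'.slopeAt ξ > s.slopeAt ξ ∨
        (s'.slopeAt ξ = s.slopeAt ξ ∧
          ((s'.parity = 0 ∧ s.parity = 1) ∨
            (s'.parity = 1 ∧ s.parity = 1 ∧ s.1.area < s'.1.area) ∨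
            (s'.parity = 0 ∧ s.parity = 0 ∧ s.1.area > s'.1.area)))))

/-- The insertion order. -/
def InsertionLT (s s' : PolySeg) : Prop :=
  s.minX < s'.minX ∨ (s.minX = s'.minX ∧ Before s.minX s s')

end PolySeg

/-! ### The algorithm -/

namespace NestingForest

/-- The list of all pairs `(S, P)`, with `P` in the input and `S` a maximal outstretched segment of
`P`. -/
noncomputable def allSegs (Ps : List SimplePolygon) : List PolySeg :=
  Ps.flatMap fun P => P.maxSegs.map (Sigma.mk P)

open Classical in
/-- The insertion list: all segments, sorted by insertion order. -/
noncomputable def insertionList (Ps : List SimplePolygon) : List PolySeg :=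
  (allSegs Ps).insertionSort fun s s' => ¬ PolySeg.InsertionLT s' s

open Classical in
/-- The removal list: all segments, sorted by increasing `max(S)_x`. -/
noncomputable def removalList (Ps : List SimplePolygon) : List PolySeg :=
  (allSegs Ps).insertionSort fun s s' => s.maxX ≤ s'.maxX

/-- `first(S, P)`: no segment of the same polygon precedes `(S, P)` in insertion order. -/
def IsFirst (Ps : List SimplePolygon) (s : PolySeg) : Prop :=
  ∀ t ∈ insertionList Ps, t.1 = s.1 → ¬ PolySeg.InsertionLT t s

/-- An event of the sweep. -/
inductive Event where
  | remove (s : PolySeg)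
  | insert (s : PolySeg)

/-- The sweep-line position of an event. -/
noncomputable def Event.pos : Event → ℝ
  | .remove s => s.maxX
  | .insert s => s.minX

open Classical in
/-- The removal list and the insertion list, merged by sweep-line position. At equal positions,
removals come before insertions (`List.merge` prefers its first argument). -/
noncomputable def events (Ps : List SimplePolygon) : List Event :=
  List.merge ((removalList Ps).map Event.remove) ((insertionList Ps).map Event.insert)
    fun a b => decide (a.pos ≤ b.pos)

/-- The state of the sweep: the content of the search tree (in its order, from small to large), and
the partial function `parent`. The value `none` means that `parent(P)` is not yet defined,
`some none` means that `parent(P) = ∅`, and `some (some Q)` means that `parent(P) = Q`. -/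
structure State where
  tree : List PolySeg
  parent : SimplePolygon → Option (Option SimplePolygon)

open Classical in
/-- Insertion of `s` into a search tree whose keys are compared by `⋖_ξ`. -/
noncomputable def treeInsert (ξ : ℝ) (s : PolySeg) (tree : List PolySeg) : List PolySeg :=
  tree.takeWhile (fun t => PolySeg.Before ξ t s) ++
    s :: tree.dropWhile (fun t => PolySeg.Before ξ t s)

open Classical in
/-- Removal of `s` from a search tree. -/
noncomputable def treeDelete (s : PolySeg) (tree : List PolySeg) : List PolySeg :=
  tree.filter fun t => t ≠ s

open Classical in
/-- The predecessor of `s` in a search tree whose keys are compared by `⋖_ξ`, if there is one: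
the last of the leading keys that are `⋖_ξ`-smaller than `s`. The value is `none` if `s` is the
minimum. -/
noncomputable def treePred (ξ : ℝ) (s : PolySeg) (tree : List PolySeg) : Option PolySeg :=
  (tree.takeWhile fun t => PolySeg.Before ξ t s).getLast?

open Classical in
/-- One pass through the main loop. -/
noncomputable def step (Ps : List SimplePolygon) (st : State) : Event → State
  | .remove s => { st with tree := treeDelete s st.tree }
  | .insert s =>
    let tree := treeInsert s.minX s st.tree
    if IsFirst Ps s then
      match treePred s.minX s tree with
      | none => ⟨tree, Function.update st.parent s.1 (some none)⟩
      | some s' =>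
        if s'.parity = 1 then ⟨tree, Function.update st.parent s.1 (some (some s'.1))⟩
        else ⟨tree, Function.update st.parent s.1 (st.parent s'.1)⟩
    else ⟨tree, st.parent⟩

/-- The function `parent` computed by the algorithm on the input `Ps`. -/
noncomputable def parent (Ps : List SimplePolygon) :
    SimplePolygon → Option (Option SimplePolygon) :=
  ((events Ps).foldl (step Ps) ⟨[], fun _ => none⟩).parent

end NestingForest

/-! ### The nesting forest -/

/-- Two sets overlap if they meet and neither contains the other. -/
def Overlap {α : Type*} (A B : Set α) : Prop :=
  A ∩ B ≠ A ∧ A ∩ B ≠ B ∧ A ∩ B ≠ ∅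

/-- `Int(Ps)` -/
def insides (Ps : List SimplePolygon) : Set (Set (ℝ × ℝ)) :=
  {A | ∃ P ∈ Ps, P.inside = A}

/-- `Ps` is overlap-free: no two of the interiors overlap. -/
def OverlapFree (Ps : List SimplePolygon) : Prop :=
  ∀ A ∈ insides Ps, ∀ B ∈ insides Ps, ¬ Overlap A B

/-- A graph with a set of distinguished vertices, the roots. -/
@[ext]
structure RootedGraph (V : Type*) where
  graph : SimpleGraph V
  roots : Set V

/-- The Hasse diagram of a family of sets with respect to inclusion. Its roots are the
inclusion-maximal members. -/
def hasseDiagram {α : Type*} (𝒮 : Set (Set α)) : RootedGraph 𝒮 where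
  graph := SimpleGraph.hasse 𝒮
  roots := {A | IsMax A}

/-- The interior of a member of `Ps`, as a member of `Int(Ps)`. -/
def toInside (Ps : List SimplePolygon) (P : {P : SimplePolygon // P ∈ Ps}) : insides Ps :=
  ⟨P.1.inside, P.1, P.2, rfl⟩

/-- The nesting forest of `Ps`: the Hasse diagram of `Int(Ps)`, in which the vertex `Int(P)` is
identified with `P`. -/
def nestingForest (Ps : List SimplePolygon) : RootedGraph {P : SimplePolygon // P ∈ Ps} where
  graph := (hasseDiagram (insides Ps)).graph.comap (toInside Ps)
  roots := toInside Ps ⁻¹' (hasseDiagram (insides Ps)).roots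

/-- The forest that the algorithm returns, as defined by `parent`. -/
def NestingForest.output (Ps : List SimplePolygon) :
    RootedGraph {P : SimplePolygon // P ∈ Ps} where
  graph := SimpleGraph.fromRel fun P Q => NestingForest.parent Ps P.1 = some (some Q.1)
  roots := {P | NestingForest.parent Ps P.1 = some none}

/-! Everything rests on a parity count. For a polygon, the interior consists of the points off the
curve from which an upward ray crosses an odd number of edges (`inside_eq`, a Jordan curve theorem
for polygons). Ray parity is locally constant off the curve and flips across every edge, so going
once around the polygon shows that one side of all edges is odd and the other even. Neither region
can be separated further, because a piece of it that stays away from that side would be open and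
closed in the plane.

An outstretched segment is `x`-monotone, so the interior lies on one vertical side of it throughout:
below for parity `1`, above for parity `0` (`parity_eq_one_iff`).

Let `S` and `T` be segments of polygons `P` and `Q`, where `P` is equal to, disjoint from or
enclosed by `Q`. Then the interior of `P` misses the curve `Q`, and the inner side of `S` cannot
pass from one side of `T` to the other while the sweep-line moves (`innerAbove_persistent`). The
tie-breaking rules for slope, parity and area are made so that `Before` compares exactly these inner
sides just to the right of the sweep-line (`before_iff_innerAbove`, `eventually_before_iff`). Hence
the order of two segments never changes and the search tree stays sorted.

Counting the segments of `Q` that precede `s` amounts to computing the ray parity with respect to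
`Q` of a point beside `s`. So their number is odd iff `Q` encloses the polygon of `s`; for the
polygon of `s` itself, it is odd iff `s` has parity `0` (`odd_preceding_iff`,
`odd_preceding_self_iff`). If `s` is the first segment of its polygon and `k` is its predecessor,
the segments preceding `s` are `k` and those preceding `k`. Comparing the counts, a polygon other
than that of `k` encloses the polygon of `s` iff it encloses that of `k`, and the polygon of `k`
itself encloses it iff `k` has parity `1` (`ssubset_iff_of_pred`). This is the rule by which the
algorithm assigns parents, and an induction over the events (`Invariant`) completes the proof. -/

namespace SimplePolygon

open Set Filter Topology

variable (P : SimplePolygon)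

/-! ### Half-planes beside an edge -/

theorem succ_ne (e : P.Idx) : e + 1 ≠ e := by
  intro h
  have h1 : (1 : Fin (P.extra + 3)) = 0 := add_eq_left.1 h
  exact absurd (congrArg Fin.val h1) (by simp)

/-- The cross product of the direction of the edge `e` with the vector from its start to `q`: it is
positive to the left of `e`, negative to the right and zero on the line through `e`. -/
noncomputable def cross (e : P.Idx) (q : ℝ × ℝ) : ℝ :=
  ((P.vertex (e + 1)).1 - (P.vertex e).1) * (q.2 - (P.vertex e).2) -
    ((P.vertex (e + 1)).2 - (P.vertex e).2) * (q.1 - (P.vertex e).1)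

/-- The open half-plane to the right of `e` if `σ = 1`, to the left if `σ = -1`. -/
def side (σ : ℝ) (e : P.Idx) : Set (ℝ × ℝ) := {q | σ * P.cross e q < 0}

/-- The points of side `σ` of `e` that are close to `t` belong to `A`. -/
def SideIn (σ : ℝ) (e : P.Idx) (t : ℝ × ℝ) (A : Set (ℝ × ℝ)) : Prop :=
  ∀ᶠ q in 𝓝[P.side σ e] t, q ∈ A

theorem continuous_cross (e : P.Idx) : Continuous (P.cross e) := by
  unfold cross; fun_prop

theorem isOpen_side (σ : ℝ) (e : P.Idx) : IsOpen (P.side σ e) :=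
  isOpen_lt (continuous_const.mul (P.continuous_cross e)) continuous_const

theorem cross_combo (e : P.Idx) (p q : ℝ × ℝ) (a b : ℝ) (h : a + b = 1) :
    P.cross e (a • p + b • q) = a * P.cross e p + b * P.cross e q := by
  obtain rfl : a = 1 - b := by linarith
  simp only [cross, Prod.fst_add, Prod.snd_add, Prod.smul_fst, Prod.smul_snd, smul_eq_mul]
  ring

theorem convex_side (σ : ℝ) (e : P.Idx) : Convex ℝ (P.side σ e) := by
  intro p hp q hq a b ha hb hab
  simp only [side, mem_ofPred_eq] at hp hq ⊢
  rw [P.cross_combo e p q a b hab]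
  rcases ha.eq_or_lt with rfl | ha
  · simp at hab; subst hab; simpa using hq
  · nlinarith [mul_nonneg hb (neg_nonneg.2 hq.le), mul_pos ha (neg_pos.2 hp)]

theorem cross_start (e : P.Idx) : P.cross e (P.vertex e) = 0 := by simp [cross]

theorem cross_end (e : P.Idx) : P.cross e (P.vertex (e + 1)) = 0 := by simp [cross]; ring

theorem cross_eq_zero_of_mem {e : P.Idx} {q : ℝ × ℝ}
    (hq : q ∈ segment ℝ (P.vertex e) (P.vertex (e + 1))) : P.cross e q = 0 := by
  obtain ⟨a, b, _, _, hab, rfl⟩ := hq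
  rw [P.cross_combo e _ _ a b hab, cross_start, cross_end]; ring

theorem edge_dir_sq_pos (e : P.Idx) :
    0 < ((P.vertex (e + 1)).1 - (P.vertex e).1) ^ 2 +
      ((P.vertex (e + 1)).2 - (P.vertex e).2) ^ 2 := by
  have h : P.vertex (e + 1) ≠ P.vertex e := fun h => P.succ_ne e (P.injective h)
  by_contra hc
  apply h
  have h1 := sq_nonneg ((P.vertex (e + 1)).1 - (P.vertex e).1)
  have h2 := sq_nonneg ((P.vertex (e + 1)).2 - (P.vertex e).2)
  have h3 : (P.vertex (e + 1)).1 - (P.vertex e).1 = 0 := by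
    apply pow_eq_zero_iff (two_ne_zero) |>.1; linarith
  have h4 : (P.vertex (e + 1)).2 - (P.vertex e).2 = 0 := by
    apply pow_eq_zero_iff (two_ne_zero) |>.1; linarith
  exact Prod.ext (by linarith) (by linarith)

theorem mem_closure_side {σ : ℝ} (hσ : σ ≠ 0) {e : P.Idx} {t : ℝ × ℝ} (ht : P.cross e t = 0) :
    t ∈ closure (P.side σ e) := by
  -- Leave `t` along the normal of `e` that points to side `σ`; `cross` then decreases by `s * σ`
  -- times the squared length of `e`.
  set f : ℝ → ℝ × ℝ := fun s => (t.1 + s * σ * ((P.vertex (e + 1)).2 - (P.vertex e).2),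
    t.2 - s * σ * ((P.vertex (e + 1)).1 - (P.vertex e).1)) with hf
  have hcont : Tendsto f (𝓝[>] 0) (𝓝 t) := by
    have : Continuous f := by fun_prop
    have h0 : f 0 = t := by simp [hf]
    exact h0 ▸ this.continuousAt.tendsto.mono_left nhdsWithin_le_nhds
  refine mem_closure_of_tendsto hcont ?_
  filter_upwards [self_mem_nhdsWithin] with s hs
  have hs : 0 < s := hs
  have hd := P.edge_dir_sq_pos e
  have : P.cross e (f s) = P.cross e t - s * σ *
      (((P.vertex (e + 1)).1 - (P.vertex e).1) ^ 2 +
      ((P.vertex (e + 1)).2 - (P.vertex e).2) ^ 2) := by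
    simp only [hf, cross]; ring
  simp only [side, mem_ofPred_eq, this, ht]
  have h2 : 0 < σ ^ 2 := by positivity
  have := mul_pos (mul_pos hs h2) hd
  nlinarith

/-- `SideIn` has content only if this filter is nontrivial; contradictions between incompatible
sides depend on it. -/
theorem nhdsWithin_side_neBot {σ : ℝ} (hσ : σ ≠ 0) {e : P.Idx} {t : ℝ × ℝ}
    (ht : P.cross e t = 0) : (𝓝[P.side σ e] t).NeBot :=
  mem_closure_iff_nhdsWithin_neBot.1 (P.mem_closure_side hσ ht)

theorem dense_cross_ne (e : P.Idx) : Dense {q | P.cross e q ≠ 0} := by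
  intro q
  by_cases h : P.cross e q = 0
  · refine closure_mono ?_ (P.mem_closure_side one_ne_zero h)
    intro p hp
    simp only [side, mem_ofPred_eq, one_mul] at hp
    exact hp.ne
  · exact subset_closure h

theorem isOpen_cross_ne (e : P.Idx) : IsOpen {q | P.cross e q ≠ 0} :=
  isOpen_ne_fun (P.continuous_cross e) continuous_const

theorem SideIn.mono {P : SimplePolygon} {σ : ℝ} {e : P.Idx} {t : ℝ × ℝ} {A B : Set (ℝ × ℝ)}
    (h : P.SideIn σ e t A) (hAB : A ⊆ B) : P.SideIn σ e t B :=
  Eventually.mono h fun _ hq => hAB hq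

theorem SideIn.inter {P : SimplePolygon} {σ : ℝ} {e : P.Idx} {t : ℝ × ℝ} {A B : Set (ℝ × ℝ)}
    (hA : P.SideIn σ e t A) (hB : P.SideIn σ e t B) : P.SideIn σ e t (A ∩ B) :=
  Eventually.and hA hB

theorem sideIn_of_mem_nhds {σ : ℝ} {e : P.Idx} {t : ℝ × ℝ} {A : Set (ℝ × ℝ)}
    (h : A ∈ 𝓝 t) : P.SideIn σ e t A :=
  mem_nhdsWithin_of_mem_nhds h

theorem sideIn_side {σ : ℝ} {e : P.Idx} {t : ℝ × ℝ} : P.SideIn σ e t (P.side σ e) :=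
  self_mem_nhdsWithin

theorem SideIn.nonempty {P : SimplePolygon} {σ : ℝ} (hσ : σ ≠ 0) {e : P.Idx} {t : ℝ × ℝ}
    {A : Set (ℝ × ℝ)} (ht : P.cross e t = 0) (h : P.SideIn σ e t A) : A.Nonempty := by
  have := P.nhdsWithin_side_neBot hσ ht
  exact Eventually.exists h

theorem SideIn.not_disjoint {P : SimplePolygon} {σ : ℝ} (hσ : σ ≠ 0) {e : P.Idx} {t : ℝ × ℝ}
    {A B : Set (ℝ × ℝ)} (ht : P.cross e t = 0) (hA : P.SideIn σ e t A) (hB : P.SideIn σ e t B) :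
    ¬ Disjoint A B := by
  obtain ⟨q, hq⟩ := (hA.inter hB).nonempty hσ ht
  exact fun h => h.le_bot hq

/-- Whether the side `σ` of `e` at `t` lies in `A` is an open condition on `t`. -/
theorem isOpen_setOf_sideIn (σ : ℝ) (e : P.Idx) (A : Set (ℝ × ℝ)) :
    IsOpen {t | P.SideIn σ e t A} := by
  have : {t | P.SideIn σ e t A} = interior ((P.side σ e)ᶜ ∪ A) := by
    ext t
    rw [mem_interior_iff_mem_nhds, mem_ofPred_eq, SideIn, eventually_nhdsWithin_iff,
      ← eventually_mem_set]
    exact eventually_congr (Eventually.of_forall fun q => imp_iff_not_or)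
  rw [this]
  exact isOpen_interior

/-! ### The curve near a point of an edge and near a corner -/

theorem segment_subset_curve (e : P.Idx) :
    segment ℝ (P.vertex e) (P.vertex (e + 1)) ⊆ P.curve :=
  subset_iUnion (fun i : P.Idx => segment ℝ (P.vertex i) (P.vertex (i + 1))) e

theorem openSegment_subset_curve (e : P.Idx) :
    openSegment ℝ (P.vertex e) (P.vertex (e + 1)) ⊆ P.curve :=
  (openSegment_subset_segment ℝ _ _).trans (P.segment_subset_curve e)

theorem isCompact_edge (e : P.Idx) : IsCompact (segment ℝ (P.vertex e) (P.vertex (e + 1))) := by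
  rw [segment_eq_image_lineMap]
  exact isCompact_Icc.image (AffineMap.lineMap_continuous)

theorem isClosed_edge (e : P.Idx) : IsClosed (segment ℝ (P.vertex e) (P.vertex (e + 1))) :=
  (P.isCompact_edge e).isClosed

theorem isCompact_curve : IsCompact P.curve :=
  isCompact_iUnion P.isCompact_edge

theorem isOpen_compl_curve : IsOpen P.curveᶜ := P.isCompact_curve.isClosed.isOpen_compl

theorem mem_curve_iff {q : ℝ × ℝ} :
    q ∈ P.curve ↔ (∃ i, q = P.vertex i) ∨
      ∃ e, q ∈ openSegment ℝ (P.vertex e) (P.vertex (e + 1)) := by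
  constructor
  · intro h
    obtain ⟨e, he⟩ := mem_iUnion.1 h
    rw [← insert_endpoints_openSegment] at he
    rcases he with rfl | rfl | he
    · exact Or.inl ⟨_, rfl⟩
    · exact Or.inl ⟨_, rfl⟩
    · exact Or.inr ⟨e, he⟩
  · rintro (⟨i, rfl⟩ | ⟨e, he⟩)
    · exact P.segment_subset_curve i (left_mem_segment ℝ _ _)
    · exact P.openSegment_subset_curve e he

theorem notMem_edge_of_ne {e f : P.Idx} (hef : e ≠ f) {t : ℝ × ℝ}
    (ht : t ∈ openSegment ℝ (P.vertex e) (P.vertex (e + 1))) :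
    t ∉ segment ℝ (P.vertex f) (P.vertex (f + 1)) :=
  fun h => (P.planar e f hef).le_bot ⟨ht, h⟩

/-- A corner in the relative interior of another edge would meet the edge that starts at it, against
`planar`. -/
theorem vertex_mem_edge {i e : P.Idx}
    (h : P.vertex i ∈ segment ℝ (P.vertex e) (P.vertex (e + 1))) : i = e ∨ i = e + 1 := by
  rw [← insert_endpoints_openSegment] at h
  rcases h with h | h | h
  · exact Or.inl (P.injective h)
  · exact Or.inr (P.injective h)
  · by_cases hie : i = e
    · exact Or.inl hie
    · exact absurd (left_mem_segment ℝ _ _) (P.notMem_edge_of_ne (Ne.symm hie) h)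

/-- The edges are finitely many closed sets, so those that avoid `t` avoid a whole neighbourhood. -/
theorem eventually_mem_edge {t : ℝ × ℝ} {p : P.Idx → Prop}
    (h : ∀ f, t ∈ segment ℝ (P.vertex f) (P.vertex (f + 1)) → p f) :
    ∀ᶠ q in 𝓝 t, ∀ f, q ∈ segment ℝ (P.vertex f) (P.vertex (f + 1)) → p f := by
  rw [eventually_all]
  intro f
  by_cases hf : t ∈ segment ℝ (P.vertex f) (P.vertex (f + 1))
  · exact Eventually.of_forall fun _ _ => h f hf
  · filter_upwards [(P.isClosed_edge f).isOpen_compl.mem_nhds hf] with q hq hq'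
    exact absurd hq' hq

theorem eventually_cross_of_mem_openSegment {e : P.Idx} {t : ℝ × ℝ}
    (ht : t ∈ openSegment ℝ (P.vertex e) (P.vertex (e + 1))) :
    ∀ᶠ q in 𝓝 t, q ∈ P.curve → P.cross e q = 0 := by
  have := P.eventually_mem_edge (t := t) (p := fun f => f = e) fun f hf => by
    by_contra hne
    exact P.notMem_edge_of_ne (Ne.symm hne) ht hf
  filter_upwards [this] with q hq hqc
  obtain ⟨f, hf⟩ := mem_iUnion.1 hqc
  obtain rfl := hq f hf
  exact P.cross_eq_zero_of_mem hf

theorem eventually_edges_of_vertex (e : P.Idx) :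
    ∀ᶠ q in 𝓝 (P.vertex (e + 1)), q ∈ P.curve →
      q ∈ segment ℝ (P.vertex e) (P.vertex (e + 1)) ∨
      q ∈ segment ℝ (P.vertex (e + 1)) (P.vertex (e + 1 + 1)) := by
  have := P.eventually_mem_edge (t := P.vertex (e + 1)) (p := fun f => f = e ∨ f = e + 1)
    fun f hf => by
      rcases P.vertex_mem_edge hf with h | h
      · exact Or.inr h.symm
      · exact Or.inl (add_right_cancel h).symm
  filter_upwards [this] with q hq hqc
  obtain ⟨f, hf⟩ := mem_iUnion.1 hqc
  rcases hq f hf with rfl | rfl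
  · exact Or.inl hf
  · exact Or.inr hf

theorem sideIn_compl_curve {σ : ℝ} {e : P.Idx} {t : ℝ × ℝ}
    (ht : t ∈ openSegment ℝ (P.vertex e) (P.vertex (e + 1))) : P.SideIn σ e t P.curveᶜ := by
  filter_upwards [mem_nhdsWithin_of_mem_nhds (P.eventually_cross_of_mem_openSegment ht),
    self_mem_nhdsWithin] with q hq hs hc
  simp [side, hq hc] at hs

theorem cross_of_mem_openSegment {e : P.Idx} {t : ℝ × ℝ}
    (ht : t ∈ openSegment ℝ (P.vertex e) (P.vertex (e + 1))) : P.cross e t = 0 :=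
  P.cross_eq_zero_of_mem (openSegment_subset_segment ℝ _ _ ht)

/-! ### The two sectors at a corner -/

/-- The turn of the polygon at the corner `e + 1`; positive for a left turn. -/
noncomputable def turn (e : P.Idx) : ℝ := P.cross e (P.vertex (e + 1 + 1))

open Classical in
/-- The sector at the corner `e + 1` on the side `σ` of the polygon. -/
noncomputable def sector (σ : ℝ) (e : P.Idx) : Set (ℝ × ℝ) :=
  -- Turning towards side `σ`, or going straight, makes the angle on that side at most straight: an
  -- intersection of half-planes. Otherwise it is reflex: a union.
  if σ * P.turn e ≤ 0 then P.side σ e ∩ P.side σ (e + 1) else P.side σ e ∪ P.side σ (e + 1)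

/-- Collinear consecutive edges have proportional directions. The factor is positive, since an edge
cannot be degenerate or fold back onto its predecessor. -/
theorem cross_succ_of_turn_eq_zero {e : P.Idx} (h : P.turn e = 0) :
    ∃ c : ℝ, 0 < c ∧ ∀ q, P.cross (e + 1) q = c * P.cross e q := by
  obtain ⟨x0, y0, h0⟩ : ∃ x y, P.vertex e = (x, y) := ⟨_, _, rfl⟩
  obtain ⟨x1, y1, h1⟩ : ∃ x y, P.vertex (e + 1) = (x, y) := ⟨_, _, rfl⟩
  obtain ⟨x2, y2, h2⟩ : ∃ x y, P.vertex (e + 1 + 1) = (x, y) := ⟨_, _, rfl⟩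
  have hd := P.edge_dir_sq_pos e
  have hd2 := P.edge_dir_sq_pos (e + 1)
  simp only [turn, cross, h0, h1, h2] at h hd hd2 ⊢
  set D := (x1 - x0) ^ 2 + (y1 - y0) ^ 2 with hD
  obtain ⟨c, hc⟩ : ∃ c, c = ((x2 - x1) * (x1 - x0) + (y2 - y1) * (y1 - y0)) / D := ⟨_, rfl⟩
  have hcD : c * D = (x2 - x1) * (x1 - x0) + (y2 - y1) * (y1 - y0) := by
    rw [hc]; field_simp
  have hx : x2 - x1 = c * (x1 - x0) := by
    apply mul_right_cancel₀ hd.ne'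
    linear_combination (x0 - x1) * hcD + (x2 - x1) * hD - (y1 - y0) * h
  have hy : y2 - y1 = c * (y1 - y0) := by
    apply mul_right_cancel₀ hd.ne'
    linear_combination (y0 - y1) * hcD + (y2 - y1) * hD + (x1 - x0) * h
  refine ⟨c, ?_, ?_⟩
  · by_contra hneg
    rcases (not_lt.1 hneg).eq_or_lt with rfl | hneg
    · rw [hx, hy] at hd2; simp at hd2
    · -- the two edges at the corner would overlap
      -- The positions of the common point on the two edges, measured from the corner, are `β` and
      -- `-β * c`. They sum to `1 / 2`, so neither reaches the far end.
      set β : ℝ := 1 / (1 - c) / 2 with hβ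
      have h1c : 0 < 1 - c := by linarith
      have hβ0 : 0 < β := by positivity
      have hβc : β * (1 - c) = 1 / 2 := by rw [hβ]; field_simp
      have hpl := Set.disjoint_left.1 (P.planar e (e + 1) (Ne.symm (P.succ_ne e)))
      refine @hpl (x1 + β * (x2 - x1), y1 + β * (y2 - y1)) ?_ ?_
      · rw [h0, h1]
        refine ⟨-(β * c), 1 + β * c, ?_, ?_, by ring, ?_⟩
        · nlinarith
        · nlinarith
        · ext <;> simp [hx, hy] <;> ring
      · rw [h1, h2]
        refine ⟨1 - β, β, ?_, hβ0.le, by ring, ?_⟩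
        · nlinarith
        · ext <;> simp <;> ring
  · intro q
    rw [hx, hy]
    ring

theorem cross_succ_of_mem {e : P.Idx} {q : ℝ × ℝ} {a b : ℝ} (hab : a + b = 1)
    (hq : a • P.vertex e + b • P.vertex (e + 1) = q) : P.cross (e + 1) q = a * P.turn e := by
  obtain rfl : b = 1 - a := by linarith
  subst hq
  simp [turn, cross]; ring

theorem cross_of_mem_succ {e : P.Idx} {q : ℝ × ℝ} {a b : ℝ} (hab : a + b = 1)
    (hq : a • P.vertex (e + 1) + b • P.vertex (e + 1 + 1) = q) : P.cross e q = b * P.turn e := by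
  subst hq
  rw [P.cross_combo e _ _ a b hab, cross_end, turn]; ring

/-- In the convex case, `t` lies strictly on side `σ` of the next edge, or else the two half-planes
coincide because the corner is straight. -/
theorem sideIn_sector {σ : ℝ} {e : P.Idx} {t : ℝ × ℝ}
    (ht : t ∈ openSegment ℝ (P.vertex e) (P.vertex (e + 1))) :
    P.SideIn σ e t (P.sector σ e) := by
  unfold sector
  split_ifs with h
  · refine P.sideIn_side.inter ?_
    rcases h.lt_or_eq with h | h
    · refine P.sideIn_of_mem_nhds ((P.isOpen_side σ (e + 1)).mem_nhds ?_)
      obtain ⟨a, b, ha, hb, hab, ht⟩ := ht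
      simp only [side, mem_ofPred_eq, P.cross_succ_of_mem hab ht]
      nlinarith
    · rcases mul_eq_zero.1 h with rfl | h
      · refine P.sideIn_side.mono ?_
        intro q hq; simp [side] at hq
      · obtain ⟨c, hc, hcr⟩ := P.cross_succ_of_turn_eq_zero h
        refine P.sideIn_side.mono ?_
        intro q hq
        simp only [side, mem_ofPred_eq, hcr] at hq ⊢
        nlinarith
  · exact P.sideIn_side.mono subset_union_left

theorem sideIn_succ_sector {σ : ℝ} {e : P.Idx} {t : ℝ × ℝ}
    (ht : t ∈ openSegment ℝ (P.vertex (e + 1)) (P.vertex (e + 1 + 1))) :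
    P.SideIn σ (e + 1) t (P.sector σ e) := by
  unfold sector
  split_ifs with h
  · refine SideIn.inter ?_ P.sideIn_side
    rcases h.lt_or_eq with h | h
    · refine P.sideIn_of_mem_nhds ((P.isOpen_side σ e).mem_nhds ?_)
      obtain ⟨a, b, ha, hb, hab, ht⟩ := ht
      simp only [side, mem_ofPred_eq, P.cross_of_mem_succ hab ht]
      nlinarith
    · rcases mul_eq_zero.1 h with rfl | h
      · refine P.sideIn_side.mono ?_
        intro q hq; simp [side] at hq
      · obtain ⟨c, hc, hcr⟩ := P.cross_succ_of_turn_eq_zero h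
        refine P.sideIn_side.mono ?_
        intro q hq
        simp only [side, mem_ofPred_eq, hcr] at hq ⊢
        by_contra hcon
        nlinarith [mul_nonneg hc.le (not_lt.1 hcon)]
  · exact P.sideIn_side.mono subset_union_right

theorem sector_disjoint_edges {σ : ℝ} {e : P.Idx} {q : ℝ × ℝ} (hq : q ∈ P.sector σ e) :
    q ∉ segment ℝ (P.vertex e) (P.vertex (e + 1)) ∧
      q ∉ segment ℝ (P.vertex (e + 1)) (P.vertex (e + 1 + 1)) := by
  unfold sector at hq
  split_ifs at hq with h
  · refine ⟨fun hs => ?_, fun hs => ?_⟩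
    · have := P.cross_eq_zero_of_mem hs
      simp [side, this] at hq
    · have := P.cross_eq_zero_of_mem hs
      simp [side, this] at hq
  · refine ⟨fun hs => ?_, fun hs => ?_⟩
    · have h0 := P.cross_eq_zero_of_mem hs
      obtain ⟨a, b, ha, hb, hab, hs⟩ := hs
      have h1 := P.cross_succ_of_mem hab hs
      simp only [side, mem_union, mem_ofPred_eq, h0, h1] at hq
      rcases hq with hq | hq <;> nlinarith
    · have h0 := P.cross_eq_zero_of_mem hs
      obtain ⟨a, b, ha, hb, hab, hs⟩ := hs
      have h1 := P.cross_of_mem_succ hab hs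
      simp only [side, mem_union, mem_ofPred_eq, h0, h1] at hq
      rcases hq with hq | hq <;> nlinarith

/-- At a proper turn the intersection for one sign faces the union for the other; at a straight
corner both sectors are opposite half-planes. -/
theorem mem_sector_or {σ : ℝ} (hσ : σ ≠ 0) {e : P.Idx} {q : ℝ × ℝ} (h0 : P.cross e q ≠ 0)
    (h1 : P.cross (e + 1) q ≠ 0) : q ∈ P.sector σ e ∨ q ∈ P.sector (-σ) e := by
  have h0' : σ * P.cross e q ≠ 0 := mul_ne_zero hσ h0
  have h1' : σ * P.cross (e + 1) q ≠ 0 := mul_ne_zero hσ h1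
  unfold sector
  rcases lt_trichotomy (σ * P.turn e) 0 with h | h | h
  · rw [if_pos h.le, if_neg (by linarith)]
    simp only [side, mem_inter_iff, mem_union, mem_ofPred_eq]
    rcases lt_or_gt_of_ne h0' with h2 | h2
    · rcases lt_or_gt_of_ne h1' with h3 | h3
      · exact Or.inl ⟨h2, h3⟩
      · exact Or.inr (Or.inr (by linarith))
    · exact Or.inr (Or.inl (by linarith))
  · rw [if_pos h.le, if_pos (by linarith)]
    obtain ⟨c, hc, hcr⟩ := P.cross_succ_of_turn_eq_zero ((mul_eq_zero.1 h).resolve_left hσ)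
    simp only [side, mem_inter_iff, mem_ofPred_eq, hcr]
    rcases lt_or_gt_of_ne h0' with h2 | h2
    · exact Or.inl ⟨h2, by nlinarith⟩
    · exact Or.inr ⟨by linarith, by nlinarith⟩
  · rw [if_neg (by linarith), if_pos (by linarith)]
    simp only [side, mem_inter_iff, mem_union, mem_ofPred_eq]
    rcases lt_or_gt_of_ne h0' with h2 | h2
    · exact Or.inl (Or.inl h2)
    · rcases lt_or_gt_of_ne h1' with h3 | h3
      · exact Or.inl (Or.inr h3)
      · exact Or.inr ⟨by linarith, by linarith⟩

theorem isPreconnected_sector_inter_ball (σ : ℝ) (e : P.Idx) {r : ℝ} (hr : 0 < r) :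
    IsPreconnected (P.sector σ e ∩ Metric.ball (P.vertex (e + 1)) r) := by
  have hball := convex_ball (P.vertex (e + 1)) r
  unfold sector
  split_ifs with h
  · exact (((P.convex_side σ e).inter (P.convex_side σ (e + 1))).inter hball).isPreconnected
  · rw [union_inter_distrib_right]
    -- The incoming direction minus the outgoing one points into the reflex angle, so the two
    -- half-discs have a common point and their union is connected.
    set f : ℝ → ℝ × ℝ := fun s => P.vertex (e + 1) +
      s • ((P.vertex (e + 1) - P.vertex e) - (P.vertex (e + 1 + 1) - P.vertex (e + 1))) with hf
    have hcont : Tendsto f (𝓝[>] 0) (𝓝 (P.vertex (e + 1))) := by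
      have : Continuous f := by fun_prop
      have h0 : f 0 = P.vertex (e + 1) := by simp [hf]
      exact h0 ▸ this.continuousAt.tendsto.mono_left nhdsWithin_le_nhds
    obtain ⟨s, hsb, hs⟩ := ((hcont.eventually (Metric.ball_mem_nhds _ hr)).and
      self_mem_nhdsWithin).exists
    have hs : 0 < s := hs
    have hs0 : P.cross e (f s) = -(s * P.turn e) := by
      simp [hf, turn, cross]; ring
    have hs1 : P.cross (e + 1) (f s) = -(s * P.turn e) := by
      simp [hf, turn, cross]; ring
    refine IsPreconnected.union (f s) ⟨?_, hsb⟩ ⟨?_, hsb⟩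
      ((P.convex_side σ e).inter hball).isPreconnected
      ((P.convex_side σ (e + 1)).inter hball).isPreconnected
    · simp only [side, mem_ofPred_eq, hs0]; nlinarith
    · simp only [side, mem_ofPred_eq, hs1]; nlinarith

end SimplePolygon
namespace SimplePolygon

open Set Filter Topology

variable (P : SimplePolygon)

/-! ### Following one side of the polygon -/

/-- A half-disc at `t` is convex, hence connected, and cannot meet both parts. -/
theorem sideIn_or {σ : ℝ} {e : P.Idx} {t : ℝ × ℝ} {A B : Set (ℝ × ℝ)} (hA : IsOpen A)
    (hB : IsOpen B) (hAB : Disjoint A B) (h : P.SideIn σ e t (A ∪ B)) :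
    P.SideIn σ e t A ∨ P.SideIn σ e t B := by
  obtain ⟨r, hr, hsub⟩ := Metric.mem_nhdsWithin_iff.1 h
  have hpre : IsPreconnected (Metric.ball t r ∩ P.side σ e) :=
    ((convex_ball t r).inter (P.convex_side σ e)).isPreconnected
  rcases hpre.subset_or_subset hA hB hAB hsub with h1 | h1
  · exact Or.inl (Metric.mem_nhdsWithin_iff.2 ⟨r, hr, h1⟩)
  · exact Or.inr (Metric.mem_nhdsWithin_iff.2 ⟨r, hr, h1⟩)

/-- The points of the edge whose side lies in `A` and those whose side lies in `B` form disjoint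
open sets covering a connected piece of the edge. The window `W` is the whole plane for the Jordan
curve theorem and a vertical strip when segments are compared. -/
theorem SideIn.along_edge {P : SimplePolygon} {σ : ℝ} (hσ : σ ≠ 0) {W A B : Set (ℝ × ℝ)}
    (hW : Convex ℝ W) (hWo : IsOpen W) (hA : IsOpen A) (hB : IsOpen B) (hAB : Disjoint A B)
    (hcov : W ∩ P.curveᶜ ⊆ A ∪ B) {e : P.Idx} {t t' : ℝ × ℝ}
    (ht : t ∈ openSegment ℝ (P.vertex e) (P.vertex (e + 1))) (htW : t ∈ W)
    (ht' : t' ∈ openSegment ℝ (P.vertex e) (P.vertex (e + 1))) (htW' : t' ∈ W)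
    (h : P.SideIn σ e t A) : P.SideIn σ e t' A := by
  have hpre : IsPreconnected (openSegment ℝ (P.vertex e) (P.vertex (e + 1)) ∩ W) :=
    ((convex_openSegment _ _).inter hW).isPreconnected
  have hor : ∀ s ∈ openSegment ℝ (P.vertex e) (P.vertex (e + 1)) ∩ W,
      P.SideIn σ e s A ∨ P.SideIn σ e s B := fun s hs =>
    P.sideIn_or hA hB hAB
      (((P.sideIn_of_mem_nhds (hWo.mem_nhds hs.2)).inter (P.sideIn_compl_curve hs.1)).mono hcov)
  by_contra hcon
  obtain ⟨s, hs, hsA, hsB⟩ := hpre _ _ (P.isOpen_setOf_sideIn σ e A) (P.isOpen_setOf_sideIn σ e B)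
    (fun s hs => hor s hs) ⟨t, ⟨ht, htW⟩, h⟩
    ⟨t', ⟨ht', htW'⟩, (hor t' ⟨ht', htW'⟩).resolve_left hcon⟩
  exact SideIn.not_disjoint hσ (P.cross_of_mem_openSegment hs.1) hsA hsB hAB

theorem exists_ball_sector (e : P.Idx) {W : Set (ℝ × ℝ)} (hW : W ∈ 𝓝 (P.vertex (e + 1))) :
    ∃ r > 0, Metric.ball (P.vertex (e + 1)) r ⊆ W ∧
      ∀ σ : ℝ, P.sector σ e ∩ Metric.ball (P.vertex (e + 1)) r ⊆ W ∩ P.curveᶜ := by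
  obtain ⟨r, hr, hsub⟩ := Metric.mem_nhds_iff.1
    (inter_mem hW (P.eventually_edges_of_vertex e))
  refine ⟨r, hr, fun q hq => (hsub hq).1, fun σ q hq => ⟨(hsub hq.2).1, fun hc => ?_⟩⟩
  have h1 := P.sector_disjoint_edges hq.1
  rcases (hsub hq.2).2 hc with h | h
  · exact h1.1 h
  · exact h1.2 h

theorem exists_sector_dichotomy (σ : ℝ) {W A B : Set (ℝ × ℝ)} (hA : IsOpen A) (hB : IsOpen B)
    (hAB : Disjoint A B) (hcov : W ∩ P.curveᶜ ⊆ A ∪ B) (e : P.Idx)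
    (hW : W ∈ 𝓝 (P.vertex (e + 1))) :
    ∃ r > 0, Metric.ball (P.vertex (e + 1)) r ⊆ W ∧
      (P.sector σ e ∩ Metric.ball (P.vertex (e + 1)) r ⊆ A ∨
        P.sector σ e ∩ Metric.ball (P.vertex (e + 1)) r ⊆ B) := by
  obtain ⟨r, hr, hrW, hsub⟩ := P.exists_ball_sector e hW
  exact ⟨r, hr, hrW, (P.isPreconnected_sector_inter_ball σ e hr).subset_or_subset hA hB hAB
    ((hsub σ).trans hcov)⟩

theorem exists_openSegment_mem_of_start (e : P.Idx) {U : Set (ℝ × ℝ)}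
    (hU : U ∈ 𝓝 (P.vertex e)) :
    ∃ t ∈ openSegment ℝ (P.vertex e) (P.vertex (e + 1)), t ∈ U := by
  have h : P.vertex e ∈ closure (openSegment ℝ (P.vertex e) (P.vertex (e + 1))) :=
    segment_subset_closure_openSegment (left_mem_segment ℝ _ _)
  obtain ⟨t, htU, ht⟩ := mem_closure_iff_nhds.1 h U hU
  exact ⟨t, ht, htU⟩

theorem exists_openSegment_mem_of_end (e : P.Idx) {U : Set (ℝ × ℝ)}
    (hU : U ∈ 𝓝 (P.vertex (e + 1))) :
    ∃ t ∈ openSegment ℝ (P.vertex e) (P.vertex (e + 1)), t ∈ U := by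
  have h : P.vertex (e + 1) ∈ closure (openSegment ℝ (P.vertex e) (P.vertex (e + 1))) :=
    segment_subset_closure_openSegment (right_mem_segment ℝ _ _)
  obtain ⟨t, htU, ht⟩ := mem_closure_iff_nhds.1 h U hU
  exact ⟨t, ht, htU⟩

/-- Within `W`, side `σ` of the edge `e` lies in `A`. -/
def EdgeSideIn (W : Set (ℝ × ℝ)) (σ : ℝ) (e : P.Idx) (A : Set (ℝ × ℝ)) : Prop :=
  ∀ t ∈ openSegment ℝ (P.vertex e) (P.vertex (e + 1)), t ∈ W → P.SideIn σ e t A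

/-- Both edges at the corner border the same sector, which near the corner is connected and avoids
the curve, so it lies entirely in `A` or in `B`. -/
theorem edgeSideIn_succ_iff {σ : ℝ} (hσ : σ ≠ 0) {W A B : Set (ℝ × ℝ)}
    (hW : Convex ℝ W) (hWo : IsOpen W) (hA : IsOpen A) (hB : IsOpen B) (hAB : Disjoint A B)
    (hcov : W ∩ P.curveᶜ ⊆ A ∪ B) {e : P.Idx} (hv : P.vertex (e + 1) ∈ W) :
    P.EdgeSideIn W σ e A ↔ P.EdgeSideIn W σ (e + 1) A := by
  obtain ⟨r, hr, hrW, hd⟩ := P.exists_sector_dichotomy σ hA hB hAB hcov e (hWo.mem_nhds hv)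
  obtain ⟨t, ht, htb⟩ := P.exists_openSegment_mem_of_end e (Metric.ball_mem_nhds _ hr)
  obtain ⟨s, hs, hsb⟩ := P.exists_openSegment_mem_of_start (e + 1) (Metric.ball_mem_nhds _ hr)
  have h1 : P.SideIn σ e t (P.sector σ e ∩ Metric.ball (P.vertex (e + 1)) r) :=
    (P.sideIn_sector ht).inter (P.sideIn_of_mem_nhds (Metric.isOpen_ball.mem_nhds htb))
  have h2 : P.SideIn σ (e + 1) s (P.sector σ e ∩ Metric.ball (P.vertex (e + 1)) r) :=
    (P.sideIn_succ_sector hs).inter (P.sideIn_of_mem_nhds (Metric.isOpen_ball.mem_nhds hsb))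
  constructor
  · intro h
    rcases hd with hd | hd
    · intro s' hs' hsW'
      exact (h2.mono hd).along_edge hσ hW hWo hA hB hAB hcov hs (hrW hsb) hs' hsW'
    · exact absurd hAB (SideIn.not_disjoint hσ (P.cross_of_mem_openSegment ht)
        (h t ht (hrW htb)) (h1.mono hd))
  · intro h
    rcases hd with hd | hd
    · intro s' hs' hsW'
      exact (h1.mono hd).along_edge hσ hW hWo hA hB hAB hcov ht (hrW htb) hs' hsW'
    · exact absurd hAB (SideIn.not_disjoint hσ (P.cross_of_mem_openSegment hs)
        (h s hs (hrW hsb)) (h2.mono hd))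

theorem exists_mem_openSegment (e : P.Idx) :
    ∃ t, t ∈ openSegment ℝ (P.vertex e) (P.vertex (e + 1)) :=
  let ⟨t, ht, _⟩ := P.exists_openSegment_mem_of_start e univ_mem
  ⟨t, ht⟩

/-- The part to which the side belongs is carried from edge to edge around all corners, starting
from edge `0`. -/
theorem edgeSideIn_univ_or {σ : ℝ} (hσ : σ ≠ 0) {A B : Set (ℝ × ℝ)} (hA : IsOpen A)
    (hB : IsOpen B) (hAB : Disjoint A B) (hcov : P.curveᶜ ⊆ A ∪ B) :
    (∀ e, P.EdgeSideIn univ σ e A) ∨ (∀ e, P.EdgeSideIn univ σ e B) := by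
  have key : ∀ A B : Set (ℝ × ℝ), IsOpen A → IsOpen B → Disjoint A B → P.curveᶜ ⊆ A ∪ B →
      P.EdgeSideIn univ σ 0 A → ∀ e, P.EdgeSideIn univ σ e A := by
    intro A B hA hB hAB hcov h0 e
    induction e using Fin.induction with
    | zero => exact h0
    | succ i ih =>
      have := (P.edgeSideIn_succ_iff hσ convex_univ isOpen_univ hA hB hAB (by simpa using hcov)
        (mem_univ _)).1 ih
      rwa [Fin.coeSucc_eq_succ] at this
  obtain ⟨t, ht⟩ := P.exists_mem_openSegment 0
  rcases P.sideIn_or hA hB hAB ((P.sideIn_compl_curve (σ := σ) ht).mono hcov) with h | h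
  · exact Or.inl (key A B hA hB hAB hcov fun s hs _ => h.along_edge hσ convex_univ isOpen_univ
      hA hB hAB (by simpa using hcov) ht (mem_univ _) hs (mem_univ _))
  · have hcov' : P.curveᶜ ⊆ B ∪ A := by rwa [union_comm]
    exact Or.inr (key B A hB hA hAB.symm hcov' fun s hs _ => h.along_edge hσ convex_univ
      isOpen_univ hB hA hAB.symm (by simpa using hcov') ht (mem_univ _) hs (mem_univ _))

/-! ### Edges as graphs of functions -/

/-- The left end of the edge `e`. -/
noncomputable def leftX (e : P.Idx) : ℝ := min (P.vertex e).1 (P.vertex (e + 1)).1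

/-- The right end of the edge `e`. -/
noncomputable def rightX (e : P.Idx) : ℝ := max (P.vertex e).1 (P.vertex (e + 1)).1

theorem edgeIco_eq (e : P.Idx) : P.edgeIco e = Ico (P.leftX e) (P.rightX e) := rfl

theorem leftX_lt_rightX {e : P.Idx} : P.leftX e < P.rightX e ↔ ¬ P.VerticalEdge e := by
  simp [leftX, rightX, VerticalEdge, eq_comm]

theorem not_vertical_of_mem_edgeIco {e : P.Idx} {x : ℝ} (h : x ∈ P.edgeIco e) :
    ¬ P.VerticalEdge e :=
  P.leftX_lt_rightX.1 (h.1.trans_lt h.2)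

theorem continuous_edgeHeight (e : P.Idx) : Continuous (P.edgeHeight e) := by
  unfold edgeHeight; fun_prop

/-- This translates left and right of an edge into above and below, according to the horizontal
direction of the edge. -/
theorem cross_eq {e : P.Idx} (he : ¬ P.VerticalEdge e) (q : ℝ × ℝ) :
    P.cross e q = ((P.vertex (e + 1)).1 - (P.vertex e).1) * (q.2 - P.edgeHeight e q.1) := by
  have : (P.vertex (e + 1)).1 - (P.vertex e).1 ≠ 0 := fun h => he (by
    unfold VerticalEdge; linarith)
  simp only [cross, edgeHeight, edgeSlope]
  field_simp
  ring

theorem edgeHeight_start (e : P.Idx) : P.edgeHeight e (P.vertex e).1 = (P.vertex e).2 := by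
  simp [edgeHeight]

theorem edgeHeight_end {e : P.Idx} (he : ¬ P.VerticalEdge e) :
    P.edgeHeight e (P.vertex (e + 1)).1 = (P.vertex (e + 1)).2 := by
  have : (P.vertex (e + 1)).1 - (P.vertex e).1 ≠ 0 := fun h => he (by
    unfold VerticalEdge; linarith)
  simp only [edgeHeight, edgeSlope]
  field_simp
  ring

theorem edgeHeight_combo (e : P.Idx) {a b x y : ℝ} (h : a + b = 1) :
    P.edgeHeight e (a * x + b * y) = a * P.edgeHeight e x + b * P.edgeHeight e y := by
  obtain rfl : b = 1 - a := by linarith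
  simp only [edgeHeight]; ring

theorem mem_edge_iff {e : P.Idx} (he : ¬ P.VerticalEdge e) {q : ℝ × ℝ} :
    q ∈ segment ℝ (P.vertex e) (P.vertex (e + 1)) ↔
      q.1 ∈ Icc (P.leftX e) (P.rightX e) ∧ q.2 = P.edgeHeight e q.1 := by
  have hx : q.1 ∈ Icc (P.leftX e) (P.rightX e) ↔
      q.1 ∈ segment ℝ (P.vertex e).1 (P.vertex (e + 1)).1 := by
    rw [segment_eq_uIcc]; rfl
  rw [hx]
  constructor
  · rintro ⟨a, b, ha, hb, hab, rfl⟩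
    refine ⟨⟨a, b, ha, hb, hab, rfl⟩, ?_⟩
    simp only [Prod.fst_add, Prod.snd_add, Prod.smul_fst, Prod.smul_snd, smul_eq_mul]
    rw [P.edgeHeight_combo e hab, edgeHeight_start, P.edgeHeight_end he]
  · rintro ⟨⟨a, b, ha, hb, hab, h1⟩, h2⟩
    refine ⟨a, b, ha, hb, hab, Prod.ext h1 ?_⟩
    rw [h2, ← h1]
    simp only [smul_eq_mul, Prod.snd_add, Prod.smul_snd]
    rw [P.edgeHeight_combo e hab, edgeHeight_start, P.edgeHeight_end he]

theorem mem_openEdge_iff {e : P.Idx} (he : ¬ P.VerticalEdge e) {q : ℝ × ℝ} :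
    q ∈ openSegment ℝ (P.vertex e) (P.vertex (e + 1)) ↔
      q.1 ∈ Ioo (P.leftX e) (P.rightX e) ∧ q.2 = P.edgeHeight e q.1 := by
  have hx : q.1 ∈ Ioo (P.leftX e) (P.rightX e) ↔
      q.1 ∈ openSegment ℝ (P.vertex e).1 (P.vertex (e + 1)).1 := by
    unfold leftX rightX
    rcases lt_or_gt_of_ne (show (P.vertex e).1 ≠ (P.vertex (e + 1)).1 from he) with h | h
    · rw [openSegment_eq_Ioo h, min_eq_left h.le, max_eq_right h.le]
    · rw [openSegment_symm, openSegment_eq_Ioo h, min_eq_right h.le, max_eq_left h.le]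
  rw [hx]
  constructor
  · rintro ⟨a, b, ha, hb, hab, rfl⟩
    refine ⟨⟨a, b, ha, hb, hab, rfl⟩, ?_⟩
    simp only [Prod.fst_add, Prod.snd_add, Prod.smul_fst, Prod.smul_snd, smul_eq_mul]
    rw [P.edgeHeight_combo e hab, edgeHeight_start, P.edgeHeight_end he]
  · rintro ⟨⟨a, b, ha, hb, hab, h1⟩, h2⟩
    refine ⟨a, b, ha, hb, hab, Prod.ext h1 ?_⟩
    rw [h2, ← h1]
    simp only [smul_eq_mul, Prod.snd_add, Prod.smul_snd]
    rw [P.edgeHeight_combo e hab, edgeHeight_start, P.edgeHeight_end he]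

theorem mem_verticalEdge_iff {e : P.Idx} (he : P.VerticalEdge e) {q : ℝ × ℝ} :
    q ∈ segment ℝ (P.vertex e) (P.vertex (e + 1)) ↔
      q.1 = (P.vertex e).1 ∧ q.2 ∈ uIcc (P.vertex e).2 (P.vertex (e + 1)).2 := by
  rw [← segment_eq_uIcc]
  unfold VerticalEdge at he
  constructor
  · rintro ⟨a, b, ha, hb, hab, rfl⟩
    refine ⟨?_, ⟨a, b, ha, hb, hab, rfl⟩⟩
    simp only [Prod.fst_add, Prod.smul_fst, smul_eq_mul, ← he]
    rw [← add_mul, hab, one_mul]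
  · rintro ⟨h1, ⟨a, b, ha, hb, hab, h2⟩⟩
    refine ⟨a, b, ha, hb, hab, Prod.ext ?_ h2⟩
    simp only [Prod.fst_add, Prod.smul_fst, smul_eq_mul, ← he]
    rw [← add_mul, hab, one_mul, h1]

/-! ### Counting crossings with the upward ray -/

open Classical in
/-- `1` if the upward ray from `p` crosses the edge `e`, and `0` otherwise. -/
noncomputable def rayInd (e : P.Idx) (p : ℝ × ℝ) : ZMod 2 :=
  if p.1 ∈ P.edgeIco e ∧ p.2 < P.edgeHeight e p.1 then 1 else 0

open Classical in
/-- `1` if the corner `i` lies vertically above `p`, and `0` otherwise. -/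
noncomputable def endInd (p : ℝ × ℝ) (i : P.Idx) : ZMod 2 :=
  if (P.vertex i).1 = p.1 ∧ p.2 < (P.vertex i).2 then 1 else 0

/-- The parity of the number of edges that cross the upward ray from `p`. -/
noncomputable def rayParity (p : ℝ × ℝ) : ZMod 2 := ∑ e, P.rayInd e p

open Classical in
-- As the interval is half-open, a small move of `p` to the right changes nothing. A move to the
-- left loses a graph that starts above `p` and gains one that ends above `p`; modulo `2` both
-- corrections are `+1`.
theorem eventually_ray_graph {a b : ℝ} (hab : a < b) {h : ℝ → ℝ} (hc : Continuous h)
    {p : ℝ × ℝ} (hp : ¬ (p.1 ∈ Icc a b ∧ p.2 = h p.1)) :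
    ∀ᶠ q : ℝ × ℝ in 𝓝 p,
      (if q.1 ∈ Ico a b ∧ q.2 < h q.1 then 1 else 0 : ZMod 2) =
        (if p.1 ∈ Ico a b ∧ p.2 < h p.1 then 1 else 0) +
          if q.1 < p.1 then (if a = p.1 ∧ p.2 < h a then 1 else 0) +
            (if b = p.1 ∧ p.2 < h b then 1 else 0) else 0 := by
  have lt1 : ∀ c, p.1 < c → ∀ᶠ q : ℝ × ℝ in 𝓝 p, q.1 < c := fun c hc =>
    (continuous_fst.tendsto p).eventually (gt_mem_nhds hc)
  have gt1 : ∀ c, c < p.1 → ∀ᶠ q : ℝ × ℝ in 𝓝 p, c < q.1 := fun c hc =>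
    (continuous_fst.tendsto p).eventually (lt_mem_nhds hc)
  rcases lt_or_ge p.1 a with h1 | h1
  · filter_upwards [lt1 a h1] with q hq
    have : ¬ a ≤ q.1 := not_le.2 hq
    have : ¬ a ≤ p.1 := not_le.2 h1
    have : a ≠ p.1 := h1.ne'
    have : b ≠ p.1 := (h1.trans hab).ne'
    simp [*]
  rcases lt_or_ge b p.1 with h2 | h2
  · filter_upwards [gt1 b h2] with q hq
    have : ¬ q.1 < b := not_lt.2 hq.le
    have : ¬ p.1 < b := not_lt.2 h2.le
    have : a ≠ p.1 := (hab.trans h2).ne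
    have : b ≠ p.1 := h2.ne
    simp [*]
  have hne : p.2 ≠ h p.1 := fun h3 => hp ⟨⟨h1, h2⟩, h3⟩
  have hst : ∀ᶠ q : ℝ × ℝ in 𝓝 p, (q.2 < h q.1 ↔ p.2 < h p.1) := by
    rcases lt_or_gt_of_ne hne with h3 | h3
    · filter_upwards [(isOpen_lt continuous_snd (hc.comp continuous_fst)).mem_nhds h3] with q hq
      exact ⟨fun _ => h3, fun _ => hq⟩
    · filter_upwards [(isOpen_lt (hc.comp continuous_fst) continuous_snd).mem_nhds h3] with q hq
      have hq : h q.1 < q.2 := hq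
      exact ⟨fun h4 => absurd h4 (not_lt.2 hq.le), fun h4 => absurd h4 (not_lt.2 h3.le)⟩
  rcases h1.eq_or_lt with rfl | h1
  · filter_upwards [lt1 b hab, hst] with q hq hs
    have : b ≠ p.1 := hab.ne'
    by_cases h4 : q.1 < p.1
    · have : ¬ p.1 ≤ q.1 := not_le.2 h4
      simp only [mem_Ico, *]
      split_ifs <;> simp_all
      rfl
    · have : p.1 ≤ q.1 := not_lt.1 h4
      simp [*]
  rcases h2.eq_or_lt with rfl | h2
  · filter_upwards [gt1 a hab, hst] with q hq hs
    have : a ≠ p.1 := hab.ne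
    by_cases h4 : q.1 < p.1
    · simp [*, hq.le]
    · simp [*]
  · filter_upwards [gt1 a h1, lt1 b h2, hst] with q hq1 hq2 hs
    have : a ≠ p.1 := h1.ne
    have : b ≠ p.1 := h2.ne'
    simp [*, hq1.le, h1.le]

theorem eventually_rayInd (e : P.Idx) {p : ℝ × ℝ}
    (hp : p ∉ segment ℝ (P.vertex e) (P.vertex (e + 1))) :
    ∀ᶠ q : ℝ × ℝ in 𝓝 p, P.rayInd e q =
      P.rayInd e p + if q.1 < p.1 then P.endInd p e + P.endInd p (e + 1) else 0 := by
  by_cases he : P.VerticalEdge e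
  · have h0 : ∀ q, P.rayInd e q = 0 := fun q =>
      if_neg fun h => P.not_vertical_of_mem_edgeIco h.1 he
    -- Since `p` is not on the vertical edge, both ends or neither lie above `p`, and the two
    -- corrections cancel.
    have hends : P.endInd p e = P.endInd p (e + 1) := by
      rw [P.mem_verticalEdge_iff he] at hp
      unfold VerticalEdge at he
      unfold endInd
      rw [← he]
      by_cases h1 : (P.vertex e).1 = p.1
      · have h2 : p.2 ∉ uIcc (P.vertex e).2 (P.vertex (e + 1)).2 := fun h => hp ⟨h1.symm, h⟩
        have h3 : p.2 < (P.vertex e).2 ↔ p.2 < (P.vertex (e + 1)).2 := by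
          rw [mem_uIcc] at h2
          push Not at h2
          constructor <;> intro h3 <;> by_contra h4
          · exact absurd (h2.2 (not_lt.1 h4)) (not_lt.2 h3.le)
          · exact absurd (h2.1 (not_lt.1 h4)) (not_lt.2 h3.le)
        simp only [h3]
      · simp [h1]
    refine Eventually.of_forall fun q => ?_
    rw [h0, h0, hends, CharTwo.add_self_eq_zero]
    simp
  · rw [P.mem_edge_iff he] at hp
    have := eventually_ray_graph (P.leftX_lt_rightX.2 he) (P.continuous_edgeHeight e) hp
    filter_upwards [this] with q hq
    have hr : ∀ p, P.rayInd e p =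
        if p.1 ∈ Ico (P.leftX e) (P.rightX e) ∧ p.2 < P.edgeHeight e p.1 then 1 else 0 := by
      intro p; simp only [rayInd, edgeIco_eq]; congr
    rw [hr, hr, hq]
    congr 2
    unfold endInd
    rcases lt_or_ge (P.vertex e).1 (P.vertex (e + 1)).1 with h | h
    · rw [show P.leftX e = (P.vertex e).1 from min_eq_left h.le,
        show P.rightX e = (P.vertex (e + 1)).1 from max_eq_right h.le, edgeHeight_start,
        P.edgeHeight_end he]
    · rw [show P.leftX e = (P.vertex (e + 1)).1 from min_eq_right h,
        show P.rightX e = (P.vertex e).1 from max_eq_left h, edgeHeight_start,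
        P.edgeHeight_end he, add_comm]

/-- Every corner is an end of exactly two edges. Hence the corrections for moves to the left cancel,
and ray parity is locally constant off the curve. -/
theorem sum_endInd (p : ℝ × ℝ) : ∑ e, (P.endInd p e + P.endInd p (e + 1)) = 0 := by
  rw [Finset.sum_add_distrib, show ∑ e, P.endInd p (e + 1) = ∑ e, P.endInd p e from
    Equiv.sum_comp (Equiv.addRight (1 : P.Idx)) (P.endInd p), CharTwo.add_self_eq_zero]

theorem eventually_rayParity {p : ℝ × ℝ} (hp : p ∉ P.curve) :
    ∀ᶠ q in 𝓝 p, P.rayParity q = P.rayParity p := by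
  have : ∀ᶠ q in 𝓝 p, ∀ e, P.rayInd e q =
      P.rayInd e p + if q.1 < p.1 then P.endInd p e + P.endInd p (e + 1) else 0 :=
    eventually_all.2 fun e => P.eventually_rayInd e fun h => hp (P.segment_subset_curve e h)
  filter_upwards [this] with q hq
  simp only [rayParity, hq]
  rw [Finset.sum_add_distrib]
  split_ifs
  · rw [P.sum_endInd, add_zero]
  · simp

/-- Near `t`, the other edges contribute a constant plus their corrections, and by `sum_endInd`
these add up to the corrections at the ends of `e`. So the term of `e` with its own corrections
decides, and it differs between the two sides. -/
theorem eventually_rayParity_edge {e : P.Idx} {t : ℝ × ℝ}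
    (ht : t ∈ openSegment ℝ (P.vertex e) (P.vertex (e + 1))) :
    ∃ c : ZMod 2, (P.SideIn 1 e t {q | P.rayParity q = c}) ∧
      P.SideIn (-1) e t {q | P.rayParity q = c + 1} := by
  classical
  have hall : ∀ᶠ q in 𝓝 t, ∀ f, f ≠ e → P.rayInd f q =
      P.rayInd f t + if q.1 < t.1 then P.endInd t f + P.endInd t (f + 1) else 0 :=
    eventually_all.2 fun f => by
      by_cases hf : f = e
      · simp [hf]
      · simpa [hf] using P.eventually_rayInd f (P.notMem_edge_of_ne (Ne.symm hf) ht)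
  set C := ∑ f ∈ Finset.univ.erase e, P.rayInd f t with hC
  have hsum : ∑ f ∈ Finset.univ.erase e, (P.endInd t f + P.endInd t (f + 1)) =
      P.endInd t e + P.endInd t (e + 1) := by
    have h := Finset.add_sum_erase Finset.univ (fun f => P.endInd t f + P.endInd t (f + 1))
      (Finset.mem_univ e)
    rw [P.sum_endInd] at h
    exact (CharTwo.add_eq_zero.1 h).symm
  have hpar : ∀ᶠ q in 𝓝 t, P.rayParity q = C + (P.rayInd e q +
      if q.1 < t.1 then P.endInd t e + P.endInd t (e + 1) else 0) := by
    filter_upwards [hall] with q hq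
    rw [rayParity, ← Finset.add_sum_erase Finset.univ _ (Finset.mem_univ e),
      Finset.sum_congr rfl fun f hf => hq f (Finset.ne_of_mem_erase hf), Finset.sum_add_distrib]
    split_ifs
    · rw [hsum]; ring
    · rw [Finset.sum_const_zero]; ring
  -- which side of the edge is counted
  obtain ⟨τ, hτ, hcount⟩ : ∃ τ : ℝ, (τ = 1 ∨ τ = -1) ∧ ∀ᶠ q in 𝓝 t, P.cross e q ≠ 0 →
      (P.rayInd e q + if q.1 < t.1 then P.endInd t e + P.endInd t (e + 1) else 0) =
        if τ * P.cross e q < 0 then 1 else 0 := by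
    by_cases he : P.VerticalEdge e
    · have h0 : ∀ q, P.rayInd e q = 0 := fun q =>
        if_neg fun h => P.not_vertical_of_mem_edgeIco h.1 he
      obtain ⟨a, b, ha, hb, hab, rfl⟩ := ht
      have hx : P.vertex (e + 1) = ((P.vertex e).1, (P.vertex (e + 1)).2) := Prod.ext he.symm rfl
      have hy : (P.vertex e).2 ≠ (P.vertex (e + 1)).2 := fun hy =>
        P.succ_ne e (P.injective (Prod.ext he hy)).symm
      have hcr : ∀ q, P.cross e q =
          -((P.vertex (e + 1)).2 - (P.vertex e).2) * (q.1 - (P.vertex e).1) := by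
        intro q
        unfold VerticalEdge at he
        simp only [cross, ← he]; ring
      have h1 : (a • P.vertex e + b • P.vertex (e + 1)).1 = (P.vertex e).1 := by
        unfold VerticalEdge at he
        simp only [Prod.fst_add, Prod.smul_fst, smul_eq_mul, ← he]
        rw [← add_mul, hab, one_mul]
      -- Exactly one end of a vertical edge lies above an inner point of it; this alone makes the
      -- parity flip, as the edge itself is never counted.
      have hend : P.endInd (a • P.vertex e + b • P.vertex (e + 1)) e +
          P.endInd (a • P.vertex e + b • P.vertex (e + 1)) (e + 1) = 1 := by
        unfold endInd
        rw [h1, ← he]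
        simp only [Prod.snd_add, Prod.smul_snd, smul_eq_mul, true_and]
        obtain rfl : a = 1 - b := by linarith
        rcases lt_or_gt_of_ne hy with h | h
        · rw [if_neg (by nlinarith), if_pos (by nlinarith)]; simp
        · rw [if_pos (by nlinarith), if_neg (by nlinarith)]; simp
      rw [hend, h1]
      rcases lt_or_gt_of_ne hy with h | h
      · refine ⟨-1, Or.inr rfl, Eventually.of_forall fun q hq => ?_⟩
        rw [h0, zero_add, hcr]
        congr 1
        rw [eq_iff_iff]
        constructor <;> intro h3 <;> nlinarith
      · refine ⟨1, Or.inl rfl, Eventually.of_forall fun q hq => ?_⟩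
        rw [h0, zero_add, hcr]
        congr 1
        rw [eq_iff_iff]
        constructor <;> intro h3 <;> nlinarith
    · obtain ⟨hx, hy⟩ := (P.mem_openEdge_iff he).1 ht
      -- An inner point of a non-vertical edge has no end of that edge above it.
      have hend : P.endInd t e + P.endInd t (e + 1) = 0 := by
        unfold endInd
        have h1 : (P.vertex e).1 ≠ t.1 := by
          intro h
          rcases min_choice (P.vertex e).1 (P.vertex (e + 1)).1 with h2 | h2
          · exact hx.1.ne (h2.trans h)
          · have := max_choice (P.vertex e).1 (P.vertex (e + 1)).1
            have := hx.2
            rw [rightX, max_eq_left (min_eq_right_iff.1 h2), h] at this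
            exact this.false
        have h1' : (P.vertex (e + 1)).1 ≠ t.1 := by
          intro h
          rcases le_total (P.vertex e).1 (P.vertex (e + 1)).1 with h2 | h2
          · exact hx.2.ne ((max_eq_right h2).trans h).symm
          · exact hx.1.ne ((min_eq_right h2).trans h)
        simp [h1, h1']
      have hin : ∀ᶠ q : ℝ × ℝ in 𝓝 t, q.1 ∈ Ioo (P.leftX e) (P.rightX e) :=
        (continuous_fst.tendsto t).eventually (isOpen_Ioo.mem_nhds hx)
      have hray : ∀ᶠ q : ℝ × ℝ in 𝓝 t, P.rayInd e q =
          if q.2 < P.edgeHeight e q.1 then 1 else 0 := by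
        filter_upwards [hin] with q hq
        simp only [rayInd, edgeIco_eq, mem_Ico, hq.1.le, hq.2, true_and]
      simp only [hend, ite_self, add_zero]
      have hne : (P.vertex e).1 ≠ (P.vertex (e + 1)).1 := he
      rcases lt_or_gt_of_ne hne with h | h
      · refine ⟨1, Or.inl rfl, ?_⟩
        filter_upwards [hray] with q hq _
        rw [hq, P.cross_eq he]
        congr 1
        rw [eq_iff_iff]
        constructor <;> intro h3 <;> nlinarith
      · refine ⟨-1, Or.inr rfl, ?_⟩
        filter_upwards [hray] with q hq _
        rw [hq, P.cross_eq he]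
        congr 1
        rw [eq_iff_iff]
        constructor <;> intro h3 <;> nlinarith
  rcases hτ with rfl | rfl
  · refine ⟨C + 1, ?_, ?_⟩
    · filter_upwards [mem_nhdsWithin_of_mem_nhds hpar, mem_nhdsWithin_of_mem_nhds hcount,
        self_mem_nhdsWithin] with q h1 h2 h3
      have h3 : 1 * P.cross e q < 0 := h3
      rw [h1, h2 (by rintro h; simp [h] at h3), if_pos h3]
    · filter_upwards [mem_nhdsWithin_of_mem_nhds hpar, mem_nhdsWithin_of_mem_nhds hcount,
        self_mem_nhdsWithin] with q h1 h2 h3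
      have h3 : -1 * P.cross e q < 0 := h3
      rw [h1, h2 (by rintro h; simp [h] at h3), if_neg (by linarith), add_assoc,
        CharTwo.add_self_eq_zero]
  · refine ⟨C, ?_, ?_⟩
    · filter_upwards [mem_nhdsWithin_of_mem_nhds hpar, mem_nhdsWithin_of_mem_nhds hcount,
        self_mem_nhdsWithin] with q h1 h2 h3
      have h3 : 1 * P.cross e q < 0 := h3
      rw [h1, h2 (by rintro h; simp [h] at h3), if_neg (by linarith), add_zero]
    · filter_upwards [mem_nhdsWithin_of_mem_nhds hpar, mem_nhdsWithin_of_mem_nhds hcount,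
        self_mem_nhdsWithin] with q h1 h2 h3
      have h3 : -1 * P.cross e q < 0 := h3
      rw [h1, h2 (by rintro h; simp [h] at h3), if_pos h3]

end SimplePolygon
namespace SimplePolygon

open Set Filter Topology

variable (P : SimplePolygon)

/-! ### The Jordan curve theorem for polygons -/

/-- The points off the curve with ray parity `c`. -/
def parityRegion (c : ZMod 2) : Set (ℝ × ℝ) := {q | q ∉ P.curve ∧ P.rayParity q = c}

theorem isOpen_parityRegion (c : ZMod 2) : IsOpen (P.parityRegion c) := by
  rw [isOpen_iff_mem_nhds]
  rintro q ⟨hq, rfl⟩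
  filter_upwards [P.isOpen_compl_curve.mem_nhds hq, P.eventually_rayParity hq] with p h1 h2
  exact ⟨h1, h2⟩

theorem disjoint_parityRegion {c d : ZMod 2} (h : c ≠ d) :
    Disjoint (P.parityRegion c) (P.parityRegion d) :=
  Set.disjoint_left.2 fun _ h1 h2 => h (h1.2.symm.trans h2.2)

theorem compl_curve_subset_parityRegion :
    P.curveᶜ ⊆ P.parityRegion 1 ∪ P.parityRegion 0 := by
  intro q hq
  have h : ∀ c : ZMod 2, c = 1 ∨ c = 0 := by decide
  rcases h (P.rayParity q) with h | h
  · exact Or.inl ⟨hq, h⟩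
  · exact Or.inr ⟨hq, h⟩

/-- The two parity regions separate the complement of the curve, so the side `1` of all edges lies
in one of them; the parity flip puts the opposite side into the other. -/
theorem exists_orientation : ∃ σ : ℝ, (σ = 1 ∨ σ = -1) ∧
    (∀ e, P.EdgeSideIn univ σ e (P.parityRegion 1)) ∧
    ∀ e, P.EdgeSideIn univ (-σ) e (P.parityRegion 0) := by
  have hopp : ∀ c : ZMod 2, (∀ e, P.EdgeSideIn univ 1 e (P.parityRegion c)) →
      ∀ e, P.EdgeSideIn univ (-1) e (P.parityRegion (c + 1)) := by
    intro c h e t ht _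
    obtain ⟨d, h1, h2⟩ := P.eventually_rayParity_edge ht
    obtain ⟨q, hq, hq'⟩ := (SideIn.inter (h e t ht trivial) h1).nonempty one_ne_zero
      (P.cross_of_mem_openSegment ht)
    obtain rfl : c = d := hq.2.symm.trans hq'
    exact (P.sideIn_compl_curve ht).inter h2
  rcases P.edgeSideIn_univ_or one_ne_zero (P.isOpen_parityRegion 1) (P.isOpen_parityRegion 0)
    (P.disjoint_parityRegion one_ne_zero) P.compl_curve_subset_parityRegion with h | h
  · exact ⟨1, Or.inl rfl, h, by simpa [CharTwo.add_self_eq_zero] using hopp 1 h⟩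
  · refine ⟨-1, Or.inr rfl, by simpa using hopp 0 h, by simpa using h⟩

theorem exists_sector_subset {σ : ℝ} (hσ : σ ≠ 0) {A B : Set (ℝ × ℝ)} (hA : IsOpen A)
    (hB : IsOpen B) (hAB : Disjoint A B) (hcov : P.curveᶜ ⊆ A ∪ B) {e : P.Idx}
    (h : P.EdgeSideIn univ σ e A) :
    ∃ r > 0, P.sector σ e ∩ Metric.ball (P.vertex (e + 1)) r ⊆ A := by
  obtain ⟨r, hr, -, hd⟩ := P.exists_sector_dichotomy σ (W := univ) hA hB hAB
    (by simpa using hcov) e univ_mem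
  refine ⟨r, hr, hd.resolve_right fun hd => ?_⟩
  obtain ⟨t, ht, htb⟩ := P.exists_openSegment_mem_of_end e (Metric.ball_mem_nhds _ hr)
  have h1 := ((P.sideIn_sector (σ := σ) ht).inter
    (P.sideIn_of_mem_nhds (Metric.isOpen_ball.mem_nhds htb))).mono hd
  exact SideIn.not_disjoint hσ (P.cross_of_mem_openSegment ht) (h t ht trivial) h1 hAB

/-- If one side of the curve lies in the part `A` of a separation of its complement, then so does
the whole region with the ray parity of that side. -/
theorem parityRegion_subset {σ : ℝ} (hσ : σ ≠ 0) {c d : ZMod 2} (hcd : c ≠ d)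
    (hd : ∀ e, P.EdgeSideIn univ (-σ) e (P.parityRegion d)) {A B : Set (ℝ × ℝ)} (hA : IsOpen A)
    (hB : IsOpen B) (hAB : Disjoint A B) (hcov : P.curveᶜ ⊆ A ∪ B)
    (h : ∀ e, P.EdgeSideIn univ σ e A) : P.parityRegion c ⊆ A := by
  -- The exceptional points form an open and closed set. It misses the curve, so it is not the whole
  -- plane and must be empty.
  set bad := P.parityRegion c ∩ B with hbad
  have hopen : IsOpen bad := (P.isOpen_parityRegion c).inter hB
  have hcov' : P.curveᶜ ⊆ P.parityRegion d ∪ P.parityRegion c := by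
    have hall : ∀ c d x : ZMod 2, c ≠ d → x = d ∨ x = c := by decide
    intro q hq
    rcases hall c d (P.rayParity q) hcd with h | h
    · exact Or.inl ⟨hq, h⟩
    · exact Or.inr ⟨hq, h⟩
  have hnot : ∀ q ∈ bad, ¬ (q ∈ A ∨ q ∈ P.parityRegion d) := by
    rintro q ⟨h1, h2⟩ (h3 | h3)
    · exact Set.disjoint_left.1 hAB h3 h2
    · exact Set.disjoint_left.1 (P.disjoint_parityRegion hcd) h1 h3
  have hclosed : IsClosed bad := by
    refine isClosed_of_closure_subset fun t ht => ?_
    by_cases htc : t ∈ P.curve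
    · exfalso
      rcases P.mem_curve_iff.1 htc with ⟨i, rfl⟩ | ⟨e, he⟩
      · obtain ⟨e, rfl⟩ : ∃ e, i = e + 1 := ⟨i - 1, by simp⟩
        obtain ⟨r, hr, hrA⟩ := P.exists_sector_subset hσ hA hB hAB hcov (h e)
        obtain ⟨s, hs, hsd⟩ := P.exists_sector_subset (neg_ne_zero.2 hσ)
          (P.isOpen_parityRegion d) (P.isOpen_parityRegion c)
          (P.disjoint_parityRegion hcd.symm) hcov' (hd e)
        -- Points off the lines of both edges are dense. Such a point close to the corner is in one
        -- of the two sectors, hence in `A` or in the region of parity `d`, and is not exceptional.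
        have hD := (P.dense_cross_ne e).inter_of_isOpen_left (P.dense_cross_ne (e + 1))
          (P.isOpen_cross_ne e)
        have ht' := closure_minimal (hD.open_subset_closure_inter hopen) isClosed_closure ht
        obtain ⟨q, ⟨hqr, hqs⟩, hqb, hq0, hq1⟩ := mem_closure_iff_nhds.1 ht' _
          (inter_mem (Metric.ball_mem_nhds _ hr) (Metric.ball_mem_nhds _ hs))
        rcases P.mem_sector_or hσ hq0 hq1 with hq | hq
        · exact hnot q hqb (Or.inl (hrA ⟨hq, hqr⟩))
        · exact hnot q hqb (Or.inr (hsd ⟨hq, hqs⟩))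
      · have ht' := closure_minimal ((P.dense_cross_ne e).open_subset_closure_inter hopen)
          isClosed_closure ht
        have h1 := eventually_nhdsWithin_iff.1 (h e t he trivial)
        have h2 := eventually_nhdsWithin_iff.1 (hd e t he trivial)
        obtain ⟨q, ⟨hq1, hq2⟩, hqb, hq0⟩ := mem_closure_iff_nhds.1 ht' _ (h1.and h2)
        rcases lt_or_gt_of_ne (mul_ne_zero hσ hq0) with h3 | h3
        · exact hnot q hqb (Or.inl (hq1 h3))
        · refine hnot q hqb (Or.inr (hq2 ?_))
          simp only [side, mem_ofPred_eq]; linarith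
    · refine ⟨?_, ?_⟩
      · refine ⟨htc, ?_⟩
        obtain ⟨q, hq, hqb⟩ := mem_closure_iff_nhds.1 ht _
          ((P.isOpen_parityRegion (P.rayParity t)).mem_nhds ⟨htc, rfl⟩)
        exact hq.2.symm.trans hqb.1.2
      · refine (hcov htc).resolve_left fun htA => ?_
        obtain ⟨q, hq, hqb⟩ := mem_closure_iff_nhds.1 ht _ (hA.mem_nhds htA)
        exact hnot q hqb (Or.inl hq)
  have hempty : bad = ∅ := by
    refine (isClopen_iff.1 ⟨hclosed, hopen⟩).resolve_right fun hu => ?_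
    have : P.vertex 0 ∈ bad := hu ▸ mem_univ _
    exact this.1.1 (P.mem_curve_iff.2 (Or.inl ⟨0, rfl⟩))
  intro q hq
  refine (hcov hq.1).resolve_right fun hqB => ?_
  have : q ∈ bad := ⟨hq, hqB⟩
  simp [hempty] at this

theorem exists_curve_bound : ∃ R : ℝ, ∀ q ∈ P.curve, |q.1| ≤ R ∧ |q.2| ≤ R := by
  obtain ⟨R, hR⟩ := P.isCompact_curve.isBounded.exists_norm_le
  refine ⟨R, fun q hq => ?_⟩
  have := hR q hq
  rw [Prod.norm_def, max_le_iff] at this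
  exact this

theorem rayParity_eq_zero_of_large {R : ℝ} (hR : ∀ q ∈ P.curve, |q.1| ≤ R ∧ |q.2| ≤ R)
    {q : ℝ × ℝ} (hq : R < |q.1| ∨ R < q.2) : P.rayParity q = 0 := by
  refine Finset.sum_eq_zero fun e _ => if_neg ?_
  rintro ⟨h1, h2⟩
  have hmem : (q.1, P.edgeHeight e q.1) ∈ P.curve :=
    P.segment_subset_curve e ((P.mem_edge_iff (P.not_vertical_of_mem_edgeIco h1)).2
      ⟨⟨h1.1, h1.2.le⟩, rfl⟩)
  obtain ⟨h3, h4⟩ := hR _ hmem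
  rcases hq with hq | hq
  · exact absurd h3 (not_le.2 hq)
  · exact absurd ((le_abs_self _).trans h4) (not_le.2 (hq.trans h2))

theorem isBounded_parityRegion_one : Bornology.IsBounded (P.parityRegion 1) := by
  obtain ⟨R, hR⟩ := P.exists_curve_bound
  refine (Metric.isBounded_closedBall (x := (0 : ℝ × ℝ)) (r := R)).subset fun q hq => ?_
  have h1 : |q.1| ≤ R := by
    by_contra hc
    have := P.rayParity_eq_zero_of_large hR (Or.inl (not_le.1 hc))
    exact one_ne_zero (hq.2.symm.trans this)
  have h2 : q.2 ≤ R := by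
    by_contra hc
    have := P.rayParity_eq_zero_of_large hR (Or.inr (not_le.1 hc))
    exact one_ne_zero (hq.2.symm.trans this)
  have h3 : -R ≤ q.2 := by
    by_contra hc
    -- Rays that start below the curve may cross it. But the half-plane below the curve is connected
    -- and contains a point far to the right, whose parity is `0`.
    have hpre : IsPreconnected {p : ℝ × ℝ | p.2 < -R} := by
      refine Convex.isPreconnected ?_
      exact (convex_Iio (-R)).linear_preimage (LinearMap.snd ℝ ℝ ℝ)
    have hsub : {p : ℝ × ℝ | p.2 < -R} ⊆ P.parityRegion 1 ∪ P.parityRegion 0 := fun p hp =>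
      P.compl_curve_subset_parityRegion fun hpc => by
        have := (abs_le.1 (hR p hpc).2).1
        exact absurd hp (not_lt.2 this)
    have hfar : ((|R| + 1, -R - 1) : ℝ × ℝ) ∈ P.parityRegion 0 := by
      have hlt : R < |R| + 1 := (le_abs_self R).trans_lt (lt_add_one _)
      have hpos : R < |((|R| + 1, -R - 1) : ℝ × ℝ).1| := hlt.trans_le (le_abs_self _)
      exact ⟨fun hpc => absurd (hR _ hpc).1 (not_le.2 hpos),
        P.rayParity_eq_zero_of_large hR (Or.inl hpos)⟩
    have hR1 : ((|R| + 1, -R - 1) : ℝ × ℝ) ∈ {p : ℝ × ℝ | p.2 < -R} := by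
      simp only [mem_ofPred_eq]; linarith
    rcases hpre.subset_or_subset (P.isOpen_parityRegion 1) (P.isOpen_parityRegion 0)
      (P.disjoint_parityRegion one_ne_zero) hsub with h | h
    · exact Set.disjoint_left.1 (P.disjoint_parityRegion one_ne_zero) (h hR1) hfar
    · exact Set.disjoint_left.1 (P.disjoint_parityRegion one_ne_zero) hq (h (not_le.1 hc))
  rw [mem_closedBall_zero_iff, Prod.norm_def]
  exact max_le h1 (abs_le.2 ⟨h3, h2⟩)

theorem not_isBounded_parityRegion_zero : ¬ Bornology.IsBounded (P.parityRegion 0) := by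
  intro hb
  obtain ⟨R, hR⟩ := P.exists_curve_bound
  obtain ⟨M, hM⟩ := hb.exists_norm_le
  -- This point lies beyond both the bound `R` for the curve and the supposed bound `M` for the
  -- region.
  have hpos : ∀ r : ℝ, r < |((|R| + |M| + 1, 0) : ℝ × ℝ).1| ∨ ¬ (r = R ∨ r = M) := by
    intro r
    by_cases hr : r = R ∨ r = M
    · refine Or.inl (lt_of_lt_of_le ?_ (le_abs_self _))
      have := abs_nonneg R
      have := abs_nonneg M
      have := le_abs_self R
      have := le_abs_self M
      rcases hr with rfl | rfl <;> simp only <;> linarith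
    · exact Or.inr hr
  have h1 := (hpos R).resolve_right (by simp)
  have h2 := (hpos M).resolve_right (by simp)
  have h3 := hM (|R| + |M| + 1, 0) ⟨fun hpc => absurd (hR _ hpc).1 (not_le.2 h1),
    P.rayParity_eq_zero_of_large hR (Or.inl h1)⟩
  rw [Prod.norm_def] at h3
  exact absurd ((le_max_left _ _).trans h3) (not_le.2 h2)

/-- The interior of a polygon consists of the points from which an upward ray crosses the polygon
an odd number of times. -/
theorem inside_eq : P.inside = P.parityRegion 1 := by
  obtain ⟨σ, hσ, h1, h0⟩ := P.exists_orientation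
  have hσ0 : σ ≠ 0 := by rcases hσ with rfl | rfl <;> norm_num
  ext p
  constructor
  · rintro ⟨hp, hb⟩
    refine (P.compl_curve_subset_parityRegion hp).resolve_right fun hp0 => ?_
    -- `C` and the rest of the complement form a separation. The part that contains the outer side
    -- contains all points of parity `0`: if it is `C`, then `C` is unbounded; if it is the rest,
    -- then `p` is not in `C`.
    set C := connectedComponentIn P.curveᶜ p with hC
    have hCo : IsOpen C := P.isOpen_compl_curve.connectedComponentIn
    have hpC : p ∈ C := mem_connectedComponentIn hp
    have hBo : IsOpen (P.curveᶜ \ C) := by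
      rw [isOpen_iff_mem_nhds]
      rintro q ⟨hq, hqC⟩
      filter_upwards [(P.isOpen_compl_curve.connectedComponentIn (x := q)).mem_nhds
        (mem_connectedComponentIn hq)] with s hs
      refine ⟨connectedComponentIn_subset _ _ hs, fun hsC => hqC ?_⟩
      rw [hC, connectedComponentIn_eq hsC, ← connectedComponentIn_eq hs]
      exact mem_connectedComponentIn hq
    have hcov : P.curveᶜ ⊆ C ∪ (P.curveᶜ \ C) := fun q hq => by
      by_cases hqC : q ∈ C
      · exact Or.inl hqC
      · exact Or.inr ⟨hq, hqC⟩
    have h1' : ∀ e, P.EdgeSideIn univ (-(-σ)) e (P.parityRegion 1) := by simpa using h1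
    rcases P.edgeSideIn_univ_or (neg_ne_zero.2 hσ0) hCo hBo disjoint_sdiff_right hcov with h | h
    · exact P.not_isBounded_parityRegion_zero (hb.subset (P.parityRegion_subset
        (neg_ne_zero.2 hσ0) zero_ne_one h1' hCo hBo disjoint_sdiff_right hcov h))
    · have := P.parityRegion_subset (neg_ne_zero.2 hσ0) zero_ne_one h1' hBo hCo
        disjoint_sdiff_left (by rwa [union_comm]) h hp0
      exact this.2 hpC
  · intro hp
    refine ⟨hp.1, P.isBounded_parityRegion_one.subset ?_⟩
    exact isPreconnected_connectedComponentIn.subset_left_of_subset_union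
      (P.isOpen_parityRegion 1) (P.isOpen_parityRegion 0) (P.disjoint_parityRegion one_ne_zero)
      ((connectedComponentIn_subset _ _).trans P.compl_curve_subset_parityRegion)
      ⟨p, mem_connectedComponentIn hp.1, hp⟩

/-! ### Consequences for interiors, curves and areas -/

theorem mem_inside_iff {q : ℝ × ℝ} : q ∈ P.inside ↔ q ∉ P.curve ∧ P.rayParity q = 1 := by
  rw [inside_eq]; rfl

theorem isOpen_inside : IsOpen P.inside := by
  rw [inside_eq]; exact P.isOpen_parityRegion 1

theorem disjoint_inside_curve : Disjoint P.inside P.curve :=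
  Set.disjoint_left.2 fun _ h => h.1

theorem curve_subset_closure_parityRegion (c : ZMod 2) :
    P.curve ⊆ closure (P.parityRegion c) := by
  obtain ⟨σ, hσ, h1, h0⟩ := P.exists_orientation
  have hσ0 : σ ≠ 0 := by rcases hσ with rfl | rfl <;> norm_num
  obtain ⟨τ, hτ, h⟩ : ∃ τ : ℝ, τ ≠ 0 ∧ ∀ e, P.EdgeSideIn univ τ e (P.parityRegion c) := by
    have hall : ∀ c : ZMod 2, c = 1 ∨ c = 0 := by decide
    rcases hall c with rfl | rfl
    · exact ⟨σ, hσ0, h1⟩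
    · exact ⟨-σ, neg_ne_zero.2 hσ0, h0⟩
  refine iUnion_subset fun e => (segment_subset_closure_openSegment).trans ?_
  refine closure_minimal (fun t ht => ?_) isClosed_closure
  rw [mem_closure_iff_nhds]
  intro U hU
  obtain ⟨q, h1, h2⟩ := (SideIn.inter (P.sideIn_of_mem_nhds hU) (h e t ht trivial)).nonempty hτ
    (P.cross_of_mem_openSegment ht)
  exact ⟨q, h1, h2⟩

theorem curve_subset_closure_inside : P.curve ⊆ closure P.inside := by
  rw [inside_eq]; exact P.curve_subset_closure_parityRegion 1

theorem curve_nonempty : P.curve.Nonempty := ⟨P.vertex 0, P.mem_curve_iff.2 (Or.inl ⟨0, rfl⟩)⟩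

theorem inside_nonempty : P.inside.Nonempty :=
  closure_nonempty_iff.1 (P.curve_nonempty.mono P.curve_subset_closure_inside)

/-- A point of the curve `Q` is a limit of interior points of `Q`, whereas the interior of `P` is
open. -/
theorem disjoint_inside_curve_of_disjoint {P Q : SimplePolygon}
    (h : Disjoint P.inside Q.inside) : Disjoint P.inside Q.curve := by
  rw [Set.disjoint_left]
  intro p hp hq
  obtain ⟨s, hs1, hs2⟩ := mem_closure_iff_nhds.1 (Q.curve_subset_closure_inside hq) _
    (P.isOpen_inside.mem_nhds hp)
  exact Set.disjoint_left.1 h hs1 hs2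

theorem isBounded_inside : Bornology.IsBounded P.inside := by
  rw [inside_eq]; exact P.isBounded_parityRegion_one

/-- A missing point of the interior of `P` may lie on the curve `P`, but it is always a limit of
exterior points of `P`. So the larger interior contains a nonempty open set outside the smaller one,
which has positive area. -/
theorem area_lt {P Q : SimplePolygon} (h : P.inside ⊂ Q.inside) : P.area < Q.area := by
  obtain ⟨q, hqQ, hqP⟩ := Set.exists_of_ssubset h
  have hcl : q ∈ closure (P.parityRegion 0) := by
    by_cases hc : q ∈ P.curve
    · exact P.curve_subset_closure_parityRegion 0 hc
    · refine subset_closure ((P.compl_curve_subset_parityRegion hc).resolve_left ?_)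
      rwa [← inside_eq]
  obtain ⟨s, hsQ, hs0⟩ := mem_closure_iff_nhds.1 hcl _ (Q.isOpen_inside.mem_nhds hqQ)
  have hUo : IsOpen (Q.inside ∩ P.parityRegion 0) := Q.isOpen_inside.inter (P.isOpen_parityRegion 0)
  have hpos : 0 < MeasureTheory.volume (Q.inside ∩ P.parityRegion 0) :=
    hUo.measure_pos _ ⟨s, hsQ, hs0⟩
  have hdisj : Disjoint P.inside (Q.inside ∩ P.parityRegion 0) := by
    rw [inside_eq]
    exact (P.disjoint_parityRegion one_ne_zero).mono_right inter_subset_right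
  have hle : MeasureTheory.volume P.inside +
      MeasureTheory.volume (Q.inside ∩ P.parityRegion 0) ≤ MeasureTheory.volume Q.inside := by
    rw [← MeasureTheory.measure_union hdisj hUo.measurableSet]
    exact MeasureTheory.measure_mono (union_subset h.subset inter_subset_left)
  refine ENNReal.toReal_strict_mono Q.isBounded_inside.measure_lt_top.ne (lt_of_lt_of_le ?_ hle)
  exact ENNReal.lt_add_right P.isBounded_inside.measure_lt_top.ne hpos.ne'

end SimplePolygon
namespace SimplePolygon

open Set Filter Topology

variable (P : SimplePolygon)

/-! ### Walks along the polygon -/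

/-- The index reached from `i` after `j` steps along the polygon. -/
def shift (i : P.Idx) (j : ℕ) : P.Idx := i + Fin.ofNat (P.extra + 3) j

theorem ofNat_add (a b : ℕ) : Fin.ofNat (P.extra + 3) (a + b) =
    Fin.ofNat (P.extra + 3) a + Fin.ofNat (P.extra + 3) b := by
  apply Fin.ext
  simp [Fin.ofNat, Fin.val_add]

theorem ofNat_one : Fin.ofNat (P.extra + 3) 1 = 1 := by
  apply Fin.ext
  simp [Fin.ofNat]

theorem shift_zero (i : P.Idx) : P.shift i 0 = i := by
  have : Fin.ofNat (P.extra + 3) 0 = 0 := by apply Fin.ext; simp [Fin.ofNat]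
  rw [shift, this, add_zero]

theorem shift_add (i : P.Idx) (a b : ℕ) : P.shift i (a + b) = P.shift (P.shift i a) b := by
  simp only [shift, ofNat_add, add_assoc]

theorem shift_succ (i : P.Idx) (j : ℕ) : P.shift i (j + 1) = P.shift i j + 1 := by
  rw [shift_add]
  conv_lhs => rw [shift, ofNat_one]

theorem shift_injOn (i : P.Idx) {a b : ℕ} (ha : a < P.extra + 3) (hb : b < P.extra + 3)
    (h : P.shift i a = P.shift i b) : a = b := by
  have h1 := congrArg Fin.val (add_left_cancel h)
  simpa [Fin.ofNat, Nat.mod_eq_of_lt ha, Nat.mod_eq_of_lt hb] using h1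

theorem exists_shift (i e : P.Idx) : ∃ j < P.extra + 3, P.shift i j = e := by
  refine ⟨(e - i).val, (e - i).isLt, ?_⟩
  have : Fin.ofNat (P.extra + 3) (e - i).val = e - i := by
    exact Fin.ext (Nat.mod_eq_of_lt (e - i).isLt)
  rw [shift, this]
  simp

theorem mem_segEdges {S : P.Seg} {e : P.Idx} :
    e ∈ P.segEdges S ↔ ∃ j < (S.2 : ℕ), P.shift S.1 j = e := by
  simp [segEdges, shift]

theorem mem_segVerts {S : P.Seg} {e : P.Idx} :
    e ∈ P.segVerts S ↔ ∃ j ≤ (S.2 : ℕ), P.shift S.1 j = e := by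
  simp [segVerts, shift]

theorem card_segEdges (S : P.Seg) : (P.segEdges S).card = S.2 := by
  rw [segEdges, Finset.card_image_of_injOn, Finset.card_range]
  intro a ha b hb h
  simp only [Finset.coe_range, mem_Iio] at ha hb
  exact P.shift_injOn S.1 (ha.trans S.2.isLt) (hb.trans S.2.isLt) h

theorem segEdges_nonempty {S : P.Seg} : (P.segEdges S).Nonempty ↔ 0 < (S.2 : ℕ) := by
  rw [← Finset.card_pos, card_segEdges]

theorem card_segVerts (S : P.Seg) : (P.segVerts S).card = S.2 + 1 := by
  rw [segVerts, Finset.card_image_of_injOn, Finset.card_range]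
  intro a ha b hb h
  simp only [Finset.coe_range, mem_Iio] at ha hb
  exact P.shift_injOn S.1 (by have := S.2.isLt; omega) (by have := S.2.isLt; omega) h

theorem mem_segVerts_of_mem_segEdges {S : P.Seg} {e : P.Idx} (he : e ∈ P.segEdges S) :
    e ∈ P.segVerts S ∧ e + 1 ∈ P.segVerts S := by
  obtain ⟨j, hj, rfl⟩ := P.mem_segEdges.1 he
  exact ⟨P.mem_segVerts.2 ⟨j, hj.le, rfl⟩, P.mem_segVerts.2 ⟨j + 1, hj, P.shift_succ _ _⟩⟩

/-- The horizontal extent of the edge `e`, with sign. -/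
noncomputable def dx (e : P.Idx) : ℝ := (P.vertex (e + 1)).1 - (P.vertex e).1

theorem dx_eq_zero {e : P.Idx} : P.dx e = 0 ↔ P.VerticalEdge e := by
  unfold dx VerticalEdge
  rw [sub_eq_zero, eq_comm]

theorem sum_dx : ∑ e, P.dx e = 0 := by
  unfold dx
  rw [Finset.sum_sub_distrib, show ∑ e : P.Idx, (P.vertex (e + 1)).1 = ∑ e, (P.vertex e).1 from
    Equiv.sum_comp (Equiv.addRight (1 : P.Idx)) fun e => (P.vertex e).1, sub_self]

/-- The signed extents sum to zero around the cycle; consequently an `x`-monotone walk cannot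
traverse the whole polygon. -/
theorem exists_dx_nonpos (σ : ℝ) {e : P.Idx} (he : 0 < σ * P.dx e) : ∃ f, σ * P.dx f < 0 := by
  by_contra! h
  have h1 : 0 < ∑ f, σ * P.dx f :=
    Finset.sum_pos' (fun f _ => h f) ⟨e, Finset.mem_univ _, he⟩
  rw [← Finset.mul_sum, sum_dx, mul_zero] at h1
  exact h1.false

/-- If all edges were vertical, no ray would count an edge and the interior would be empty. -/
theorem exists_not_vertical : ∃ e, ¬ P.VerticalEdge e := by
  by_contra! h
  have hx : ∀ j : ℕ, (P.vertex (P.shift 0 j)).1 = (P.vertex 0).1 := by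
    intro j
    induction j with
    | zero => rw [shift_zero]
    | succ j ih => rw [shift_succ, ← ih]; exact (h _).symm
  have hx' : ∀ e, (P.vertex e).1 = (P.vertex 0).1 := fun e => by
    obtain ⟨j, -, rfl⟩ := P.exists_shift 0 e
    exact hx j
  have hc : ∀ y, ((P.vertex 0).1 + 1, y) ∉ P.curve := by
    intro y hy
    obtain ⟨e, he⟩ := mem_iUnion.1 hy
    have := ((P.mem_verticalEdge_iff (h e)).1 he).1
    rw [hx' e] at this
    simp at this
  obtain ⟨q, hq⟩ := P.inside_nonempty
  rw [mem_inside_iff] at hq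
  have : P.rayParity q = 0 := Finset.sum_eq_zero fun e _ =>
    if_neg fun h1 => P.not_vertical_of_mem_edgeIco h1.1 (h e)
  exact zero_ne_one (this.symm.trans hq.2)

/-! ### Outstretched segments -/

/-- The abscissae of the corners along a walk of weak direction `σ`. -/
theorem walk_monotone {σ : ℝ} {i : P.Idx} {m : ℕ}
    (h : ∀ j < m, 0 ≤ σ * P.dx (P.shift i j)) {a b : ℕ} (hab : a ≤ b) (hb : b ≤ m) :
    σ * (P.vertex (P.shift i a)).1 ≤ σ * (P.vertex (P.shift i b)).1 := by
  induction b, hab using Nat.le_induction with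
  | base => exact le_rfl
  | succ b hab ih =>
    have h1 := h b (by omega)
    rw [dx, ← shift_succ] at h1
    linarith [ih (by omega)]

/-- Along a monotone walk, each edge projects to an interval beyond all earlier ones. Together with
`Outstretched.exists_dir`, this replaces (O) by monotonicity. -/
theorem outstretched_of_monotone {σ : ℝ} (hσ : σ = 1 ∨ σ = -1) {S : P.Seg}
    (h : ∀ e ∈ P.segEdges S, 0 ≤ σ * P.dx e) (hfirst : ¬ P.VerticalEdge S.1)
    (hlast : ∀ e, e + 1 = S.1 + S.2 → ¬ P.VerticalEdge e) : P.Outstretched S := by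
  have hw : ∀ j < (S.2 : ℕ), 0 ≤ σ * P.dx (P.shift S.1 j) := fun j hj =>
    h _ (P.mem_segEdges.2 ⟨j, hj, rfl⟩)
  have key : ∀ a b : ℕ, a < b → b < (S.2 : ℕ) →
      Disjoint (P.edgeIco (P.shift S.1 a)) (P.edgeIco (P.shift S.1 b)) := by
    intro a b hab hb
    rw [Set.disjoint_left]
    rintro x ⟨hx1, hx2⟩ ⟨hx3, hx4⟩
    have h0 := hw a (by omega)
    have h1 := P.walk_monotone hw (show a + 1 ≤ b by omega) hb.le
    have h2 := hw b hb
    rw [dx] at h0 h2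
    rw [shift_succ] at h1
    rw [min_le_iff] at hx1 hx3
    rw [lt_max_iff] at hx2 hx4
    rcases hσ with rfl | rfl
    · rcases hx2 with hx2 | hx2 <;> rcases hx3 with hx3 | hx3 <;> linarith
    · rcases hx1 with hx1 | hx1 <;> rcases hx4 with hx4 | hx4 <;> linarith
  refine ⟨fun e he f hf hef => ?_, fun e _ hor => ?_⟩
  · obtain ⟨a, ha, rfl⟩ := P.mem_segEdges.1 he
    obtain ⟨b, hb, rfl⟩ := P.mem_segEdges.1 hf
    rcases lt_trichotomy a b with hab | rfl | hab
    · exact key a b hab hb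
    · exact absurd rfl hef
    · exact (key b a hab ha).symm
  · rcases hor with rfl | hor
    · exact hfirst
    · exact hlast e hor

theorem val_eq_ofNat (k : P.Idx) : Fin.ofNat (P.extra + 3) (k : ℕ) = k :=
  Fin.ext (Nat.mod_eq_of_lt k.isLt)

theorem add_eq_shift (S : P.Seg) : S.1 + S.2 = P.shift S.1 S.2 := by
  rw [shift, val_eq_ofNat]

variable {P}

theorem Outstretched.first {S : P.Seg} (hS : P.Outstretched S) (h0 : 0 < (S.2 : ℕ)) :
    ¬ P.VerticalEdge S.1 :=
  hS.2 _ (P.mem_segEdges.2 ⟨0, h0, P.shift_zero _⟩) (Or.inl rfl)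

theorem Outstretched.last {S : P.Seg} (hS : P.Outstretched S) (h0 : 0 < (S.2 : ℕ)) {e : P.Idx}
    (he : e + 1 = S.1 + S.2) : ¬ P.VerticalEdge e := by
  refine hS.2 _ (P.mem_segEdges.2 ⟨S.2 - 1, by omega, ?_⟩) (Or.inr he)
  apply add_right_cancel (b := (1 : P.Idx))
  rw [he, add_eq_shift, ← shift_succ]
  congr 1
  omega

/-- Outstretched segments are `x`-monotone. -/
theorem Outstretched.exists_dir {S : P.Seg} (hS : P.Outstretched S) :
    ∃ σ : ℝ, (σ = 1 ∨ σ = -1) ∧ ∀ e ∈ P.segEdges S, 0 ≤ σ * P.dx e := by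
  rcases Nat.eq_zero_or_pos (S.2 : ℕ) with h0 | h0
  · refine ⟨1, Or.inl rfl, fun e he => ?_⟩
    obtain ⟨j, hj, -⟩ := P.mem_segEdges.1 he
    omega
  obtain ⟨σ, hσ, hpos⟩ : ∃ σ : ℝ, (σ = 1 ∨ σ = -1) ∧ 0 < σ * P.dx S.1 := by
    have hne : P.dx S.1 ≠ 0 := fun h => hS.first h0 (P.dx_eq_zero.1 h)
    rcases lt_or_gt_of_ne hne with h | h
    · exact ⟨-1, Or.inr rfl, by linarith⟩
    · exact ⟨1, Or.inl rfl, by linarith⟩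
  -- Here `l` is the last non-vertical edge so far, so its end has the abscissa of the current
  -- corner. An edge that turned back from there would share abscissae with edge `l`.
  have key : ∀ j < (S.2 : ℕ), 0 ≤ σ * P.dx (P.shift S.1 j) ∧ ∃ l ≤ j,
      0 < σ * P.dx (P.shift S.1 l) ∧
        (P.vertex (P.shift S.1 (l + 1))).1 = (P.vertex (P.shift S.1 (j + 1))).1 := by
    intro j
    induction j with
    | zero =>
      intro _
      rw [shift_zero]
      exact ⟨hpos.le, 0, le_rfl, by rwa [shift_zero], rfl⟩
    | succ j ih =>
      intro hj
      obtain ⟨-, l, hl, hl0, hlx⟩ := ih (by omega)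
      rcases lt_trichotomy (σ * P.dx (P.shift S.1 (j + 1))) 0 with h | h | h
      · exfalso
        have hne : P.shift S.1 l ≠ P.shift S.1 (j + 1) := fun h =>
          absurd (P.shift_injOn S.1 (by omega) (by omega) h) (by omega)
        have hd := Set.disjoint_left.1 (hS.1 _ (P.mem_segEdges.2 ⟨l, by omega, rfl⟩) _
          (P.mem_segEdges.2 ⟨j + 1, hj, rfl⟩) hne)
        rw [shift_succ] at hlx
        unfold dx at h hl0
        set a := (P.vertex (P.shift S.1 l)).1
        set b := (P.vertex (P.shift S.1 l + 1)).1
        set c := (P.vertex (P.shift S.1 (j + 1) + 1)).1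
        rw [← hlx] at h
        rcases hσ with rfl | rfl
        · have hab : a < b := by linarith
          have hcb : c < b := by linarith
          refine @hd (max a c) ?_ ?_
          · refine ⟨(min_le_left _ _).trans (le_max_left _ _), ?_⟩
            exact (max_lt hab hcb).trans_le (le_max_right _ _)
          · change _ ≤ _ ∧ _ < _
            rw [← hlx]
            exact ⟨(min_le_right _ _).trans (le_max_right _ _),
              (max_lt hab hcb).trans_le (le_max_left _ _)⟩
        · have hab : b < a := by linarith
          have hcb : b < c := by linarith
          refine @hd b ?_ ?_
          · exact ⟨min_le_right _ _, hab.trans_le (le_max_left _ _)⟩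
          · change _ ≤ _ ∧ _ < _
            rw [← hlx]
            exact ⟨min_le_left _ _, hcb.trans_le (le_max_right _ _)⟩
      · refine ⟨h.ge, l, by omega, hl0, ?_⟩
        have hv : P.dx (P.shift S.1 (j + 1)) = 0 := by
          rcases hσ with rfl | rfl <;> linarith
        rw [hlx, P.shift_succ S.1 (j + 1)]
        exact P.dx_eq_zero.1 hv
      · exact ⟨h.le, j + 1, le_rfl, h, rfl⟩
  refine ⟨σ, hσ, fun e he => ?_⟩
  obtain ⟨j, hj, rfl⟩ := P.mem_segEdges.1 he
  exact (key j hj).1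

variable (P)

/-- A single non-vertical edge is outstretched; among the outstretched segments through it, one with
the most edges cannot be extended. -/
theorem exists_maxOutstretched {e : P.Idx} (he : ¬ P.VerticalEdge e) :
    ∃ S, P.MaxOutstretched S ∧ e ∈ P.segEdges S := by
  classical
  have h1 : ((1 : P.Idx) : ℕ) = 1 := by simp
  have hedges : ∀ f, f ∈ P.segEdges (e, 1) ↔ f = e := by
    intro f
    rw [mem_segEdges]
    constructor
    · rintro ⟨j, hj, rfl⟩
      obtain rfl : j = 0 := by simp only [h1] at hj; omega
      exact P.shift_zero e
    · rintro rfl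
      exact ⟨0, by simp, P.shift_zero _⟩
  have hout : P.Outstretched (e, 1) := by
    refine ⟨fun f hf g hg hfg => ?_, fun f hf _ => ?_⟩
    · rw [hedges] at hf hg
      exact absurd (hf.trans hg.symm) hfg
    · rw [hedges] at hf
      rwa [hf]
  obtain ⟨S, hS, hmax⟩ := Finset.exists_max_image
    (Finset.univ.filter fun S : P.Seg => P.Outstretched S ∧ e ∈ P.segEdges S)
    (fun S => (S.2 : ℕ)) ⟨(e, 1), by simp [hout, hedges]⟩
  rw [Finset.mem_filter] at hS
  refine ⟨S, ⟨⟨e, hS.2.2⟩, hS.2.1, ?_⟩, hS.2.2⟩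
  rintro ⟨T, hT, ⟨hv, hedge⟩, hnot⟩
  have hle := hmax T (by simp [hT, hedge hS.2.2])
  have hE : P.segEdges S = P.segEdges T :=
    Finset.eq_of_subset_of_card_le hedge (by rw [card_segEdges, card_segEdges]; exact hle)
  have hV : P.segVerts S = P.segVerts T :=
    Finset.eq_of_subset_of_card_le hv (by rw [card_segVerts, card_segVerts]; omega)
  exact hnot ⟨hV.ge, hE.ge⟩

/-- A non-vertical edge belongs to only one maximal outstretched segment. -/
theorem maxOutstretched_unique {S T : P.Seg} (hS : P.MaxOutstretched S)
    (hT : P.MaxOutstretched T) {e : P.Idx} (he : ¬ P.VerticalEdge e) (heS : e ∈ P.segEdges S)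
    (heT : e ∈ P.segEdges T) : S = T := by
  obtain ⟨σ, hσ, hdS⟩ := hS.2.1.exists_dir
  obtain ⟨τ, hτ, hdT⟩ := hT.2.1.exists_dir
  have hne : P.dx e ≠ 0 := fun h => he (P.dx_eq_zero.1 h)
  obtain rfl : σ = τ := by
    have h1 := hdS e heS
    have h2 := hdT e heT
    rcases hσ with rfl | rfl <;> rcases hτ with rfl | rfl
    · rfl
    · exact absurd (by linarith) hne
    · exact absurd (by linarith) hne
    · rfl
  obtain ⟨a, ha, haS⟩ := P.mem_segEdges.1 heS
  obtain ⟨b, hb, hbT⟩ := P.mem_segEdges.1 heT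
  have hepos : 0 < σ * P.dx e := lt_of_le_of_ne (hdS e heS)
    (Ne.symm (mul_ne_zero (by rcases hσ with rfl | rfl <;> norm_num) hne))
  -- the union of both segments
  obtain ⟨i, c, hic, hac, hbc, hi, hback⟩ : ∃ i : P.Idx, ∃ c : ℕ, P.shift i c = e ∧ a ≤ c ∧
      b ≤ c ∧ ¬ P.VerticalEdge i ∧ ∀ j < c, 0 ≤ σ * P.dx (P.shift i j) := by
    rcases le_total b a with h | h
    · exact ⟨S.1, a, haS, le_rfl, h, hS.2.1.first (by omega), fun j hj =>
        hdS _ (P.mem_segEdges.2 ⟨j, by omega, rfl⟩)⟩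
    · exact ⟨T.1, b, hbT, h, le_rfl, hT.2.1.first (by omega), fun j hj =>
        hdT _ (P.mem_segEdges.2 ⟨j, by omega, rfl⟩)⟩
  obtain ⟨d, hSd, hTd, hd0, hlast, hforw⟩ : ∃ d : ℕ, (S.2 : ℕ) - a ≤ d ∧ (T.2 : ℕ) - b ≤ d ∧
      0 < d ∧ (∀ f, f + 1 = P.shift e d → ¬ P.VerticalEdge f) ∧
      ∀ j < d, 0 ≤ σ * P.dx (P.shift e j) := by
    rcases le_total ((T.2 : ℕ) - b) ((S.2 : ℕ) - a) with h | h
    · refine ⟨(S.2 : ℕ) - a, le_rfl, h, by omega, fun f hf => ?_, fun j hj => ?_⟩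
      · refine hS.2.1.last (by omega) ?_
        rw [hf, ← haS, ← shift_add, add_eq_shift]
        congr 1; omega
      · refine hdS _ (P.mem_segEdges.2 ⟨a + j, by omega, ?_⟩)
        rw [shift_add, haS]
    · refine ⟨(T.2 : ℕ) - b, h, le_rfl, by omega, fun f hf => ?_, fun j hj => ?_⟩
      · refine hT.2.1.last (by omega) ?_
        rw [hf, ← hbT, ← shift_add, add_eq_shift]
        congr 1; omega
      · refine hdT _ (P.mem_segEdges.2 ⟨b + j, by omega, ?_⟩)
        rw [shift_add, hbT]
  have hall : ∀ j < c + d, 0 ≤ σ * P.dx (P.shift i j) := by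
    intro j hj
    rcases lt_or_ge j c with h | h
    · exact hback j h
    · obtain ⟨l, rfl⟩ := Nat.exists_eq_add_of_le h
      rw [shift_add, hic]
      exact hforw l (by omega)
  -- Otherwise the joined walk would pass every edge, although some edge runs against `σ`.
  have hlen : c + d < P.extra + 3 := by
    by_contra hlen
    obtain ⟨f, hf⟩ := P.exists_dx_nonpos σ hepos
    obtain ⟨j, hj, rfl⟩ := P.exists_shift i f
    exact absurd (hall j (by omega)) (not_le.2 hf)
  set U : P.Seg := (i, ⟨c + d, hlen⟩) with hU
  have hUout : P.Outstretched U := by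
    refine P.outstretched_of_monotone hσ (fun f hf => ?_) hi fun f hf => hlast f ?_
    · obtain ⟨j, hj, rfl⟩ := P.mem_segEdges.1 hf
      exact hall j hj
    · rw [hf, add_eq_shift, ← hic, ← shift_add]
  have hsub : ∀ (R : P.Seg) (r : ℕ), P.shift R.1 r = e → r ≤ c → r ≤ R.2 → (R.2 : ℕ) - r ≤ d →
      P.SubSeg R U := by
    intro R r hr hrc hrR hrd
    have hstart : P.shift i (c - r) = R.1 := by
      have h1 : P.shift (P.shift i (c - r)) r = P.shift R.1 r := by
        rw [← shift_add, hr, ← hic]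
        congr 1; omega
      exact add_right_cancel h1
    constructor
    · intro f hf
      obtain ⟨j, hj, rfl⟩ := P.mem_segVerts.1 hf
      refine P.mem_segVerts.2 ⟨c - r + j, ?_, ?_⟩
      · change c - r + j ≤ c + d; omega
      · change P.shift i (c - r + j) = _
        rw [shift_add, hstart]
    · intro f hf
      obtain ⟨j, hj, rfl⟩ := P.mem_segEdges.1 hf
      refine P.mem_segEdges.2 ⟨c - r + j, ?_, ?_⟩
      · change c - r + j < c + d; omega
      · change P.shift i (c - r + j) = _
        rw [shift_add, hstart]
  have hmax : ∀ (R : P.Seg) (r : ℕ), P.MaxOutstretched R → P.shift R.1 r = e → r ≤ c →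
      r ≤ R.2 → (R.2 : ℕ) - r ≤ d → r = c ∧ (R.2 : ℕ) = c + d := by
    intro R r hR hr hrc hrR hrd
    have h1 : P.SubSeg U R := by
      by_contra hn
      exact hR.2.2 ⟨U, hUout, hsub R r hr hrc hrR hrd, hn⟩
    have h2 := Finset.card_le_card h1.2
    rw [card_segEdges, card_segEdges] at h2
    have h3 : c + d ≤ R.2 := h2
    omega
  obtain ⟨h1, h2⟩ := hmax S a hS haS hac ha.le hSd
  obtain ⟨h3, h4⟩ := hmax T b hT hbT hbc hb.le hTd
  refine Prod.ext ?_ (Fin.ext (by omega))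
  have h5 : P.shift S.1 a = P.shift T.1 a := by rw [haS, h1, ← h3, hbT]
  exact add_right_cancel h5

/-! ### The sweep-line and the edges of a segment -/

theorem edgeIco_subset {S : P.Seg} {e : P.Idx} (he : e ∈ P.segEdges S) :
    P.edgeIco e ⊆ Ico (P.minX S) (P.maxX S) := by
  obtain ⟨h1, h2⟩ := P.mem_segVerts_of_mem_segEdges he
  refine Ico_subset_Ico (le_min ?_ ?_) (max_le ?_ ?_)
  · exact Finset.inf'_le (fun i => (P.vertex i).1) h1
  · exact Finset.inf'_le (fun i => (P.vertex i).1) h2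
  · exact Finset.le_sup' (fun i => (P.vertex i).1) h1
  · exact Finset.le_sup' (fun i => (P.vertex i).1) h2

/-- A discrete intermediate value argument: an edge whose interval avoids `x` has both ends at most
`x` or both beyond `x`, so all corners of `S` would be on the same side. -/
theorem exists_edge_of_mem_Ico {S : P.Seg} {x : ℝ} (hx : x ∈ Ico (P.minX S) (P.maxX S)) :
    ∃ e ∈ P.segEdges S, x ∈ P.edgeIco e := by
  by_contra! hno
  have hstep : ∀ j < (S.2 : ℕ), ((P.vertex (P.shift S.1 j)).1 ≤ x ↔
      (P.vertex (P.shift S.1 (j + 1))).1 ≤ x) := by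
    intro j hj
    have h := hno _ (P.mem_segEdges.2 ⟨j, hj, rfl⟩)
    simp only [edgeIco, mem_Ico, min_le_iff, lt_max_iff, not_and, ← shift_succ] at h
    constructor <;> intro h1 <;> by_contra h2
    · exact h (Or.inl h1) (Or.inr (not_le.1 h2))
    · exact h (Or.inr h1) (Or.inl (not_le.1 h2))
  have hall : ∀ j ≤ (S.2 : ℕ), ((P.vertex (P.shift S.1 j)).1 ≤ x ↔ (P.vertex S.1).1 ≤ x) := by
    intro j
    induction j with
    | zero => intro _; rw [shift_zero]
    | succ j ih => intro hj; rw [← hstep j (by omega), ih (by omega)]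
  obtain ⟨i, hi, hix⟩ := (Finset.inf'_le_iff _ (f := fun i => (P.vertex i).1)).1 hx.1
  obtain ⟨l, hl, hlx⟩ := (Finset.lt_sup'_iff _ (f := fun i => (P.vertex i).1)).1 hx.2
  obtain ⟨a, ha, rfl⟩ := P.mem_segVerts.1 hi
  obtain ⟨b, hb, rfl⟩ := P.mem_segVerts.1 hl
  exact absurd ((hall b hb).2 ((hall a ha).1 hix)) (not_le.2 hlx)

theorem edgeAt_spec {S : P.Seg} {x : ℝ} (hx : x ∈ Ico (P.minX S) (P.maxX S)) :
    P.edgeAt S x ∈ P.segEdges S ∧ x ∈ P.edgeIco (P.edgeAt S x) := by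
  have h := P.exists_edge_of_mem_Ico hx
  unfold edgeAt
  rw [dif_pos h]
  exact h.choose_spec

theorem edgeAt_eq {S : P.Seg} (hS : P.Outstretched S) {e : P.Idx} (he : e ∈ P.segEdges S) {x : ℝ}
    (hx : x ∈ P.edgeIco e) : P.edgeAt S x = e := by
  obtain ⟨h1, h2⟩ := P.edgeAt_spec (P.edgeIco_subset he hx)
  by_contra hne
  exact Set.disjoint_left.1 (hS.1 _ h1 _ he hne) h2 hx

theorem minX_lt_maxX {S : P.Seg} (hS : P.MaxOutstretched S) : P.minX S < P.maxX S := by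
  have h0 := P.segEdges_nonempty.1 hS.1
  have h1 : S.1 ∈ P.segEdges S := P.mem_segEdges.2 ⟨0, h0, P.shift_zero _⟩
  have h2 := P.leftX_lt_rightX.2 (hS.2.1.first h0)
  have h3 := P.edgeIco_subset h1 ⟨le_rfl, h2⟩
  exact h3.1.trans_lt h3.2

/-- The maximal outstretched segments of `P` that meet the sweep-line at `x`. -/
def activeSegs (x : ℝ) : Set P.Seg := {S | P.MaxOutstretched S ∧ x ∈ Ico (P.minX S) (P.maxX S)}

theorem injOn_edgeAt (x : ℝ) : InjOn (fun S => P.edgeAt S x) (P.activeSegs x) := by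
  rintro S ⟨hS, hSx⟩ T ⟨hT, hTx⟩ h
  have h : P.edgeAt S x = P.edgeAt T x := h
  have h1 := P.edgeAt_spec hSx
  have h2 := P.edgeAt_spec hTx
  rw [← h] at h2
  exact P.maxOutstretched_unique hS hT (P.not_vertical_of_mem_edgeIco h1.2) h1.1 h2.1

/-- `edgeAt` is a bijection between the segments that meet the sweep-line and the edges over `x`. It
turns counts of segments into the counts of edges that define ray parity. -/
theorem ncard_activeSegs (x : ℝ) (p : ℝ → Prop) :
    {S | S ∈ P.activeSegs x ∧ p (P.yVal S x)}.ncard =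
      {e | x ∈ P.edgeIco e ∧ p (P.edgeHeight e x)}.ncard := by
  have him : (fun S => P.edgeAt S x) '' {S | S ∈ P.activeSegs x ∧ p (P.yVal S x)} =
      {e | x ∈ P.edgeIco e ∧ p (P.edgeHeight e x)} := by
    ext e
    constructor
    · rintro ⟨S, ⟨hS, hp⟩, rfl⟩
      exact ⟨(P.edgeAt_spec hS.2).2, hp⟩
    · rintro ⟨hx, hp⟩
      obtain ⟨S, hS, heS⟩ := P.exists_maxOutstretched (P.not_vertical_of_mem_edgeIco hx)
      have h1 := P.edgeAt_eq hS.2.1 heS hx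
      refine ⟨S, ⟨⟨hS, P.edgeIco_subset heS hx⟩, ?_⟩, h1⟩
      rwa [yVal, h1]
  rw [← him, InjOn.ncard_image ((P.injOn_edgeAt x).mono fun S hS => hS.1)]

/-- Two segments of a polygon that meet the sweep-line in the same point start in that point. -/
theorem eq_minX_of_yVal_eq {S T : P.Seg} {x : ℝ} (hS : S ∈ P.activeSegs x)
    (hT : T ∈ P.activeSegs x) (hne : S ≠ T) (hy : P.yVal S x = P.yVal T x) : x = P.minX S := by
  obtain ⟨heS, hxS⟩ := P.edgeAt_spec hS.2
  obtain ⟨heT, hxT⟩ := P.edgeAt_spec hT.2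
  have hee : P.edgeAt S x ≠ P.edgeAt T x := fun h => hne (P.injOn_edgeAt x hS hT h)
  have hvS := P.not_vertical_of_mem_edgeIco hxS
  have hvT := P.not_vertical_of_mem_edgeIco hxT
  unfold yVal at hy
  set e := P.edgeAt S x
  set f := P.edgeAt T x
  have hmS : (x, P.edgeHeight e x) ∈ segment ℝ (P.vertex e) (P.vertex (e + 1)) :=
    (P.mem_edge_iff hvS).2 ⟨⟨hxS.1, hxS.2.le⟩, rfl⟩
  have hmT : (x, P.edgeHeight e x) ∈ segment ℝ (P.vertex f) (P.vertex (f + 1)) :=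
    (P.mem_edge_iff hvT).2 ⟨⟨hxT.1, hxT.2.le⟩, hy⟩
  -- The common point cannot be inside an edge, and `x` is not the right end of `e`, so it is the
  -- left end.
  have hno : (x, P.edgeHeight e x) ∉ openSegment ℝ (P.vertex e) (P.vertex (e + 1)) := fun h =>
    P.notMem_edge_of_ne hee h hmT
  have hleft : x = P.leftX e := by
    by_contra h
    exact hno ((P.mem_openEdge_iff hvS).2 ⟨⟨lt_of_le_of_ne hxS.1 (Ne.symm h), hxS.2⟩, rfl⟩)
  obtain ⟨σ, hσ, hdir⟩ := hS.1.2.1.exists_dir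
  have hwalk : ∀ j < (S.2 : ℕ), 0 ≤ σ * P.dx (P.shift S.1 j) := fun j hj =>
    hdir _ (P.mem_segEdges.2 ⟨j, hj, rfl⟩)
  obtain ⟨j, hj, hje⟩ := P.mem_segEdges.1 heS
  have hclash : f ∉ P.segEdges S := fun hf =>
    hne (P.maxOutstretched_unique hS.1 hT.1 hvT hf heT)
  have hdx : 0 ≤ σ * P.dx e := hdir e heS
  have hmin : ∀ v : ℝ, (∀ l ≤ (S.2 : ℕ), v ≤ (P.vertex (P.shift S.1 l)).1) → v ≤ P.minX S := by
    intro v hv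
    refine Finset.le_inf' _ _ fun i hi => ?_
    obtain ⟨l, hl, rfl⟩ := P.mem_segVerts.1 hi
    exact hv l hl
  refine le_antisymm ?_ hS.2.1
  rcases hσ with rfl | rfl
  · have hle : (P.vertex e).1 ≤ (P.vertex (e + 1)).1 := by rw [dx] at hdx; linarith
    rw [leftX, min_eq_left hle] at hleft
    have hpt : (x, P.edgeHeight e x) = P.vertex e := by
      rw [hleft, edgeHeight_start]
    rw [hpt] at hmT
    rcases P.vertex_mem_edge hmT with h | h
    · exact absurd h hee
    -- The edge `f` ends where `e` starts. Unless `e` is the first edge of `S`, this puts `f` into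
    -- `S` and gives `S = T`.
    · rcases Nat.eq_zero_or_pos j with rfl | hj0
      · refine hmin x fun l hl => ?_
        have := P.walk_monotone hwalk (Nat.zero_le l) hl
        rw [hje, ← hleft] at this
        linarith
      · exfalso
        refine hclash (P.mem_segEdges.2 ⟨j - 1, by omega, ?_⟩)
        apply add_right_cancel (b := (1 : P.Idx))
        rw [← h, ← hje, ← shift_succ]
        congr 1; omega
  · have hle : (P.vertex (e + 1)).1 ≤ (P.vertex e).1 := by rw [dx] at hdx; linarith
    rw [leftX, min_eq_right hle] at hleft
    have hpt : (x, P.edgeHeight e x) = P.vertex (e + 1) := by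
      rw [hleft, P.edgeHeight_end hvS]
    rw [hpt] at hmT
    rcases P.vertex_mem_edge hmT with h | h
    · rcases (show j + 1 ≤ (S.2 : ℕ) from hj).eq_or_lt with hjk | hjk
      · refine hmin x fun l hl => ?_
        have := P.walk_monotone hwalk hl (le_refl (S.2 : ℕ))
        rw [← hjk, shift_succ, hje, ← hleft] at this
        linarith
      · exfalso
        refine hclash (P.mem_segEdges.2 ⟨j + 1, hjk, ?_⟩)
        rw [shift_succ, hje, h]
    · exact absurd (add_right_cancel h) hee

end SimplePolygon
namespace SimplePolygon

open Set Filter Topology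

variable (P : SimplePolygon)

/-! ### Moving the sweep-line slightly to the right -/

/-- Half-open intervals are insensitive to small moves to the right, which is why the sweep-line is
always perturbed in that direction. -/
theorem eventually_mem_Ico {a b ξ : ℝ} : ∀ᶠ x in 𝓝[>] ξ, (x ∈ Ico a b ↔ ξ ∈ Ico a b) := by
  have hgt : ∀ᶠ x in 𝓝[>] ξ, ξ < x := self_mem_nhdsWithin
  have ha : ∀ᶠ x in 𝓝[>] ξ, (a ≤ x ↔ a ≤ ξ) := by
    rcases le_or_gt a ξ with h | h
    · filter_upwards [hgt] with x hx
      exact ⟨fun _ => h, fun _ => h.trans hx.le⟩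
    · filter_upwards [mem_nhdsWithin_of_mem_nhds (Iio_mem_nhds h)] with x hx
      exact ⟨fun h1 => absurd h1 (not_le.2 hx), fun h1 => absurd h1 (not_le.2 h)⟩
  have hb : ∀ᶠ x in 𝓝[>] ξ, (x < b ↔ ξ < b) := by
    rcases lt_or_ge ξ b with h | h
    · filter_upwards [mem_nhdsWithin_of_mem_nhds (Iio_mem_nhds h)] with x hx
      exact ⟨fun _ => h, fun _ => hx⟩
    · filter_upwards [hgt] with x hx
      exact ⟨fun h1 => hx.trans h1, fun h1 => absurd h1 (not_lt.2 h)⟩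
  filter_upwards [ha, hb] with x h1 h2
  rw [mem_Ico, mem_Ico, h1, h2]

theorem eventually_activeSegs (ξ : ℝ) : ∀ᶠ x in 𝓝[>] ξ, P.activeSegs x = P.activeSegs ξ := by
  have : ∀ᶠ x in 𝓝[>] ξ, ∀ S : P.Seg, (x ∈ Ico (P.minX S) (P.maxX S) ↔
      ξ ∈ Ico (P.minX S) (P.maxX S)) := eventually_all.2 fun S => eventually_mem_Ico
  filter_upwards [this] with x hx
  ext S
  simp only [activeSegs, mem_ofPred_eq, hx]

theorem eventually_edgeAt {ξ : ℝ} {S : P.Seg} (hS : S ∈ P.activeSegs ξ) :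
    ∀ᶠ x in 𝓝[>] ξ, P.edgeAt S x = P.edgeAt S ξ := by
  obtain ⟨h1, h2⟩ := P.edgeAt_spec hS.2
  have h3 : ∀ᶠ x in 𝓝[>] ξ, (x ∈ P.edgeIco (P.edgeAt S ξ) ↔ ξ ∈ P.edgeIco (P.edgeAt S ξ)) :=
    eventually_mem_Ico
  filter_upwards [h3] with x hx
  exact P.edgeAt_eq hS.1.2.1 h1 (hx.2 h2)

theorem edgeHeight_eq (e : P.Idx) (ξ x : ℝ) :
    P.edgeHeight e x = P.edgeHeight e ξ + P.edgeSlope e * (x - ξ) := by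
  simp only [edgeHeight]; ring

/-- The abscissa `x` is in general position with respect to `P` and `Q`. -/
def Generic (P Q : SimplePolygon) (x : ℝ) : Prop :=
  (∀ i, (P.vertex i).1 ≠ x) ∧ (∀ i, (Q.vertex i).1 ≠ x) ∧
    ∀ e f, P.edgeHeight e x = Q.edgeHeight f x → P.edgeSlope e = Q.edgeSlope f

theorem Generic.symm {P Q : SimplePolygon} {x : ℝ} (h : Generic P Q x) : Generic Q P x :=
  ⟨h.2.1, h.1, fun e f hef => (h.2.2 f e hef.symm).symm⟩

/-- Only finitely many abscissae are excluded: those of the corners and those where two lines of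
different slope cross. -/
theorem eventually_generic (P Q : SimplePolygon) (ξ : ℝ) : ∀ᶠ x in 𝓝[>] ξ, Generic P Q x := by
  have hne : ∀ c : ℝ, ∀ᶠ x in 𝓝[>] ξ, c ≠ x := fun c => by
    rcases eq_or_ne c ξ with rfl | h
    · filter_upwards [self_mem_nhdsWithin] with x hx using (ne_of_gt hx).symm
    · filter_upwards [mem_nhdsWithin_of_mem_nhds (isOpen_ne.mem_nhds h.symm)] with x hx using hx.symm
  refine (eventually_all.2 fun i => hne _).and ((eventually_all.2 fun i => hne _).and
    (eventually_all.2 fun e => eventually_all.2 fun f => ?_))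
  by_cases hs : P.edgeSlope e = Q.edgeSlope f
  · exact Eventually.of_forall fun _ _ => hs
  · have hs' : P.edgeSlope e - Q.edgeSlope f ≠ 0 := sub_ne_zero.2 hs
    filter_upwards [hne (ξ + (Q.edgeHeight f ξ - P.edgeHeight e ξ) /
      (P.edgeSlope e - Q.edgeSlope f))] with x hx hxe
    exfalso
    rw [P.edgeHeight_eq e ξ x, Q.edgeHeight_eq f ξ x] at hxe
    apply hx
    field_simp
    linear_combination -hxe

theorem eventually_height_le {P Q : SimplePolygon} {e : P.Idx} {f : Q.Idx} {ξ : ℝ}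
    (h : P.edgeHeight e ξ < Q.edgeHeight f ξ) :
    ∀ᶠ x in 𝓝[>] ξ, P.edgeHeight e x < Q.edgeHeight f x :=
  mem_nhdsWithin_of_mem_nhds ((isOpen_lt (P.continuous_edgeHeight e)
    (Q.continuous_edgeHeight f)).mem_nhds h)

theorem eventually_segsAbove {S : P.Seg} (hS : P.MaxOutstretched S) {ξ : ℝ}
    (hξ : ξ ∈ Ioo (P.minX S) (P.maxX S)) :
    ∀ᶠ x in 𝓝[>] ξ, P.segsAbove x S = P.segsAbove ξ S := by
  have hSa : S ∈ P.activeSegs ξ := ⟨hS, hξ.1.le, hξ.2⟩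
  have hall : ∀ᶠ x in 𝓝[>] ξ, ∀ T ∈ P.activeSegs ξ,
      (P.yVal S x ≤ P.yVal T x ↔ P.yVal S ξ ≤ P.yVal T ξ) := by
    refine eventually_all.2 fun T => ?_
    by_cases hT : T ∈ P.activeSegs ξ
    · rcases lt_trichotomy (P.yVal S ξ) (P.yVal T ξ) with h | h | h
      · filter_upwards [P.eventually_edgeAt hSa, P.eventually_edgeAt hT, eventually_height_le h]
          with x h1 h2 h3 _
        simp only [yVal, h1, h2]
        exact ⟨fun _ => h.le, fun _ => h3.le⟩
      -- Different segments could meet only at the start of `S`, and `ξ` lies strictly to its right.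
      · obtain rfl : S = T := by
          by_contra hne
          exact hξ.1.ne (P.eq_minX_of_yVal_eq hSa hT hne h).symm
        simp
      · filter_upwards [P.eventually_edgeAt hSa, P.eventually_edgeAt hT, eventually_height_le h]
          with x h1 h2 h3 _
        simp only [yVal, h1, h2]
        exact ⟨fun h4 => absurd h4 (not_le.2 h3), fun h4 => absurd h4 (not_le.2 h)⟩
    · simp [hT]
  filter_upwards [hall, P.eventually_activeSegs ξ] with x h1 h2
  ext T
  have h3 : T ∈ P.activeSegs x ↔ T ∈ P.activeSegs ξ := by rw [h2]
  simp only [activeSegs, mem_ofPred_eq] at h3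
  simp only [segsAbove, mem_ofPred_eq, ← and_assoc, h3]
  exact and_congr_right fun h => h1 T h

/-! ### Parities -/

theorem rayParity_eq_ncard (q : ℝ × ℝ) : P.rayParity q =
    (({e | q.1 ∈ P.edgeIco e ∧ q.2 < P.edgeHeight e q.1}.ncard : ℕ) : ZMod 2) := by
  classical
  have h : {e | q.1 ∈ P.edgeIco e ∧ q.2 < P.edgeHeight e q.1} =
      ((Finset.univ.filter fun e => q.1 ∈ P.edgeIco e ∧ q.2 < P.edgeHeight e q.1 :
        Finset P.Idx) : Set P.Idx) := by
    ext e; simp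
  rw [h, Set.ncard_coe_finset, ← Finset.sum_boole]
  unfold rayParity rayInd
  refine Finset.sum_congr rfl fun e _ => ?_
  congr

/-- The number of segments above a point off the curve has the ray parity of the point. -/
theorem rayParity_eq_ncard_activeSegs (x y : ℝ) : P.rayParity (x, y) =
    (({S | S ∈ P.activeSegs x ∧ y < P.yVal S x}.ncard : ℕ) : ZMod 2) := by
  rw [rayParity_eq_ncard, P.ncard_activeSegs x fun z => y < z]

theorem mem_openEdge_edgeAt {S : P.Seg} {x : ℝ} (hS : S ∈ P.activeSegs x)
    (hx : ∀ i, (P.vertex i).1 ≠ x) : (x, P.yVal S x) ∈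
      openSegment ℝ (P.vertex (P.edgeAt S x)) (P.vertex (P.edgeAt S x + 1)) := by
  obtain ⟨h1, h2⟩ := P.edgeAt_spec hS.2
  refine (P.mem_openEdge_iff (P.not_vertical_of_mem_edgeIco h2)).2
    ⟨⟨lt_of_le_of_ne h2.1 fun h => ?_, h2.2⟩, rfl⟩
  rcases min_choice (P.vertex (P.edgeAt S x)).1 (P.vertex (P.edgeAt S x + 1)).1 with h3 | h3
  · exact hx _ (h3.symm.trans h)
  · exact hx _ (h3.symm.trans h)

theorem SideIn.eventually_below {P : SimplePolygon} {σ : ℝ} {e : P.Idx} {x : ℝ}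
    {A : Set (ℝ × ℝ)} (hσ : 0 < σ * P.dx e) (h : P.SideIn σ e (x, P.edgeHeight e x) A) :
    ∀ᶠ δ in 𝓝[>] (0 : ℝ), (x, P.edgeHeight e x - δ) ∈ A := by
  have he : ¬ P.VerticalEdge e := fun he => by simp [P.dx_eq_zero.2 he] at hσ
  refine (tendsto_nhdsWithin_iff.2 ⟨?_, ?_⟩ : Tendsto
    (fun δ : ℝ => (x, P.edgeHeight e x - δ)) (𝓝[>] 0) (𝓝[P.side σ e] _)).eventually h
  · have : Continuous fun δ : ℝ => (x, P.edgeHeight e x - δ) := by fun_prop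
    have h0 := this.tendsto 0
    rw [sub_zero] at h0
    exact h0.mono_left nhdsWithin_le_nhds
  · filter_upwards [self_mem_nhdsWithin] with δ hδ
    have hδ : 0 < δ := hδ
    have : P.cross e (x, P.edgeHeight e x - δ) = -(P.dx e * δ) := by
      rw [P.cross_eq he, dx]; ring
    simp only [side, mem_ofPred_eq, this]
    nlinarith

theorem SideIn.eventually_above {P : SimplePolygon} {σ : ℝ} {e : P.Idx} {x : ℝ}
    {A : Set (ℝ × ℝ)} (hσ : σ * P.dx e < 0) (h : P.SideIn σ e (x, P.edgeHeight e x) A) :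
    ∀ᶠ δ in 𝓝[>] (0 : ℝ), (x, P.edgeHeight e x + δ) ∈ A := by
  have he : ¬ P.VerticalEdge e := fun he => by simp [P.dx_eq_zero.2 he] at hσ
  refine (tendsto_nhdsWithin_iff.2 ⟨?_, ?_⟩ : Tendsto
    (fun δ : ℝ => (x, P.edgeHeight e x + δ)) (𝓝[>] 0) (𝓝[P.side σ e] _)).eventually h
  · have : Continuous fun δ : ℝ => (x, P.edgeHeight e x + δ) := by fun_prop
    have h0 := this.tendsto 0
    rw [add_zero] at h0
    exact h0.mono_left nhdsWithin_le_nhds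
  · filter_upwards [self_mem_nhdsWithin] with δ hδ
    have hδ : 0 < δ := hδ
    have : P.cross e (x, P.edgeHeight e x + δ) = P.dx e * δ := by
      rw [P.cross_eq he, dx]; ring
    simp only [side, mem_ofPred_eq, this]
    nlinarith

/-- The interior of `P` lies on the side `σ` of its edges. -/
def Orientation (σ : ℝ) : Prop :=
  (σ = 1 ∨ σ = -1) ∧ (∀ e, P.EdgeSideIn univ σ e P.inside) ∧
    ∀ e, P.EdgeSideIn univ (-σ) e (P.parityRegion 0)

theorem exists_orientation_inside : ∃ σ, P.Orientation σ := by
  unfold Orientation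
  rw [inside_eq]
  exact P.exists_orientation

theorem Orientation.ne_zero {P : SimplePolygon} {σ : ℝ} (h : P.Orientation σ) : σ ≠ 0 := by
  rcases h.1 with rfl | rfl <;> norm_num

theorem dx_sign {S : P.Seg} (hS : P.Outstretched S) {σ : ℝ} {e f : P.Idx}
    (he : e ∈ P.segEdges S) (hf : f ∈ P.segEdges S) (hev : ¬ P.VerticalEdge e)
    (hfv : ¬ P.VerticalEdge f) (h : 0 < σ * P.dx e) : 0 < σ * P.dx f := by
  obtain ⟨τ, hτ, hdir⟩ := hS.exists_dir
  have h1 := hdir e he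
  have h2 := hdir f hf
  have h3 : P.dx e ≠ 0 := fun h => hev (P.dx_eq_zero.1 h)
  have h4 : P.dx f ≠ 0 := fun h => hfv (P.dx_eq_zero.1 h)
  rcases hτ with rfl | rfl
  · have h5 : 0 < P.dx e := lt_of_le_of_ne (by linarith) h3.symm
    have h6 : 0 < P.dx f := lt_of_le_of_ne (by linarith) h4.symm
    exact mul_pos (pos_of_mul_pos_left h h5.le) h6
  · have h5 : P.dx e < 0 := lt_of_le_of_ne (by linarith) h3
    have h6 : P.dx f < 0 := lt_of_le_of_ne (by linarith) h4
    exact mul_pos_of_neg_of_neg (neg_of_mul_pos_left h h5.le) h6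

/-- The segments not below `S` are those strictly above a point just below `S`, so their count has
the ray parity of that point. The point is interior iff side `σ` of the edge is its lower side. -/
theorem odd_segsAbove_iff {σ : ℝ} (hσ : P.Orientation σ) {S : P.Seg} {x : ℝ}
    (hS : S ∈ P.activeSegs x) (hx : ∀ i, (P.vertex i).1 ≠ x) :
    Odd (P.segsAbove x S).ncard ↔ 0 < σ * P.dx (P.edgeAt S x) := by
  have hopen := P.mem_openEdge_edgeAt hS hx
  have hv := P.not_vertical_of_mem_edgeIco (P.edgeAt_spec hS.2).2
  have hne : P.dx (P.edgeAt S x) ≠ 0 := fun h => hv (P.dx_eq_zero.1 h)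
  have hcount : ∀ᶠ δ in 𝓝[>] (0 : ℝ), P.rayParity (x, P.yVal S x - δ) =
      ((P.segsAbove x S).ncard : ZMod 2) := by
    have h1 : ∀ᶠ δ in 𝓝[>] (0 : ℝ), ∀ T : P.Seg,
        (P.yVal S x - δ < P.yVal T x ↔ P.yVal S x ≤ P.yVal T x) := by
      refine eventually_all.2 fun T => ?_
      rcases le_or_gt (P.yVal S x) (P.yVal T x) with h | h
      · filter_upwards [self_mem_nhdsWithin] with δ hδ
        have hδ : 0 < δ := hδ
        exact ⟨fun _ => h, fun _ => by linarith⟩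
      · filter_upwards [mem_nhdsWithin_of_mem_nhds (Iio_mem_nhds (sub_pos.2 h))] with δ hδ
        have hδ : δ < P.yVal S x - P.yVal T x := hδ
        exact ⟨fun h2 => by linarith, fun h2 => by linarith⟩
    filter_upwards [h1] with δ hδ
    rw [rayParity_eq_ncard_activeSegs]
    congr 2
    ext T
    simp only [segsAbove, activeSegs, mem_ofPred_eq, hδ T, and_assoc]
  have hpos : (0 < σ * P.dx (P.edgeAt S x) → Odd (P.segsAbove x S).ncard) := by
    intro h
    obtain ⟨δ, h1, h2⟩ := (hcount.and
      ((hσ.2.1 _ _ hopen trivial).eventually_below h)).exists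
    rw [mem_inside_iff] at h2
    rw [← ZMod.natCast_eq_one_iff_odd, ← h1]
    exact h2.2
  refine ⟨fun hodd => ?_, hpos⟩
  by_contra hneg
  have hneg' : 0 < -σ * P.dx (P.edgeAt S x) := by
    have : σ * P.dx (P.edgeAt S x) ≠ 0 := mul_ne_zero hσ.ne_zero hne
    rcases lt_or_gt_of_ne this with h | h
    · linarith
    · exact absurd h hneg
  obtain ⟨δ, h1, h2⟩ := (hcount.and
    ((hσ.2.2 _ _ hopen trivial).eventually_below hneg')).exists
  rw [← ZMod.natCast_eq_one_iff_odd, ← h1] at hodd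
  exact zero_ne_one (h2.2.symm.trans hodd)

theorem parity_eq_zero_or_one (S : P.Seg) : P.parity S = 0 ∨ P.parity S = 1 := by
  unfold parity
  split_ifs <;> simp

/-- The parity of a segment tells on which side the interior of the polygon lies. -/
theorem parity_eq_one_iff {σ : ℝ} (hσ : P.Orientation σ) {S : P.Seg}
    (hS : P.MaxOutstretched S) {e : P.Idx} (he : e ∈ P.segEdges S) (hev : ¬ P.VerticalEdge e) :
    P.parity S = 1 ↔ 0 < σ * P.dx e := by
  -- The count keeps its value on moving to a generic abscissa, and its parity depends only on the
  -- direction of `S`. Hence "for all `ξ`" and "for some `ξ`" agree in the definition of `parity`.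
  have key : ∀ ξ ∈ Ioo (P.minX S) (P.maxX S),
      (Odd (P.segsAbove ξ S).ncard ↔ 0 < σ * P.dx e) := by
    intro ξ hξ
    obtain ⟨x, h1, h2, h3⟩ := ((P.eventually_segsAbove hS hξ).and
      ((P.eventually_activeSegs ξ).and (eventually_generic P P ξ))).exists
    have hSx : S ∈ P.activeSegs x := by rw [h2]; exact ⟨hS, hξ.1.le, hξ.2⟩
    obtain ⟨h4, h5⟩ := P.edgeAt_spec hSx.2
    have h6 := P.not_vertical_of_mem_edgeIco h5
    rw [← h1, P.odd_segsAbove_iff hσ hSx h3.1]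
    exact ⟨P.dx_sign hS.2.1 h4 he h6 hev, P.dx_sign hS.2.1 he h4 hev h6⟩
  unfold parity
  split_ifs with h
  · simp only [false_iff]
    intro hpos
    obtain ⟨ξ, hξ⟩ := nonempty_Ioo.2 (P.minX_lt_maxX hS)
    exact Nat.not_even_iff_odd.2 ((key ξ hξ).2 hpos) (h ξ hξ)
  · simp only [true_iff]
    push Not at h
    obtain ⟨ξ, hξ, hodd⟩ := h
    exact (key ξ hξ).1 (Nat.not_even_iff_odd.1 hodd)

theorem parity_eq_zero_iff {σ : ℝ} (hσ : P.Orientation σ) {S : P.Seg}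
    (hS : P.MaxOutstretched S) {e : P.Idx} (he : e ∈ P.segEdges S) (hev : ¬ P.VerticalEdge e) :
    P.parity S = 0 ↔ σ * P.dx e < 0 := by
  have h1 := P.parity_eq_one_iff hσ hS he hev
  have h2 : σ * P.dx e ≠ 0 := mul_ne_zero hσ.ne_zero fun h => hev (P.dx_eq_zero.1 h)
  rcases P.parity_eq_zero_or_one S with h | h
  · have h3 : ¬ 0 < σ * P.dx e := fun h3 => by rw [← h1, h] at h3; exact zero_ne_one h3
    exact ⟨fun _ => lt_of_le_of_ne (not_lt.1 h3) h2, fun _ => h⟩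
  · refine ⟨fun h0 => ?_, fun h3 => absurd (h1.1 h) (not_lt.2 h3.le)⟩
    rw [h] at h0; exact absurd h0 one_ne_zero

/-- Just below and above a segment of parity `1` are the interior and the exterior. -/
theorem eventually_of_parity_one {S : P.Seg} {x : ℝ} (hS : S ∈ P.activeSegs x)
    (hx : ∀ i, (P.vertex i).1 ≠ x) (hp : P.parity S = 1) :
    ∀ᶠ δ in 𝓝[>] (0 : ℝ), (x, P.yVal S x - δ) ∈ P.inside ∧
      (x, P.yVal S x + δ) ∈ P.parityRegion 0 := by
  obtain ⟨σ, hσ⟩ := P.exists_orientation_inside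
  obtain ⟨h1, h2⟩ := P.edgeAt_spec hS.2
  have h3 := (P.parity_eq_one_iff hσ hS.1 h1 (P.not_vertical_of_mem_edgeIco h2)).1 hp
  have hopen := P.mem_openEdge_edgeAt hS hx
  exact ((hσ.2.1 _ _ hopen trivial).eventually_below h3).and
    ((hσ.2.2 _ _ hopen trivial).eventually_above (by linarith))

/-- Just above and below a segment of parity `0` are the interior and the exterior. -/
theorem eventually_of_parity_zero {S : P.Seg} {x : ℝ} (hS : S ∈ P.activeSegs x)
    (hx : ∀ i, (P.vertex i).1 ≠ x) (hp : P.parity S = 0) :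
    ∀ᶠ δ in 𝓝[>] (0 : ℝ), (x, P.yVal S x + δ) ∈ P.inside ∧
      (x, P.yVal S x - δ) ∈ P.parityRegion 0 := by
  obtain ⟨σ, hσ⟩ := P.exists_orientation_inside
  obtain ⟨h1, h2⟩ := P.edgeAt_spec hS.2
  have h3 := (P.parity_eq_zero_iff hσ hS.1 h1 (P.not_vertical_of_mem_edgeIco h2)).1 hp
  have hopen := P.mem_openEdge_edgeAt hS hx
  exact ((hσ.2.1 _ _ hopen trivial).eventually_above h3).and
    ((hσ.2.2 _ _ hopen trivial).eventually_below (by linarith))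

end SimplePolygon
namespace SimplePolygon

open Set Filter Topology

variable (P : SimplePolygon)

/-! ### An outstretched segment separates the strip above its interval -/

/-- The union of the edges of a segment. -/
def segPath (S : P.Seg) : Set (ℝ × ℝ) :=
  ⋃ e ∈ P.segEdges S, segment ℝ (P.vertex e) (P.vertex (e + 1))

theorem segPath_subset_curve (S : P.Seg) : P.segPath S ⊆ P.curve :=
  iUnion₂_subset fun e _ => P.segment_subset_curve e

theorem isCompact_segPath (S : P.Seg) : IsCompact (P.segPath S) :=
  (P.segEdges S).isCompact_biUnion fun e _ => P.isCompact_edge e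

/-- The points below which (in the wide sense) there is no point of `K`. -/
def strictlyBelow (K : Set (ℝ × ℝ)) : Set (ℝ × ℝ) := {p | ∀ y ≤ p.2, (p.1, y) ∉ K}

/-- The points above which (in the wide sense) there is no point of `K`. -/
def strictlyAbove (K : Set (ℝ × ℝ)) : Set (ℝ × ℝ) := {p | ∀ y, p.2 ≤ y → (p.1, y) ∉ K}

open scoped Pointwise in
-- The complement is the sum of the compact set `K` and a closed vertical half-line, hence closed.
theorem isOpen_strictlyAbove {K : Set (ℝ × ℝ)} (hK : IsCompact K) : IsOpen (strictlyAbove K) := by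
  have hcl : IsClosed ((({0} : Set ℝ) ×ˢ Iic (0 : ℝ)) + K) :=
    IsClosed.add_right_of_isCompact (isClosed_singleton.prod isClosed_Iic) hK
  convert hcl.isOpen_compl using 1
  ext p
  simp only [strictlyAbove, mem_ofPred_eq, mem_compl_iff, Set.mem_add, not_exists, not_and]
  constructor
  · rintro h ⟨a, b⟩ ⟨ha, hb⟩ ⟨c, d⟩ hk rfl
    obtain rfl : a = 0 := ha
    have hb : b ≤ 0 := hb
    refine h d ?_ ?_
    · simp only [Prod.mk_add_mk]; linarith
    · simpa using hk
  · intro h y hy hk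
    refine h (0, p.2 - y) ⟨rfl, ?_⟩ (p.1, y) hk ?_
    · simp only [mem_Iic]; linarith
    · ext <;> simp

open scoped Pointwise in
theorem isOpen_strictlyBelow {K : Set (ℝ × ℝ)} (hK : IsCompact K) : IsOpen (strictlyBelow K) := by
  have hcl : IsClosed ((({0} : Set ℝ) ×ˢ Ici (0 : ℝ)) + K) :=
    IsClosed.add_right_of_isCompact (isClosed_singleton.prod isClosed_Ici) hK
  convert hcl.isOpen_compl using 1
  ext p
  simp only [strictlyBelow, mem_ofPred_eq, mem_compl_iff, Set.mem_add, not_exists, not_and]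
  constructor
  · rintro h ⟨a, b⟩ ⟨ha, hb⟩ ⟨c, d⟩ hk rfl
    obtain rfl : a = 0 := ha
    have hb : 0 ≤ b := hb
    refine h d ?_ ?_
    · simp only [Prod.mk_add_mk]; linarith
    · simpa using hk
  · intro h y hy hk
    refine h (0, p.2 - y) ⟨rfl, ?_⟩ (p.1, y) hk ?_
    · simp only [mem_Ici]; linarith
    · ext <;> simp

theorem mem_edge_fst {σ : ℝ} {e : P.Idx} (he : 0 ≤ σ * P.dx e) {q : ℝ × ℝ}
    (hq : q ∈ segment ℝ (P.vertex e) (P.vertex (e + 1))) :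
    σ * (P.vertex e).1 ≤ σ * q.1 ∧ σ * q.1 ≤ σ * (P.vertex (e + 1)).1 := by
  obtain ⟨a, b, ha, hb, hab, rfl⟩ := hq
  obtain rfl : a = 1 - b := by linarith
  rw [dx] at he
  simp only [Prod.fst_add, Prod.smul_fst, smul_eq_mul]
  constructor <;> nlinarith

/-- A vertical line meets each edge in an interval. If it meets both edge `m` and an earlier edge,
monotonicity forces it through the corner where edge `m` starts, which joins the pieces. -/
theorem isPreconnected_segPath_fiber {S : P.Seg} (hS : P.Outstretched S) (t : ℝ) :
    IsPreconnected {y | (t, y) ∈ P.segPath S} := by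
  obtain ⟨σ, hσ, hdir⟩ := hS.exists_dir
  have hwalk : ∀ j < (S.2 : ℕ), 0 ≤ σ * P.dx (P.shift S.1 j) := fun j hj =>
    hdir _ (P.mem_segEdges.2 ⟨j, hj, rfl⟩)
  have key : ∀ m ≤ (S.2 : ℕ), IsPreconnected {y | ∃ j < m, (t, y) ∈
      segment ℝ (P.vertex (P.shift S.1 j)) (P.vertex (P.shift S.1 j + 1))} := by
    intro m
    induction m with
    | zero => intro _; simpa using isPreconnected_empty
    | succ m ih =>
      intro hm
      have hseg : IsPreconnected {y | (t, y) ∈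
          segment ℝ (P.vertex (P.shift S.1 m)) (P.vertex (P.shift S.1 m + 1))} := by
        refine Convex.isPreconnected fun y hy z hz a b ha hb hab => ?_
        have := convex_segment (𝕜 := ℝ) _ _ hy hz ha hb hab
        have h2 : a • (t, y) + b • (t, z) = (t, a • y + b • z) := by
          ext
          · simp only [Prod.fst_add, Prod.smul_fst, smul_eq_mul]
            rw [← add_mul, hab, one_mul]
          · simp
        rw [h2] at this
        exact this
      have hun : {y | ∃ j < m + 1, (t, y) ∈
            segment ℝ (P.vertex (P.shift S.1 j)) (P.vertex (P.shift S.1 j + 1))} =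
          {y | ∃ j < m, (t, y) ∈
            segment ℝ (P.vertex (P.shift S.1 j)) (P.vertex (P.shift S.1 j + 1))} ∪
          {y | (t, y) ∈
            segment ℝ (P.vertex (P.shift S.1 m)) (P.vertex (P.shift S.1 m + 1))} := by
        ext y
        constructor
        · rintro ⟨j, hj, hy⟩
          rcases (Nat.lt_succ_iff.1 hj).lt_or_eq with h | rfl
          · exact Or.inl ⟨j, h, hy⟩
          · exact Or.inr hy
        · rintro (⟨j, hj, hy⟩ | hy)
          · exact ⟨j, by omega, hy⟩
          · exact ⟨m, by omega, hy⟩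
      rw [hun]
      rcases eq_empty_or_nonempty {y | ∃ j < m, (t, y) ∈
        segment ℝ (P.vertex (P.shift S.1 j)) (P.vertex (P.shift S.1 j + 1))} with h0 | ⟨y, hy⟩
      · rwa [h0, empty_union]
      rcases eq_empty_or_nonempty {y | (t, y) ∈
        segment ℝ (P.vertex (P.shift S.1 m)) (P.vertex (P.shift S.1 m + 1))} with h0 | ⟨z, hz⟩
      · rw [h0, union_empty]; exact ih (by omega)
      obtain ⟨j, hj, hy⟩ := hy
      have h1 := (P.mem_edge_fst (hwalk j (by omega)) hy).2
      have h2 := P.walk_monotone hwalk (show j + 1 ≤ m by omega) (by omega)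
      rw [shift_succ] at h2
      have h3 := (P.mem_edge_fst (hwalk m (by omega)) hz).1
      have ht : (P.vertex (P.shift S.1 m)).1 = t := by
        rcases hσ with rfl | rfl <;> simp only at h1 h3 <;> linarith
      have hv : P.vertex (P.shift S.1 m) = (t, (P.vertex (P.shift S.1 m)).2) := Prod.ext ht rfl
      refine IsPreconnected.union (P.vertex (P.shift S.1 m)).2 ⟨m - 1, by omega, ?_⟩ ?_
        (ih (by omega)) hseg
      · rw [← hv, ← shift_succ, Nat.sub_add_cancel (by omega)]
        exact right_mem_segment ℝ _ _
      · rw [mem_ofPred_eq, ← hv]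
        exact left_mem_segment ℝ _ _
  convert key S.2 le_rfl using 1
  ext y
  simp only [segPath, mem_iUnion, mem_ofPred_eq, mem_segEdges, exists_prop]
  constructor
  · rintro ⟨_, ⟨j, hj, rfl⟩, hy⟩
    exact ⟨j, hj, hy⟩
  · rintro ⟨j, hj, hy⟩
    exact ⟨_, ⟨j, hj, rfl⟩, hy⟩

theorem mem_strictly_or {S : P.Seg} (hS : P.Outstretched S) {p : ℝ × ℝ} (hp : p ∉ P.segPath S) :
    p ∈ strictlyAbove (P.segPath S) ∨ p ∈ strictlyBelow (P.segPath S) := by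
  by_contra! h
  simp only [strictlyAbove, strictlyBelow, mem_ofPred_eq, not_forall, not_not] at h
  obtain ⟨⟨y, hy, hyK⟩, z, hz, hzK⟩ := h
  exact hp ((P.isPreconnected_segPath_fiber hS p.1).ordConnected.out hzK hyK ⟨hz, hy⟩)

theorem exists_mem_segPath {S : P.Seg} {x : ℝ} (hx : x ∈ Ico (P.minX S) (P.maxX S)) :
    (x, P.yVal S x) ∈ P.segPath S := by
  obtain ⟨h1, h2⟩ := P.edgeAt_spec hx
  exact mem_iUnion₂.2 ⟨_, h1, (P.mem_edge_iff (P.not_vertical_of_mem_edgeIco h2)).2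
    ⟨⟨h2.1, h2.2.le⟩, rfl⟩⟩

theorem mem_edge_generic {x y : ℝ} (hx : ∀ i, (P.vertex i).1 ≠ x) {e : P.Idx}
    (h : (x, y) ∈ segment ℝ (P.vertex e) (P.vertex (e + 1))) :
    x ∈ P.edgeIco e ∧ y = P.edgeHeight e x := by
  have hv : ¬ P.VerticalEdge e := fun hv => hx e ((P.mem_verticalEdge_iff hv).1 h).1.symm
  obtain ⟨h1, h2⟩ := (P.mem_edge_iff hv).1 h
  refine ⟨⟨h1.1, lt_of_le_of_ne h1.2 fun h3 => ?_⟩, h2⟩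
  rcases max_choice (P.vertex e).1 (P.vertex (e + 1)).1 with h4 | h4
  · exact hx _ (h4.symm.trans h3.symm)
  · exact hx _ (h4.symm.trans h3.symm)

theorem mem_curve_generic {x y : ℝ} (hx : ∀ i, (P.vertex i).1 ≠ x) (h : (x, y) ∈ P.curve) :
    ∃ S ∈ P.activeSegs x, P.yVal S x = y := by
  obtain ⟨e, he⟩ := mem_iUnion.1 h
  obtain ⟨h1, rfl⟩ := P.mem_edge_generic hx he
  obtain ⟨S, hS, heS⟩ := P.exists_maxOutstretched (P.not_vertical_of_mem_edgeIco h1)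
  refine ⟨S, ⟨hS, P.edgeIco_subset heS h1⟩, ?_⟩
  rw [yVal, P.edgeAt_eq hS.2.1 heS h1]

theorem exists_vertex_eq_minX (S : P.Seg) : ∃ i, (P.vertex i).1 = P.minX S := by
  obtain ⟨i, -, hi⟩ := Finset.exists_mem_eq_inf' (P.segVerts_nonempty S) fun i => (P.vertex i).1
  exact ⟨i, hi.symm⟩

theorem minX_lt_of_generic {S : P.Seg} {x : ℝ} (hS : S ∈ P.activeSegs x)
    (hx : ∀ i, (P.vertex i).1 ≠ x) : P.minX S < x := by
  obtain ⟨i, hi⟩ := P.exists_vertex_eq_minX S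
  exact lt_of_le_of_ne hS.2.1 fun h => hx i (hi.trans h)

theorem yVal_ne_of_generic {S T : P.Seg} {x : ℝ} (hS : S ∈ P.activeSegs x)
    (hT : T ∈ P.activeSegs x) (hx : ∀ i, (P.vertex i).1 ≠ x) (hne : S ≠ T) :
    P.yVal S x ≠ P.yVal T x := fun h =>
  (P.minX_lt_of_generic hS hx).ne (P.eq_minX_of_yVal_eq hS hT hne h).symm

/-! ### The vertical order of two segments does not change -/

/-- On its inner side, `S` lies above `T` at the abscissa `x`. -/
def InnerAbove (P Q : SimplePolygon) (S : P.Seg) (T : Q.Seg) (x : ℝ) : Prop :=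
  (P.parity S = 1 ∧ Q.yVal T x < P.yVal S x) ∨ (P.parity S = 0 ∧ Q.yVal T x ≤ P.yVal S x)

/-- Over the common interval, the path of `T` cuts the interior of `P` into an open upper and an
open lower part, as this interior avoids the curve `Q`. Following `S` through the strip, its inner
side stays in the same part. -/
theorem innerAbove_persistent {P Q : SimplePolygon} (hPQ : Disjoint P.inside Q.curve) {S : P.Seg}
    {T : Q.Seg} {x x' : ℝ} (hS : S ∈ P.activeSegs x) (hT : T ∈ Q.activeSegs x)
    (hS' : S ∈ P.activeSegs x') (hT' : T ∈ Q.activeSegs x') (hPx : ∀ i, (P.vertex i).1 ≠ x)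
    (hQx : ∀ i, (Q.vertex i).1 ≠ x) (hPx' : ∀ i, (P.vertex i).1 ≠ x')
    (hQx' : ∀ i, (Q.vertex i).1 ≠ x') : InnerAbove P Q S T x ↔ InnerAbove P Q S T x' := by
  obtain ⟨σ, hσ⟩ := P.exists_orientation_inside
  set a := max (P.minX S) (Q.minX T) with ha
  set b := min (P.maxX S) (Q.maxX T) with hb
  set W : Set (ℝ × ℝ) := {p | p.1 ∈ Ioo a b} with hWdef
  have hWo : IsOpen W := isOpen_Ioo.preimage continuous_fst
  have hWc : Convex ℝ W := (convex_Ioo a b).linear_preimage (LinearMap.fst ℝ ℝ ℝ)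
  set A := strictlyAbove (Q.segPath T) ∩ (W ∩ P.inside) with hA
  -- The exterior of `P` is added to the lower part only to have `A` and `B` cover the strip off the
  -- curve `P`; the inner side of `S` never lies in it.
  set B := strictlyBelow (Q.segPath T) ∩ (W ∩ P.inside) ∪ P.parityRegion 0 with hB
  have hAo : IsOpen A := (isOpen_strictlyAbove (Q.isCompact_segPath T)).inter
    (hWo.inter P.isOpen_inside)
  have hBo : IsOpen B := ((isOpen_strictlyBelow (Q.isCompact_segPath T)).inter
    (hWo.inter P.isOpen_inside)).union (P.isOpen_parityRegion 0)
  have hdisj0 : Disjoint P.inside (P.parityRegion 0) := by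
    rw [inside_eq]; exact P.disjoint_parityRegion one_ne_zero
  have hAB : Disjoint A B := by
    rw [Set.disjoint_left]
    rintro p ⟨h1, h2, h3⟩ (⟨h4, -⟩ | h4)
    · have h5 : p.1 ∈ Ico (Q.minX T) (Q.maxX T) :=
        ⟨(le_max_right _ _).trans h2.1.le, h2.2.trans_le (min_le_right _ _)⟩
      have h6 := Q.exists_mem_segPath h5
      rcases le_total p.2 (Q.yVal T p.1) with h | h
      · exact h1 _ h h6
      · exact h4 _ h h6
    · exact Set.disjoint_left.1 hdisj0 h3 h4
  have hcov : W ∩ P.curveᶜ ⊆ A ∪ B := by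
    rintro p ⟨hpW, hp⟩
    rcases P.compl_curve_subset_parityRegion hp with h | h
    · rw [← inside_eq] at h
      rcases Q.mem_strictly_or hT.1.2.1
        (fun hK => Set.disjoint_left.1 hPQ h (Q.segPath_subset_curve T hK)) with h1 | h1
      · exact Or.inl ⟨h1, hpW, h⟩
      · exact Or.inr (Or.inl ⟨h1, hpW, h⟩)
    · exact Or.inr (Or.inr h)
  -- the inner side of `S` is above `T` at an abscissa iff it lies in `A` there
  have hpoint : ∀ z, S ∈ P.activeSegs z → T ∈ Q.activeSegs z → (∀ i, (P.vertex i).1 ≠ z) →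
      (∀ i, (Q.vertex i).1 ≠ z) → (z ∈ Ioo a b ∧
        (InnerAbove P Q S T z ↔ P.EdgeSideIn W σ (P.edgeAt S z) A)) := by
    intro z hSz hTz hPz hQz
    have hzW : z ∈ Ioo a b := ⟨max_lt (P.minX_lt_of_generic hSz hPz)
      (Q.minX_lt_of_generic hTz hQz), lt_min hSz.2.2 hTz.2.2⟩
    refine ⟨hzW, ?_⟩
    obtain ⟨h1, h2⟩ := P.edgeAt_spec hSz.2
    have h3 := P.not_vertical_of_mem_edgeIco h2
    have hopen := P.mem_openEdge_edgeAt hSz hPz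
    have habove : ∀ y, (z, y) ∈ A → Q.yVal T z < y := fun y hy => by
      by_contra hle
      exact hy.1 _ (not_lt.1 hle) (Q.exists_mem_segPath hTz.2)
    have hbelow : ∀ y, (z, y) ∈ B ∩ P.inside → y < Q.yVal T z := by
      rintro y ⟨hy | hy, hy'⟩
      · by_contra hle
        exact hy.1 _ (not_lt.1 hle) (Q.exists_mem_segPath hTz.2)
      · exact absurd hy (Set.disjoint_left.1 hdisj0 hy')
    have hiff : P.EdgeSideIn W σ (P.edgeAt S z) A ↔
        P.SideIn σ (P.edgeAt S z) (z, P.yVal S z) A :=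
      ⟨fun h => h _ hopen hzW, fun h t ht htW =>
        h.along_edge hσ.ne_zero hWc hWo hAo hBo hAB hcov hopen hzW ht htW⟩
    have hor : P.SideIn σ (P.edgeAt S z) (z, P.yVal S z) A ∨
        P.SideIn σ (P.edgeAt S z) (z, P.yVal S z) (B ∩ P.inside) := by
      have := P.sideIn_or hAo hBo hAB (((P.sideIn_of_mem_nhds (σ := σ) (e := P.edgeAt S z)
        (t := (z, P.yVal S z)) (hWo.mem_nhds hzW)).inter (P.sideIn_compl_curve hopen)).mono hcov)
      exact this.imp_right fun h => h.inter (hσ.2.1 _ _ hopen trivial)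
    have hpos : ∀ᶠ δ in 𝓝[>] (0 : ℝ), 0 < δ := self_mem_nhdsWithin
    rw [hiff]
    rcases P.parity_eq_zero_or_one S with hp | hp
    · have hs := (P.parity_eq_zero_iff hσ hSz.1 h1 h3).1 hp
      -- For parity `0` the inner side is just above `S`, so it is above `T` even where `S` touches
      -- `T`. For parity `1` it is just below `S`, and the inequality must be strict.
      simp only [InnerAbove, hp, zero_ne_one, false_and, true_and, false_or]
      constructor
      · intro hy
        refine hor.resolve_right fun h => ?_
        obtain ⟨δ, h5, h6⟩ := (hpos.and (h.eventually_above hs)).exists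
        have h7 : P.yVal S z + δ < Q.yVal T z := hbelow _ h6
        linarith
      · intro h
        by_contra hlt
        obtain ⟨δ, ⟨h5, h6⟩, h8⟩ := ((hpos.and (h.eventually_above hs)).and
          (mem_nhdsWithin_of_mem_nhds (Iio_mem_nhds (sub_pos.2 (not_le.1 hlt))))).exists
        have h7 : Q.yVal T z < P.yVal S z + δ := habove _ h6
        have h8 : δ < Q.yVal T z - P.yVal S z := h8
        linarith
    · have hs := (P.parity_eq_one_iff hσ hSz.1 h1 h3).1 hp
      simp only [InnerAbove, hp, one_ne_zero, false_and, true_and, or_false]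
      constructor
      · intro hy
        refine hor.resolve_right fun h => ?_
        obtain ⟨δ, ⟨h5, h6⟩, h8⟩ := ((hpos.and (h.eventually_below hs)).and
          (mem_nhdsWithin_of_mem_nhds (Iio_mem_nhds (sub_pos.2 hy)))).exists
        have h7 : P.yVal S z - δ < Q.yVal T z := hbelow _ h6
        have h8 : δ < P.yVal S z - Q.yVal T z := h8
        linarith
      · intro h
        obtain ⟨δ, h5, h6⟩ := (hpos.and (h.eventually_below hs)).exists
        have h7 : Q.yVal T z < P.yVal S z - δ := habove _ h6
        linarith
  obtain ⟨hxW, hx⟩ := hpoint x hS hT hPx hQx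
  obtain ⟨hxW', hx'⟩ := hpoint x' hS' hT' hPx' hQx'
  rw [hx, hx']
  -- follow `S` from one abscissa to the other
  obtain ⟨τ, hτ, hdir⟩ := hS.1.2.1.exists_dir
  have hwalk : ∀ j < (S.2 : ℕ), 0 ≤ τ * P.dx (P.shift S.1 j) := fun j hj =>
    hdir _ (P.mem_segEdges.2 ⟨j, hj, rfl⟩)
  have hmain : ∀ z z', z ∈ Ioo a b → z' ∈ Ioo a b → ∀ j l : ℕ, j ≤ l → l < (S.2 : ℕ) →
      z ∈ P.edgeIco (P.shift S.1 j) → z' ∈ P.edgeIco (P.shift S.1 l) →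
      (P.EdgeSideIn W σ (P.shift S.1 j) A ↔ P.EdgeSideIn W σ (P.shift S.1 l) A) := by
    intro z z' hz hz' j l hjl hl hzj hzl
    have hmem : ∀ z m, z ∈ P.edgeIco (P.shift S.1 m) → (z, P.edgeHeight (P.shift S.1 m) z) ∈
        segment ℝ (P.vertex (P.shift S.1 m)) (P.vertex (P.shift S.1 m + 1)) := fun z m hzm =>
      (P.mem_edge_iff (P.not_vertical_of_mem_edgeIco hzm)).2 ⟨⟨hzm.1, hzm.2.le⟩, rfl⟩
    have h1 := (P.mem_edge_fst (hwalk j (by omega)) (hmem z j hzj)).2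
    have h2 := (P.mem_edge_fst (hwalk l (by omega)) (hmem z' l hzl)).1
    simp only at h1 h2
    have key : ∀ m, j ≤ m → m ≤ l →
        (P.EdgeSideIn W σ (P.shift S.1 j) A ↔ P.EdgeSideIn W σ (P.shift S.1 m) A) := by
      intro m hjm
      induction m, hjm using Nat.le_induction with
      | base => intro _; exact Iff.rfl
      | succ m hjm ih =>
        intro hml
        rw [ih (by omega), shift_succ]
        refine P.edgeSideIn_succ_iff hσ.ne_zero hWc hWo hAo hBo hAB hcov ?_
        -- By monotonicity, the corners passed on the way lie between `z` and `z'`, hence in the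
        -- strip.
        have h3 := P.walk_monotone hwalk (show j + 1 ≤ m + 1 by omega) (by omega)
        have h4 := P.walk_monotone hwalk hml (by omega)
        rw [shift_succ, shift_succ] at h3
        rw [shift_succ] at h4
        change (P.vertex (P.shift S.1 m + 1)).1 ∈ Ioo a b
        rcases hτ with rfl | rfl
        · exact ⟨by linarith [hz.1], by linarith [hz'.2]⟩
        · exact ⟨by linarith [hz'.1], by linarith [hz.2]⟩
    exact key l hjl le_rfl
  obtain ⟨h1, h2⟩ := P.edgeAt_spec hS.2
  obtain ⟨h3, h4⟩ := P.edgeAt_spec hS'.2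
  obtain ⟨j, hj, hje⟩ := P.mem_segEdges.1 h1
  obtain ⟨l, hl, hle⟩ := P.mem_segEdges.1 h3
  rw [← hje] at h2 ⊢
  rw [← hle] at h4 ⊢
  rcases le_total j l with h | h
  · exact hmain x x' hxW hxW' j l h hl h2 h4
  · exact (hmain x' x hxW' hxW l j h hj h4 h2).symm

end SimplePolygon
namespace PolySeg

open Set Filter Topology SimplePolygon

/-! ### The order of the segments on the sweep-line -/

/-- The segment is maximal outstretched and meets the sweep-line at `ξ`. -/
def Active (ξ : ℝ) (s : PolySeg) : Prop := s.2 ∈ s.1.activeSegs ξ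

/-- `P` equals `Q`, is contained in `Q`, or is disjoint from `Q`. -/
def Nested (P Q : SimplePolygon) : Prop :=
  P = Q ∨ Disjoint P.inside Q.inside ∨ P.inside ⊂ Q.inside

theorem Nested.disjoint_curve {P Q : SimplePolygon} (h : Nested P Q) :
    Disjoint P.inside Q.curve := by
  rcases h with rfl | h | h
  · exact P.disjoint_inside_curve
  · exact disjoint_inside_curve_of_disjoint h
  · exact Q.disjoint_inside_curve.mono_left h.subset

/-- If the heights differ, they decide both relations. At equal heights the slopes agree by
genericity and the polygons differ; then parity tells on which side each interior lies, and for
equal parities the area rule puts the inner side of the smaller polygon on the correct side. -/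
theorem before_iff_innerAbove {s t : PolySeg} (hst : s ≠ t) (hn : Nested s.1 t.1) {x : ℝ}
    (hs : s.Active x) (ht : t.Active x) (hg : Generic s.1 t.1 x) :
    (Before x s t ↔ InnerAbove s.1 t.1 s.2 t.2 x) ∧
      (Before x t s ↔ ¬ InnerAbove s.1 t.1 s.2 t.2 x) := by
  obtain ⟨P, S⟩ := s
  obtain ⟨Q, T⟩ := t
  simp only [Active] at hs ht hg hn
  simp only [Before, InnerAbove, yVal, slopeAt, parity]
  have hpar := P.parity_eq_zero_or_one S
  rcases lt_trichotomy (P.yVal S x) (Q.yVal T x) with hy | hy | hy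
  · simp [hy, hy.not_gt, hy.ne, hy.not_ge, hy.ne']
  · have hPQ : P ≠ Q := by
      rintro rfl
      exact P.yVal_ne_of_generic hs ht hg.1 (fun h => hst (by rw [h])) hy
    have hslope : P.slopeAt S x = Q.slopeAt T x := hg.2.2 _ _ hy
    -- Coinciding segments of equal parity have common interior points right beside them, so the
    -- interiors are not disjoint and `P` is enclosed by `Q`.
    have harea : P.parity S = Q.parity T → P.area < Q.area := by
      intro hp
      refine area_lt ((hn.resolve_left hPQ).resolve_left fun hd => ?_)
      rcases hpar with h0 | h1
      · obtain ⟨δ, h1, h2⟩ := ((P.eventually_of_parity_zero hs hg.1 h0).and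
          (Q.eventually_of_parity_zero ht hg.2.1 (hp.symm.trans h0))).exists
        rw [← hy] at h2
        exact Set.disjoint_left.1 hd h1.1 h2.1
      · obtain ⟨δ, h1, h2⟩ := ((P.eventually_of_parity_one hs hg.1 h1).and
          (Q.eventually_of_parity_one ht hg.2.1 (hp.symm.trans h1))).exists
        rw [← hy] at h2
        exact Set.disjoint_left.1 hd h1.1 h2.1
    have hpar' := Q.parity_eq_zero_or_one T
    rcases hpar with h0 | h0 <;> rcases hpar' with h1 | h1
    · have := harea (h0.trans h1.symm)
      simp [hy, hslope, h0, h1, this, this.le]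
    · simp [hy, hslope, h0, h1]
    · simp [hy, hslope, h0, h1]
    · have := harea (h0.trans h1.symm)
      simp [hy, hslope, h0, h1, this, this.le]
  · rcases hpar with h0 | h0 <;> simp [hy, hy.not_gt, hy.ne, hy.ne', h0, hy.le]

/-- The relation at `ξ` is the vertical order just to the right of `ξ`: at equal heights the slope
decides which segment is higher there, and the parity and area rules apply only to segments that run
together. -/
theorem eventually_before_iff {s t : PolySeg} {ξ : ℝ} (hs : s.Active ξ) (ht : t.Active ξ) :
    ∀ᶠ x in 𝓝[>] ξ, (Before x s t ↔ Before ξ s t) := by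
  obtain ⟨P, S⟩ := s
  obtain ⟨Q, T⟩ := t
  simp only [Active] at hs ht
  simp only [Before, yVal, slopeAt, parity]
  have hpos : ∀ᶠ x in 𝓝[>] ξ, ξ < x := self_mem_nhdsWithin
  rcases lt_trichotomy (P.yVal S ξ) (Q.yVal T ξ) with hy | hy | hy
  · filter_upwards [P.eventually_edgeAt hs, Q.eventually_edgeAt ht, eventually_height_le hy]
      with x h1 h2 h3
    have h4 : P.yVal S x < Q.yVal T x := by simpa only [SimplePolygon.yVal, h1, h2] using h3
    simp [hy.not_gt, hy.ne, h4.not_gt, h4.ne]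
  · filter_upwards [P.eventually_edgeAt hs, Q.eventually_edgeAt ht, hpos] with x h1 h2 h3
    have h4 : P.yVal S x = Q.yVal T x + (P.slopeAt S ξ - Q.slopeAt T ξ) * (x - ξ) := by
      simp only [SimplePolygon.yVal, SimplePolygon.slopeAt] at hy ⊢
      rw [h1, h2, P.edgeHeight_eq _ ξ x, Q.edgeHeight_eq _ ξ x, hy]; ring
    have h5 : P.slopeAt S x = P.slopeAt S ξ := by simp only [SimplePolygon.slopeAt, h1]
    have h6 : Q.slopeAt T x = Q.slopeAt T ξ := by simp only [SimplePolygon.slopeAt, h2]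
    rw [h5, h6]
    rcases lt_trichotomy (P.slopeAt S ξ) (Q.slopeAt T ξ) with h7 | h7 | h7
    · have h8 : P.yVal S x < Q.yVal T x := by nlinarith
      simp [hy, h7.not_gt, h7.ne, h8.not_gt, h8.ne]
    · have h8 : P.yVal S x = Q.yVal T x := by rw [h4, h7]; ring
      simp [hy, h8]
    · have h8 : Q.yVal T x < P.yVal S x := by nlinarith
      simp [hy, h7, h8]
  · filter_upwards [P.eventually_edgeAt hs, Q.eventually_edgeAt ht, eventually_height_le hy]
      with x h1 h2 h3
    have h4 : Q.yVal T x < P.yVal S x := by simpa only [SimplePolygon.yVal, h1, h2] using h3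
    simp [hy, h4]

theorem eventually_active (s : PolySeg) (ξ : ℝ) : ∀ᶠ x in 𝓝[>] ξ, (s.Active x ↔ s.Active ξ) := by
  filter_upwards [s.1.eventually_activeSegs ξ] with x hx
  rw [Active, hx, Active]

theorem before_or_before {s t : PolySeg} (hst : s ≠ t) (hn : Nested s.1 t.1 ∨ Nested t.1 s.1)
    {ξ : ℝ} (hs : s.Active ξ) (ht : t.Active ξ) : Before ξ s t ∨ Before ξ t s := by
  obtain ⟨x, h1, h2, h3, h4, hg⟩ := ((eventually_before_iff hs ht).and
    ((eventually_before_iff ht hs).and ((eventually_active s ξ).and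
      ((eventually_active t ξ).and (eventually_generic s.1 t.1 ξ))))).exists
  rw [← h1, ← h2]
  rcases hn with hn | hn
  · obtain ⟨h5, h6⟩ := before_iff_innerAbove hst hn (h3.2 hs) (h4.2 ht) hg
    rw [h5, h6]
    exact em _
  · obtain ⟨h5, h6⟩ := before_iff_innerAbove hst.symm hn (h4.2 ht) (h3.2 hs) hg.symm
    rw [h5, h6]
    exact (em _).symm

/-- The order of two segments is the same at all abscissae where both are present. -/
theorem before_persistent {s t : PolySeg} (hst : s ≠ t)
    (hn : Nested s.1 t.1 ∨ Nested t.1 s.1) {ξ ξ' : ℝ} (hs : s.Active ξ) (ht : t.Active ξ)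
    (hs' : s.Active ξ') (ht' : t.Active ξ') : Before ξ s t ↔ Before ξ' s t := by
  obtain ⟨x, h1, h3, h4, hg⟩ := ((eventually_before_iff hs ht).and
    ((eventually_active s ξ).and
      ((eventually_active t ξ).and (eventually_generic s.1 t.1 ξ)))).exists
  obtain ⟨x', h1', h3', h4', hg'⟩ := ((eventually_before_iff hs' ht').and
    ((eventually_active s ξ').and
      ((eventually_active t ξ').and (eventually_generic s.1 t.1 ξ')))).exists
  rw [← h1, ← h1']
  rcases hn with hn | hn
  · rw [(before_iff_innerAbove hst hn (h3.2 hs) (h4.2 ht) hg).1,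
      (before_iff_innerAbove hst hn (h3'.2 hs') (h4'.2 ht') hg').1]
    exact innerAbove_persistent hn.disjoint_curve (h3.2 hs) (h4.2 ht) (h3'.2 hs') (h4'.2 ht')
      hg.1 hg.2.1 hg'.1 hg'.2.1
  · rw [(before_iff_innerAbove hst.symm hn (h4.2 ht) (h3.2 hs) hg.symm).2,
      (before_iff_innerAbove hst.symm hn (h4'.2 ht') (h3'.2 hs') hg'.symm).2]
    exact not_congr (innerAbove_persistent hn.disjoint_curve (h4.2 ht) (h3.2 hs) (h4'.2 ht')
      (h3'.2 hs') hg.2.1 hg.1 hg'.2.1 hg'.1)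

/-! ### Counting the segments above a segment -/

/-- A point slightly below height `y` counts the segments weakly above `y`, a point slightly above
counts those strictly above. This matches the two inequalities in `InnerAbove`. -/
theorem eventually_lt_yVal_sub (Q : SimplePolygon) (x y : ℝ) :
    ∀ᶠ δ in 𝓝[>] (0 : ℝ), ∀ T : Q.Seg, (y - δ < Q.yVal T x ↔ y ≤ Q.yVal T x) ∧
      (y + δ < Q.yVal T x ↔ y < Q.yVal T x) ∧ y - δ ≠ Q.yVal T x ∧ y + δ ≠ Q.yVal T x := by
  refine eventually_all.2 fun T => ?_
  have hpos : ∀ᶠ δ in 𝓝[>] (0 : ℝ), 0 < δ := self_mem_nhdsWithin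
  rcases lt_trichotomy y (Q.yVal T x) with h | h | h
  · filter_upwards [hpos, mem_nhdsWithin_of_mem_nhds (Iio_mem_nhds (sub_pos.2 h))] with δ h1 h2
    have h2 : δ < Q.yVal T x - y := h2
    exact ⟨⟨fun _ => h.le, fun _ => by linarith⟩, ⟨fun _ => h, fun _ => by linarith⟩,
      (by linarith : y - δ < Q.yVal T x).ne, (by linarith : y + δ < Q.yVal T x).ne⟩
  · filter_upwards [hpos] with δ h1
    exact ⟨⟨fun _ => h.le, fun _ => by linarith⟩, ⟨fun _ => by linarith, fun _ => by linarith⟩,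
      (by linarith : y - δ < Q.yVal T x).ne, (by linarith : Q.yVal T x < y + δ).ne'⟩
  · filter_upwards [hpos, mem_nhdsWithin_of_mem_nhds (Iio_mem_nhds (sub_pos.2 h))] with δ h1 h2
    have h2 : δ < y - Q.yVal T x := h2
    exact ⟨⟨fun _ => by linarith, fun _ => by linarith⟩,
      ⟨fun _ => by linarith, fun _ => by linarith⟩,
      (by linarith : Q.yVal T x < y - δ).ne', (by linarith : Q.yVal T x < y + δ).ne'⟩

theorem notMem_curve_of_ne {Q : SimplePolygon} {x y : ℝ} (hx : ∀ i, (Q.vertex i).1 ≠ x)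
    (h : ∀ T : Q.Seg, y ≠ Q.yVal T x) : (x, y) ∉ Q.curve := fun hc => by
  obtain ⟨T, -, hT⟩ := Q.mem_curve_generic hx hc
  exact h T hT.symm

theorem odd_ncard_iff_mem_inside {Q : SimplePolygon} {x y : ℝ} (hc : (x, y) ∉ Q.curve)
    {N : Set Q.Seg} (hN : ∀ T ∈ Q.activeSegs x, (T ∈ N ↔ y < Q.yVal T x))
    (hNa : N ⊆ Q.activeSegs x) : Odd N.ncard ↔ (x, y) ∈ Q.inside := by
  have : N = {S | S ∈ Q.activeSegs x ∧ y < Q.yVal S x} := by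
    ext T
    exact ⟨fun h => ⟨hNa h, (hN T (hNa h)).1 h⟩, fun h => (hN T h.1).2 h.2⟩
  rw [mem_inside_iff, rayParity_eq_ncard_activeSegs, ← this, ZMod.natCast_eq_one_iff_odd]
  exact ⟨fun h => ⟨hc, h⟩, fun h => h.2⟩

/-- The segments of `Q` that precede `s` on the sweep-line. -/
def preceding (Q : SimplePolygon) (ξ : ℝ) (s : PolySeg) : Set Q.Seg :=
  {T | T ∈ Q.activeSegs ξ ∧ Before ξ ⟨Q, T⟩ s}

theorem eventually_preceding {Q : SimplePolygon} {ξ : ℝ} {s : PolySeg} (hs : s.Active ξ) :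
    ∀ᶠ x in 𝓝[>] ξ, preceding Q x s = preceding Q ξ s := by
  have : ∀ᶠ x in 𝓝[>] ξ, ∀ T : Q.Seg, T ∈ Q.activeSegs ξ →
      (Before x ⟨Q, T⟩ s ↔ Before ξ ⟨Q, T⟩ s) := eventually_all.2 fun T => by
    by_cases hT : T ∈ Q.activeSegs ξ
    · simpa [hT] using eventually_before_iff (s := ⟨Q, T⟩) hT hs
    · simp [hT]
  filter_upwards [this, Q.eventually_activeSegs ξ] with x h1 h2
  ext T
  simp only [preceding, mem_ofPred_eq, h2]
  exact and_congr_right fun h => h1 T h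

theorem odd_preceding_generic {s : PolySeg} {Q : SimplePolygon} (hQ : s.1 ≠ Q)
    (hn : Nested s.1 Q ∨ Nested Q s.1) {x : ℝ} (hs : s.Active x) (hg : Generic s.1 Q x) :
    Odd (preceding Q x s).ncard ↔ s.1.inside ⊂ Q.inside := by
  obtain ⟨P, S⟩ := s
  simp only [Active] at hs hg hn hQ ⊢
  have hne : ∀ T : Q.Seg, (⟨P, S⟩ : PolySeg) ≠ ⟨Q, T⟩ := fun T h => hQ (congrArg Sigma.fst h)
  have hsub : preceding Q x ⟨P, S⟩ ⊆ Q.activeSegs x := fun T hT => hT.1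
  have hmem : ∀ T ∈ Q.activeSegs x, (T ∈ preceding Q x ⟨P, S⟩ ↔ Before x ⟨Q, T⟩ ⟨P, S⟩) :=
    fun T hT => ⟨fun h => h.2, fun h => ⟨hT, h⟩⟩
  have hev := eventually_lt_yVal_sub Q x (P.yVal S x)
  have hpar := P.parity_eq_zero_or_one S
  by_cases hn' : Nested P Q
  -- Here the count is read at a point on the inner side of `S`. It lies in the interior of `P`, so
  -- it is enclosed by `Q` iff `P` is.
  · have hside : ∀ p ∈ P.inside, (p ∈ Q.inside ↔ P.inside ⊂ Q.inside) := by
      intro p hp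
      refine ⟨fun hpQ => (hn'.resolve_left hQ).resolve_left fun hd => ?_, fun h => h.subset hp⟩
      exact Set.disjoint_left.1 hd hp hpQ
    have hcurve : ∀ p ∈ P.inside, p ∉ Q.curve := fun p hp =>
      Set.disjoint_left.1 hn'.disjoint_curve hp
    have hbef : ∀ T ∈ Q.activeSegs x,
        (T ∈ preceding Q x ⟨P, S⟩ ↔ ¬ InnerAbove P Q S T x) := fun T hT => by
      rw [hmem T hT]
      exact (before_iff_innerAbove (hne T) hn' hs hT hg).2
    rcases hpar with hp | hp
    · obtain ⟨δ, h1, h2, -⟩ := (hev.and (P.eventually_of_parity_zero hs hg.1 hp)).exists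
      rw [← hside _ h2]
      refine odd_ncard_iff_mem_inside (hcurve _ h2) (fun T hT => ?_) hsub
      rw [hbef T hT, (h1 T).2.1]
      simp [InnerAbove, hp]
    · obtain ⟨δ, h1, h2, -⟩ := (hev.and (P.eventually_of_parity_one hs hg.1 hp)).exists
      rw [← hside _ h2]
      refine odd_ncard_iff_mem_inside (hcurve _ h2) (fun T hT => ?_) hsub
      rw [hbef T hT, (h1 T).1]
      simp [InnerAbove, hp]
  -- Now `Q` is enclosed by `P`, and the count is read on the outer side of `S`. Such a point is
  -- outside `P`, hence outside `Q`, and the count is even.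
  · have hn := hn.resolve_left hn'
    have hQP : Q.inside ⊂ P.inside := by
      refine (hn.resolve_left hQ.symm).resolve_left fun hd => hn' (Or.inr (Or.inl hd.symm))
    have hnot : ¬ P.inside ⊂ Q.inside := fun h => h.not_subset hQP.subset
    have hout : ∀ p ∈ P.parityRegion 0, p ∉ Q.inside := fun p hp hpQ => by
      have := hQP.subset hpQ
      rw [inside_eq] at this
      exact zero_ne_one (hp.2.symm.trans this.2)
    have hbef : ∀ T ∈ Q.activeSegs x,
        (T ∈ preceding Q x ⟨P, S⟩ ↔ InnerAbove Q P T S x) := fun T hT => by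
      rw [hmem T hT]
      exact (before_iff_innerAbove (hne T).symm hn hT hs hg.symm).1
    rcases hpar with hp | hp
    · obtain ⟨δ, h1, -, h2⟩ := (hev.and (P.eventually_of_parity_zero hs hg.1 hp)).exists
      rw [iff_false_right hnot]
      refine fun hodd => hout _ h2 ((odd_ncard_iff_mem_inside
        (notMem_curve_of_ne hg.2.1 fun T => (h1 T).2.2.1) (fun T hT => ?_) hsub).1 hodd)
      rw [hbef T hT, (h1 T).1]
      have hTp := Q.parity_eq_zero_or_one T
      constructor
      · rintro (⟨-, h⟩ | ⟨-, h⟩)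
        · exact h.le
        · exact h
      · intro h
        rcases hTp with hTp | hTp
        · exact Or.inr ⟨hTp, h⟩
        -- At equal heights, the points just below would be inside `Q` but outside `P`.
        · refine Or.inl ⟨hTp, lt_of_le_of_ne h fun hy => ?_⟩
          obtain ⟨ε, h3, h4⟩ := ((P.eventually_of_parity_zero hs hg.1 hp).and
            (Q.eventually_of_parity_one hT hg.2.1 hTp)).exists
          rw [← hy] at h4
          exact hout _ h3.2 h4.1
    · obtain ⟨δ, h1, -, h2⟩ := (hev.and (P.eventually_of_parity_one hs hg.1 hp)).exists
      rw [iff_false_right hnot]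
      refine fun hodd => hout _ h2 ((odd_ncard_iff_mem_inside
        (notMem_curve_of_ne hg.2.1 fun T => (h1 T).2.2.2) (fun T hT => ?_) hsub).1 hodd)
      rw [hbef T hT, (h1 T).2.1]
      have hTp := Q.parity_eq_zero_or_one T
      constructor
      · rintro (⟨-, h⟩ | ⟨hT0, h⟩)
        · exact h
        · refine lt_of_le_of_ne h fun hy => ?_
          obtain ⟨ε, h3, h4⟩ := ((P.eventually_of_parity_one hs hg.1 hp).and
            (Q.eventually_of_parity_zero hT hg.2.1 hT0)).exists
          rw [← hy] at h4
          exact hout _ h3.2 h4.1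
      · intro h
        rcases hTp with hTp | hTp
        · exact Or.inr ⟨hTp, h.le⟩
        · exact Or.inl ⟨hTp, h⟩

/-- An odd number of segments of another polygon `Q` precede `s` iff `Q` encloses the polygon of
`s`. -/
theorem odd_preceding_iff {s : PolySeg} {Q : SimplePolygon} (hQ : s.1 ≠ Q)
    (hn : Nested s.1 Q ∨ Nested Q s.1) {ξ : ℝ} (hs : s.Active ξ) :
    Odd (preceding Q ξ s).ncard ↔ s.1.inside ⊂ Q.inside := by
  obtain ⟨x, h1, h2, hg⟩ := ((eventually_preceding (Q := Q) hs).and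
    ((eventually_active s ξ).and (eventually_generic s.1 Q ξ))).exists
  rw [← h1, odd_preceding_generic hQ hn (h2.2 hs) hg]

/-- An odd number of segments of the same polygon precede `s` iff `s` has parity `0`. -/
theorem odd_preceding_self_iff {s : PolySeg} {ξ : ℝ} (hs : s.Active ξ) :
    Odd (preceding s.1 ξ s).ncard ↔ s.parity = 0 := by
  obtain ⟨x, h1, h2, hg⟩ := ((eventually_preceding (Q := s.1) hs).and
    ((eventually_active s ξ).and (eventually_generic s.1 s.1 ξ))).exists
  rw [← h1]
  replace hs := h2.2 hs
  obtain ⟨P, S⟩ := s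
  simp only [Active] at hs hg ⊢
  have hmem : ∀ T ∈ P.activeSegs x, (T ∈ preceding P x ⟨P, S⟩ ↔ P.yVal S x < P.yVal T x) := by
    intro T hT
    simp only [preceding, mem_ofPred_eq, hT, true_and, Before, yVal, slopeAt, parity]
    by_cases hTS : T = S
    · subst hTS
      rcases P.parity_eq_zero_or_one T with h | h <;> simp [h]
    · have := P.yVal_ne_of_generic hT hs hg.1 hTS
      simp [this]
  have hev := eventually_lt_yVal_sub P x (P.yVal S x)
  rcases P.parity_eq_zero_or_one S with hp | hp
  · obtain ⟨δ, h3, h4, -⟩ := (hev.and (P.eventually_of_parity_zero hs hg.1 hp)).exists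
    rw [odd_ncard_iff_mem_inside h4.1 (fun T hT => by rw [hmem T hT, (h3 T).2.1])
      fun T hT => hT.1]
    simp only [parity, hp, h4]
  · obtain ⟨δ, h3, -, h4⟩ := (hev.and (P.eventually_of_parity_one hs hg.1 hp)).exists
    rw [odd_ncard_iff_mem_inside h4.1 (fun T hT => by rw [hmem T hT, (h3 T).2.1])
      fun T hT => hT.1]
    simp only [parity, hp, one_ne_zero, mem_inside_iff, h4.2, zero_ne_one, and_false]

end PolySeg
namespace PolySeg

open SimplePolygon

/-! ### The comparisons as linear preorders -/

open Classical in
/-- Segments are compared on the sweep-line by comparing these keys. -/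
noncomputable def beforeKey (ξ : ℝ) (s : PolySeg) : ℝ ×ₗ ℝ ×ₗ ℕ ×ₗ ℝ :=
  -- The signs make the higher and then the steeper upward segment smaller. Among ties of parity `0`
  -- the smaller area comes first, among ties of parity `1` the larger.
  toLex (-s.yVal ξ, toLex (-s.slopeAt ξ, toLex (s.parity,
    if s.parity = 0 then s.1.area else -s.1.area)))

theorem parity_eq_zero_or_one (s : PolySeg) : s.parity = 0 ∨ s.parity = 1 :=
  s.1.parity_eq_zero_or_one s.2

theorem before_iff_key {ξ : ℝ} {s t : PolySeg} :
    Before ξ s t ↔ beforeKey ξ s < beforeKey ξ t := by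
  simp only [Before, beforeKey, Prod.Lex.toLex_lt_toLex, neg_lt_neg_iff, neg_inj, gt_iff_lt]
  refine or_congr Iff.rfl (and_congr_right fun _ => or_congr Iff.rfl (and_congr_right fun _ => ?_))
  rcases s.parity_eq_zero_or_one with h | h <;> rcases t.parity_eq_zero_or_one with h2 | h2 <;>
    simp [h, h2]

/-- Segments are compared in insertion order by comparing these keys. -/
noncomputable def insertionKey (s : PolySeg) : ℝ ×ₗ ℝ ×ₗ ℝ ×ₗ ℕ ×ₗ ℝ :=
  toLex (s.minX, beforeKey s.minX s)

theorem insertionLT_iff_key {s t : PolySeg} :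
    InsertionLT s t ↔ insertionKey s < insertionKey t := by
  simp only [InsertionLT, insertionKey, Prod.Lex.toLex_lt_toLex]
  refine or_congr Iff.rfl (and_congr_right fun h => ?_)
  rw [before_iff_key, ← h]

theorem minX_le_of_key_le {s t : PolySeg} (h : insertionKey s ≤ insertionKey t) :
    s.minX ≤ t.minX := by
  rw [insertionKey, insertionKey, Prod.Lex.toLex_le_toLex] at h
  rcases h with h | h
  · exact h.le
  · exact h.1.le

theorem key_lt_of_minX_lt {s t : PolySeg} (h : s.minX < t.minX) :
    insertionKey s < insertionKey t :=
  insertionLT_iff_key.1 (Or.inl h)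

theorem before_irrefl (ξ : ℝ) (s : PolySeg) : ¬ Before ξ s s := by
  rw [before_iff_key]; exact lt_irrefl _

theorem Before.trans {ξ : ℝ} {s t u : PolySeg} (h1 : Before ξ s t) (h2 : Before ξ t u) :
    Before ξ s u := by
  rw [before_iff_key] at *; exact h1.trans h2

/-- A segment that precedes `s` on the sweep-line at the start of `s` has been inserted. -/
theorem key_lt_of_before {s t : PolySeg} (ht : t.Active s.minX) (h : Before s.minX t s) :
    insertionKey t < insertionKey s := by
  rcases (show t.minX ≤ s.minX from ht.2.1).lt_or_eq with h1 | h1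
  · exact key_lt_of_minX_lt h1
  · exact insertionLT_iff_key.1 (Or.inr ⟨h1, by rwa [h1]⟩)

end PolySeg

/-! ### Sorted lists: merging, initial parts and last elements -/

namespace List

variable {α : Type*}

/-- The comparison `le` used for merging need not be `R`; it only has to decide `R` between members
of the two different lists. -/
theorem pairwise_merge_of {R : α → α → Prop} (htrans : ∀ a b c, R a b → R b c → R a c)
    {le : α → α → Bool} : ∀ {l r : List α}, l.Pairwise R → r.Pairwise R →
      (∀ a ∈ l, ∀ b ∈ r, (le a b = true → R a b) ∧ (le a b = false → R b a)) →
      (l.merge r le).Pairwise R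
  | [], r, _, hr, _ => by simpa using hr
  | l, [], hl, _, _ => by simpa using hl
  | a :: l, b :: r, hl, hr, h => by
    obtain ⟨ha, hl'⟩ := pairwise_cons.1 hl
    obtain ⟨hb, hr'⟩ := pairwise_cons.1 hr
    rw [cons_merge_cons]
    split_ifs with hab
    · have hRab := (h a mem_cons_self b mem_cons_self).1 hab
      refine pairwise_cons.2 ⟨fun c hc => ?_, pairwise_merge_of htrans hl' hr
        fun x hx y hy => h x (mem_cons_of_mem _ hx) y hy⟩
      rcases mem_merge.1 hc with hc | hc
      · exact ha c hc
      · rcases mem_cons.1 hc with rfl | hc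
        · exact hRab
        · exact htrans _ _ _ hRab (hb c hc)
    · have hRba := (h a mem_cons_self b mem_cons_self).2 (by simpa using hab)
      refine pairwise_cons.2 ⟨fun c hc => ?_, pairwise_merge_of htrans hl hr'
        fun x hx y hy => h x hx y (mem_cons_of_mem _ hy)⟩
      rcases mem_merge.1 hc with hc | hc
      · rcases mem_cons.1 hc with rfl | hc
        · exact hRba
        · exact htrans _ _ _ hRba (ha c hc)
      · exact hb c hc

/-- Elements satisfying `p` form an initial part of the list, as `p` passes to `R`-smaller elements.
Thus a search by comparisons sees all the smaller keys. -/
theorem takeWhile_eq_filter_of_pairwise {R : α → α → Prop} {p : α → Bool}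
    (hp : ∀ a b, R a b → p b = true → p a = true) : ∀ {l : List α}, l.Pairwise R →
      l.takeWhile p = l.filter p ∧ l.dropWhile p = l.filter fun a => !p a
  | [], _ => by simp
  | a :: l, h => by
    obtain ⟨ha, hl⟩ := pairwise_cons.1 h
    have ih := takeWhile_eq_filter_of_pairwise hp hl
    by_cases hpa : p a = true
    · simp [hpa, ih]
    · have hall : ∀ b ∈ l, p b = false := fun b hb => by
        by_contra hpb
        exact hpa (hp a b (ha b hb) (by simpa using hpb))
      have h1 : l.filter p = [] := filter_eq_nil_iff.2 fun b hb => by simp [hall b hb]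
      have h2 : (l.filter fun a => !p a) = l := filter_eq_self.2 fun b hb => by simp [hall b hb]
      simp [hpa, h1, h2]

theorem eq_or_of_getLast?_eq_some {R : α → α → Prop} {l : List α} (h : l.Pairwise R) {a : α}
    (ha : l.getLast? = some a) {b : α} (hb : b ∈ l) : b = a ∨ R b a := by
  obtain ⟨l', rfl⟩ := getLast?_eq_some_iff.1 ha
  rcases mem_append.1 hb with hb | hb
  · exact Or.inr ((pairwise_append.1 h).2.2 b hb a (by simp))
  · exact Or.inl (by simpa using hb)

end List

namespace NestingForest

open SimplePolygon PolySeg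

/-! ### The events of the sweep -/

theorem mem_maxSegs {P : SimplePolygon} {S : P.Seg} : S ∈ P.maxSegs ↔ P.MaxOutstretched S := by
  obtain ⟨i, k⟩ := S
  simp [maxSegs, List.pair_mem_product]

theorem mem_allSegs {Ps : List SimplePolygon} {s : PolySeg} :
    s ∈ allSegs Ps ↔ s.1 ∈ Ps ∧ s.1.MaxOutstretched s.2 := by
  obtain ⟨P, S⟩ := s
  simp only [allSegs, List.mem_flatMap, List.mem_map, mem_maxSegs]
  constructor
  · rintro ⟨Q, hQ, T, hT, h⟩
    cases h
    exact ⟨hQ, hT⟩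
  · rintro ⟨hP, hS⟩
    exact ⟨P, hP, S, hS, rfl⟩

theorem nodup_allSegs {Ps : List SimplePolygon} (h : Ps.Nodup) : (allSegs Ps).Nodup := by
  refine List.nodup_flatMap.2 ⟨fun P _ => ?_, ?_⟩
  · refine List.Nodup.map sigma_mk_injective ?_
    exact ((List.nodup_finRange _).product (List.nodup_finRange _)).filter _
  · refine h.imp fun {P Q} hPQ => ?_
    rw [Function.onFun, List.disjoint_left]
    intro s hs ht
    obtain ⟨S, -, rfl⟩ := List.mem_map.1 hs
    obtain ⟨T, -, h⟩ := List.mem_map.1 ht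
    exact hPQ (congrArg Sigma.fst h).symm

theorem perm_insertionList (Ps : List SimplePolygon) : (insertionList Ps).Perm (allSegs Ps) :=
  @List.perm_insertionSort _ _ (_) _

theorem perm_removalList (Ps : List SimplePolygon) : (removalList Ps).Perm (allSegs Ps) :=
  List.perm_insertionSort _ _

theorem pairwise_insertionList (Ps : List SimplePolygon) :
    (insertionList Ps).Pairwise fun s t => insertionKey s ≤ insertionKey t := by
  have h : ∀ s t : PolySeg, ¬ InsertionLT t s ↔ insertionKey s ≤ insertionKey t := fun s t => by
    rw [insertionLT_iff_key, not_lt]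
  have htot : Std.Total fun s t : PolySeg => ¬ InsertionLT t s :=
    ⟨fun s t => by rw [h, h]; exact le_total _ _⟩
  have htr : IsTrans PolySeg fun s t : PolySeg => ¬ InsertionLT t s :=
    ⟨fun s t u => by rw [h, h, h]; exact le_trans⟩
  exact List.Pairwise.imp (fun {s t} hst => (h s t).1 hst)
    (@List.pairwise_insertionSort _ _ (_) htot htr (allSegs Ps))

theorem pairwise_removalList (Ps : List SimplePolygon) :
    (removalList Ps).Pairwise fun s t => s.maxX ≤ t.maxX := by
  have htot : Std.Total fun s t : PolySeg => s.maxX ≤ t.maxX := ⟨fun s t => le_total _ _⟩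
  have htr : IsTrans PolySeg fun s t : PolySeg => s.maxX ≤ t.maxX := ⟨fun s t u => le_trans⟩
  classical
  exact List.pairwise_insertionSort (fun s t : PolySeg => s.maxX ≤ t.maxX) (allSegs Ps)

/-- The first event may take place before the second. -/
def Event.Ordered : Event → Event → Prop
  | .insert s, .insert t => insertionKey s ≤ insertionKey t
  | .remove s, .insert t => s.maxX ≤ t.minX
  -- Strict, because removals come first at equal positions.
  | .insert s, .remove t => s.minX < t.maxX
  | .remove s, .remove t => s.maxX ≤ t.maxX

theorem Event.Ordered.trans : ∀ a b c : Event, a.Ordered b → b.Ordered c → a.Ordered c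
  | .insert _, .insert _, .insert _, h1, h2 => le_trans (α := _ ×ₗ _) h1 h2
  | .insert _, .insert _, .remove _, h1, h2 => (minX_le_of_key_le h1).trans_lt h2
  | .insert _, .remove _, .insert _, h1, h2 => (key_lt_of_minX_lt (lt_of_lt_of_le h1 h2)).le
  | .insert _, .remove _, .remove _, h1, h2 => lt_of_lt_of_le (α := ℝ) h1 h2
  | .remove _, .insert _, .insert _, h1, h2 => le_trans (α := ℝ) h1 (minX_le_of_key_le h2)
  | .remove _, .insert _, .remove _, h1, h2 => (lt_of_le_of_lt (α := ℝ) h1 h2).le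
  | .remove _, .remove _, .insert _, h1, h2 => le_trans (α := ℝ) h1 h2
  | .remove _, .remove _, .remove _, h1, h2 => le_trans (α := ℝ) h1 h2

theorem pairwise_events (Ps : List SimplePolygon) : (events Ps).Pairwise Event.Ordered := by
  classical
  refine List.pairwise_merge_of Event.Ordered.trans ?_ ?_ ?_
  · exact List.pairwise_map.2 (pairwise_removalList Ps)
  · exact List.pairwise_map.2 (pairwise_insertionList Ps)
  · intro a ha b hb
    obtain ⟨s, -, rfl⟩ := List.mem_map.1 ha
    obtain ⟨t, -, rfl⟩ := List.mem_map.1 hb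
    simp only [Event.pos, Event.Ordered]
    exact ⟨of_decide_eq_true, fun h => not_le.1 (of_decide_eq_false h)⟩

theorem perm_events (Ps : List SimplePolygon) : (events Ps).Perm
    ((removalList Ps).map Event.remove ++ (insertionList Ps).map Event.insert) :=
  List.merge_perm_append _

theorem insert_mem_events {Ps : List SimplePolygon} {s : PolySeg} :
    Event.insert s ∈ events Ps ↔ s ∈ allSegs Ps := by
  rw [(perm_events Ps).mem_iff]
  simp [(perm_insertionList Ps).mem_iff]

theorem remove_mem_events {Ps : List SimplePolygon} {s : PolySeg} :
    Event.remove s ∈ events Ps ↔ s ∈ allSegs Ps := by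
  rw [(perm_events Ps).mem_iff]
  simp [(perm_removalList Ps).mem_iff]

theorem nodup_events {Ps : List SimplePolygon} (h : Ps.Nodup) : (events Ps).Nodup := by
  rw [(perm_events Ps).nodup_iff]
  refine List.Nodup.append ?_ ?_ ?_
  · exact ((perm_removalList Ps).nodup_iff.2 (nodup_allSegs h)).map fun s t h => by cases h; rfl
  · exact ((perm_insertionList Ps).nodup_iff.2 (nodup_allSegs h)).map fun s t h => by cases h; rfl
  · rw [List.disjoint_left]
    intro e h1 h2
    obtain ⟨s, -, rfl⟩ := List.mem_map.1 h1
    obtain ⟨t, -, h⟩ := List.mem_map.1 h2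
    cases h

theorem isFirst_iff {Ps : List SimplePolygon} {s : PolySeg} : IsFirst Ps s ↔
    ∀ t ∈ allSegs Ps, t.1 = s.1 → insertionKey s ≤ insertionKey t := by
  unfold IsFirst
  refine forall_congr' fun t => ?_
  rw [(perm_insertionList Ps).mem_iff, insertionLT_iff_key, not_lt]

theorem exists_isFirst {Ps : List SimplePolygon} {P : SimplePolygon} (hP : P ∈ Ps) :
    ∃ s ∈ allSegs Ps, s.1 = P ∧ IsFirst Ps s := by
  classical
  obtain ⟨e, he⟩ := P.exists_not_vertical
  obtain ⟨S, hS, -⟩ := P.exists_maxOutstretched he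
  obtain ⟨s, hs, hmin⟩ := Finset.exists_min_image
    ((allSegs Ps).toFinset.filter fun s => s.1 = P) insertionKey
    ⟨⟨P, S⟩, by simp [mem_allSegs, hP, hS]⟩
  simp only [Finset.mem_filter, List.mem_toFinset] at hs hmin
  exact ⟨s, hs.1, hs.2, isFirst_iff.2 fun t ht hts => hmin t ⟨ht, hts.trans hs.2⟩⟩

/-! ### The invariant of the sweep -/

/-- The value `v` correctly describes the parent of `P`. -/
def IsParent (Ps : List SimplePolygon) (P : SimplePolygon) (v : Option (Option SimplePolygon)) :
    Prop :=
  (v = some none ∧ ∀ Q ∈ Ps, ¬ P.inside ⊂ Q.inside) ∨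
    (∃ Q ∈ Ps, v = some (some Q) ∧ P.inside ⊂ Q.inside ∧
      ¬ ∃ R ∈ Ps, P.inside ⊂ R.inside ∧ R.inside ⊂ Q.inside)

theorem IsParent.congr {Ps : List SimplePolygon} {P P' : SimplePolygon}
    {v : Option (Option SimplePolygon)}
    (h : ∀ Q ∈ Ps, (P.inside ⊂ Q.inside ↔ P'.inside ⊂ Q.inside)) (hv : IsParent Ps P' v) :
    IsParent Ps P v := by
  rcases hv with ⟨rfl, h1⟩ | ⟨Q, hQ, rfl, h1, h2⟩
  · exact Or.inl ⟨rfl, fun Q hQ => by rw [h Q hQ]; exact h1 Q hQ⟩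
  · refine Or.inr ⟨Q, hQ, rfl, (h Q hQ).2 h1, ?_⟩
    rintro ⟨R, hR, h3, h4⟩
    exact h2 ⟨R, hR, (h R hR).1 h3, h4⟩

/-- The invariant of the sweep after the events in `pre`. -/
structure Invariant (Ps : List SimplePolygon) (pre : List Event) (st : State) : Prop where
  mem_tree : ∀ t, t ∈ st.tree ↔ Event.insert t ∈ pre ∧ Event.remove t ∉ pre
  -- The order is required at every common abscissa, not only at the current one, so that it
  -- survives the movement of the sweep-line.
  sorted : st.tree.Pairwise fun a b => ∀ ξ, a.Active ξ → b.Active ξ → Before ξ a b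
  correct : ∀ s, Event.insert s ∈ pre → IsFirst Ps s → IsParent Ps s.1 (st.parent s.1)

theorem nested_or_nested {Ps : List SimplePolygon}
    (hdistinct : (Ps.map SimplePolygon.inside).Nodup) (hoverlap : OverlapFree Ps)
    {P Q : SimplePolygon} (hP : P ∈ Ps) (hQ : Q ∈ Ps) : Nested P Q ∨ Nested Q P := by
  by_cases hPQ : P = Q
  · exact Or.inl (Or.inl hPQ)
  have hne : P.inside ≠ Q.inside := fun h => hPQ (List.inj_on_of_nodup_map hdistinct hP hQ h)
  have h := hoverlap _ ⟨P, hP, rfl⟩ _ ⟨Q, hQ, rfl⟩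
  unfold Overlap at h
  by_cases h1 : P.inside ⊆ Q.inside
  · exact Or.inl (Or.inr (Or.inr (lt_of_le_of_ne h1 hne)))
  by_cases h2 : Q.inside ⊆ P.inside
  · exact Or.inr (Or.inr (Or.inr (lt_of_le_of_ne h2 hne.symm)))
  refine Or.inl (Or.inr (Or.inl (Set.disjoint_iff_inter_eq_empty.2 ?_)))
  by_contra h3
  exact h ⟨fun h4 => h1 (Set.inter_eq_left.1 h4), fun h4 => h2 (Set.inter_eq_right.1 h4), h3⟩

/-! ### One event preserves the invariant -/

section Step

variable {Ps : List SimplePolygon} {pre post : List Event} {s : PolySeg}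

theorem active_of_mem_tree (hev : events Ps = pre ++ Event.insert s :: post) {t : PolySeg}
    (ht : Event.insert t ∈ pre) (ht' : Event.remove t ∉ pre) : t.Active s.minX := by
  have hpw := pairwise_events Ps
  rw [hev, List.pairwise_append, List.pairwise_cons] at hpw
  have hts : t ∈ allSegs Ps := insert_mem_events.1 (by rw [hev]; simp [ht])
  have hrem : Event.remove t ∈ post := by
    have := remove_mem_events.2 hts
    rw [hev] at this
    simpa [ht'] using this
  exact ⟨(mem_allSegs.1 hts).2, minX_le_of_key_le (hpw.2.2 _ ht _ List.mem_cons_self),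
    hpw.2.1.1 _ hrem⟩

theorem insert_mem_pre (hev : events Ps = pre ++ Event.insert s :: post) {t : PolySeg}
    (ht : t ∈ allSegs Ps) (hts : insertionKey t < insertionKey s) : Event.insert t ∈ pre := by
  have hpw := pairwise_events Ps
  rw [hev, List.pairwise_append, List.pairwise_cons] at hpw
  have hmem := insert_mem_events.2 ht
  rw [hev, List.mem_append, List.mem_cons] at hmem
  rcases hmem with h | h | h
  · exact h
  · cases h
    exact absurd hts (lt_irrefl _)
  · exact absurd hts (not_lt.2 (hpw.2.1.1 _ h))

/-- Some segments that start at the current abscissa may still be missing from the tree. Those that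
precede `s` are not among them, as they come earlier in insertion order, so counts over the tree are
counts over the whole input. -/
theorem mem_tree_before_iff (hev : events Ps = pre ++ Event.insert s :: post) {st : State}
    (hinv : Invariant Ps pre st) (t : PolySeg) : (t ∈ st.tree ∧ Before s.minX t s) ↔
      (t.1 ∈ Ps ∧ t.Active s.minX ∧ Before s.minX t s) := by
  rw [hinv.mem_tree]
  constructor
  · rintro ⟨⟨h1, h2⟩, h3⟩
    exact ⟨(mem_allSegs.1 (insert_mem_events.1 (by rw [hev]; simp [h1]))).1,
      active_of_mem_tree hev h1 h2, h3⟩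
  · rintro ⟨h1, h2, h3⟩
    refine ⟨⟨insert_mem_pre hev (mem_allSegs.2 ⟨h1, h2.1⟩) (key_lt_of_before h2 h3),
      fun hrem => ?_⟩, h3⟩
    have hpw := pairwise_events Ps
    rw [hev, List.pairwise_append] at hpw
    have h4 : t.maxX ≤ s.minX := hpw.2.2 _ hrem _ List.mem_cons_self
    exact absurd h2.2.2 (not_lt.2 h4)

open Classical in
theorem tree_split (hev : events Ps = pre ++ Event.insert s :: post) {st : State}
    (hinv : Invariant Ps pre st) :
    (st.tree.takeWhile fun t => Before s.minX t s) =
        st.tree.filter (fun t => Before s.minX t s) ∧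
      (st.tree.dropWhile fun t => Before s.minX t s) =
        st.tree.filter (fun t => ¬ Before s.minX t s) := by
  have hsorted : st.tree.Pairwise (Before s.minX) := by
    -- Everything in the tree is active at the current position, so the stored order can be read off
    -- there.
    refine hinv.sorted.imp_of_mem fun {a b} ha hb h => h _ ?_ ?_
    · exact active_of_mem_tree hev ((hinv.mem_tree a).1 ha).1 ((hinv.mem_tree a).1 ha).2
    · exact active_of_mem_tree hev ((hinv.mem_tree b).1 hb).1 ((hinv.mem_tree b).1 hb).2
  have := List.takeWhile_eq_filter_of_pairwise (p := fun t => decide (Before s.minX t s))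
    (fun a b hab hb => by
      rw [decide_eq_true_iff] at hb ⊢
      exact hab.trans hb) hsorted
  simpa using this

theorem active_self (hs : s ∈ allSegs Ps) : s.Active s.minX :=
  ⟨(mem_allSegs.1 hs).2, le_rfl, minX_lt_maxX _ (mem_allSegs.1 hs).2⟩

theorem mem_of_events (hev : events Ps = pre ++ Event.insert s :: post) : s ∈ allSegs Ps :=
  insert_mem_events.1 (by rw [hev]; simp)

theorem sorted_treeInsert (hdistinct : (Ps.map SimplePolygon.inside).Nodup)
    (hoverlap : OverlapFree Ps) (hev : events Ps = pre ++ Event.insert s :: post)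
    {st : State} (hinv : Invariant Ps pre st) :
    (treeInsert s.minX s st.tree).Pairwise
      fun a b => ∀ ξ, a.Active ξ → b.Active ξ → Before ξ a b := by
  classical
  have hnd := nodup_events (hdistinct.of_map _)
  have hs := mem_of_events hev
  have hact := active_self hs
  have hnot : s ∉ st.tree := fun h => by
    rw [hev] at hnd
    exact List.disjoint_left.1 (List.nodup_append'.1 hnd).2.2 ((hinv.mem_tree s).1 h).1
      List.mem_cons_self
  have hprop : ∀ t ∈ st.tree, t ≠ s ∧ t.1 ∈ Ps ∧ t.Active s.minX := fun t ht => by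
    obtain ⟨h1, h2⟩ := (hinv.mem_tree t).1 ht
    exact ⟨fun h => hnot (h ▸ ht), (mem_allSegs.1 (insert_mem_events.1
      (by rw [hev]; simp [h1]))).1, active_of_mem_tree hev h1 h2⟩
  have hn : ∀ {a b : PolySeg}, a.1 ∈ Ps → b.1 ∈ Ps → Nested a.1 b.1 ∨ Nested b.1 a.1 :=
    fun ha hb => nested_or_nested hdistinct hoverlap ha hb
  have hsP := (mem_allSegs.1 hs).1
  have hsplit := tree_split hev hinv
  rw [treeInsert, List.pairwise_append, List.pairwise_cons, hsplit.1, hsplit.2]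
  refine ⟨hinv.sorted.filter _, ⟨fun b hb => ?_, hinv.sorted.filter _⟩, fun a ha b hb => ?_⟩
  · simp only [List.mem_filter, decide_eq_true_iff] at hb
    obtain ⟨h1, h2, h3⟩ := hprop b hb.1
    have hbef := (before_or_before h1 (hn h2 hsP) h3 hact).resolve_left hb.2
    intro ξ hsξ hbξ
    -- A comparison made at the current position holds wherever both segments are present.
    exact (before_persistent h1.symm (hn hsP h2) hact h3 hsξ hbξ).1 hbef
  · simp only [List.mem_filter, decide_eq_true_iff] at ha
    obtain ⟨h1, h2, h3⟩ := hprop a ha.1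
    rcases List.mem_cons.1 hb with rfl | hb
    · intro ξ haξ hsξ
      exact (before_persistent h1 (hn h2 hsP) h3 hact haξ hsξ).1 ha.2
    · simp only [List.mem_filter, decide_eq_true_iff] at hb
      obtain ⟨h4, h5, h6⟩ := hprop b hb.1
      have hsb := (before_or_before h4 (hn h5 hsP) h6 hact).resolve_left hb.2
      have hab : a ≠ b := fun h => hb.2 (h ▸ ha.2)
      intro ξ haξ hbξ
      exact (before_persistent hab (hn h2 h5) h3 h6 haξ hbξ).1 (ha.2.trans hsb)

theorem mem_treeInsert {ξ : ℝ} {tree : List PolySeg} {t : PolySeg} :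
    t ∈ treeInsert ξ s tree ↔ t ∈ tree ∨ t = s := by
  classical
  have h : ∀ t, t ∈ tree ↔ t ∈ (tree.takeWhile fun t => Before ξ t s) ∨
      t ∈ tree.dropWhile fun t => Before ξ t s := fun t => by
    rw [← List.mem_append, List.takeWhile_append_dropWhile]
  rw [treeInsert, h t, List.mem_append, List.mem_cons]
  tauto

open Classical in
-- The search for smaller keys stops at `s`, which does not precede itself, so it finds the same
-- keys as before the insertion.
theorem treePred_treeInsert (hev : events Ps = pre ++ Event.insert s :: post) {st : State}
    (hinv : Invariant Ps pre st) : treePred s.minX s (treeInsert s.minX s st.tree) =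
      (st.tree.filter fun t => Before s.minX t s).getLast? := by
  rw [← (tree_split hev hinv).1, treePred, treeInsert, List.takeWhile_append]
  split_ifs <;> simp [before_irrefl, List.takeWhile_takeWhile]

/-- A polygon encloses the polygon of the first segment `s` iff it encloses the polygon of the
predecessor of `s` or is that polygon and has its interior below. -/
theorem ssubset_iff_of_pred (hdistinct : (Ps.map SimplePolygon.inside).Nodup)
    (hoverlap : OverlapFree Ps) (hs : s ∈ allSegs Ps) (hfirst : IsFirst Ps s) {k : PolySeg}
    (hkP : k.1 ∈ Ps) (hk : k.Active s.minX) (hks : Before s.minX k s)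
    (hmax : ∀ t : PolySeg, t.1 ∈ Ps → t.Active s.minX → Before s.minX t s →
      t = k ∨ Before s.minX t k) :
    (s.1.inside ⊂ k.1.inside ↔ k.parity = 1) ∧
      ∀ Q ∈ Ps, Q ≠ k.1 → (s.1.inside ⊂ Q.inside ↔ k.1.inside ⊂ Q.inside) := by
  have hn : ∀ {P Q : SimplePolygon}, P ∈ Ps → Q ∈ Ps → Nested P Q ∨ Nested Q P :=
    fun ha hb => nested_or_nested hdistinct hoverlap ha hb
  have hsP := (mem_allSegs.1 hs).1
  have hact := active_self hs
  -- No segment of its own polygon precedes the first segment.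
  have hown : ∀ t : PolySeg, t.Active s.minX → Before s.minX t s → t.1 ≠ s.1 := by
    intro t ht hts hP
    have := isFirst_iff.1 hfirst t (mem_allSegs.2 ⟨hP ▸ hsP, ht.1⟩) hP
    exact absurd (key_lt_of_before ht hts) (not_lt.2 this)
  have hks1 : k.1 ≠ s.1 := hown k hk hks
  constructor
  · rw [← odd_preceding_iff hks1.symm (hn hsP hkP) hact]
    -- Within the polygon of `k`, exactly `k` is added to the segments preceding `k`, so the parity
    -- of the count flips.
    have heq : preceding k.1 s.minX s = insert k.2 (preceding k.1 s.minX k) := by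
      ext T
      constructor
      · rintro ⟨hT, hTs⟩
        rcases hmax ⟨k.1, T⟩ hkP hT hTs with h | h
        · left
          obtain ⟨K, k2⟩ := k
          cases h
          rfl
        · exact Or.inr ⟨hT, h⟩
      · rintro (rfl | ⟨hT, hTk⟩)
        · exact ⟨hk, hks⟩
        · exact ⟨hT, hTk.trans hks⟩
    have hnot : k.2 ∉ preceding k.1 s.minX k := fun h => before_irrefl _ _ h.2
    rw [heq, Set.ncard_insert_of_notMem hnot (Set.toFinite _), Nat.odd_add_one,
      odd_preceding_self_iff hk]
    rcases k.parity_eq_zero_or_one with h | h <;> simp [h]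
  · intro Q hQ hQk
    have heq : preceding Q s.minX s = preceding Q s.minX k := by
      ext T
      constructor
      · rintro ⟨hT, hTs⟩
        rcases hmax ⟨Q, T⟩ hQ hT hTs with h | h
        · exact absurd (congrArg Sigma.fst h) hQk
        · exact ⟨hT, h⟩
      · rintro ⟨hT, hTk⟩
        exact ⟨hT, hTk.trans hks⟩
    by_cases hQs : Q = s.1
    · subst hQs
      -- No polygon encloses itself; and as no segment of this polygon precedes `s`, none precedes
      -- `k`, so it does not enclose the polygon of `k` either.
      have hempty : preceding s.1 s.minX s = ∅ :=
        Set.eq_empty_iff_forall_notMem.2 fun T hT => hown ⟨s.1, T⟩ hT.1 hT.2 rfl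
      rw [← odd_preceding_iff hks1 (hn hkP hsP) hk, ← heq, hempty]
      simp
    · rw [← odd_preceding_iff (Ne.symm hQs) (hn hsP hQ) hact,
        ← odd_preceding_iff (Ne.symm hQk) (hn hkP hQ) hk, heq]

/-- The value assigned to the polygon of its first segment is correct. -/
theorem isParent_step (hdistinct : (Ps.map SimplePolygon.inside).Nodup)
    (hoverlap : OverlapFree Ps) (hev : events Ps = pre ++ Event.insert s :: post)
    {st : State} (hinv : Invariant Ps pre st) (hfirst : IsFirst Ps s) :
    IsParent Ps s.1 ((step Ps st (.insert s)).parent s.1) := by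
  classical
  have hs := mem_of_events hev
  have hsP := (mem_allSegs.1 hs).1
  have hact := active_self hs
  have hn : ∀ {P Q : SimplePolygon}, P ∈ Ps → Q ∈ Ps → Nested P Q ∨ Nested Q P :=
    fun ha hb => nested_or_nested hdistinct hoverlap ha hb
  have hmem : ∀ t, t ∈ st.tree.filter (fun t => Before s.minX t s) ↔
      (t.1 ∈ Ps ∧ t.Active s.minX ∧ Before s.minX t s) := fun t => by
    rw [List.mem_filter, decide_eq_true_iff]
    exact mem_tree_before_iff hev hinv t
  have hpred := treePred_treeInsert hev hinv
  simp only [step, if_pos hfirst]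
  rcases hk : (st.tree.filter fun t => Before s.minX t s).getLast? with _ | k
  · rw [hpred, hk]
    simp only [Function.update_self]
    rw [List.getLast?_eq_none_iff] at hk
    refine Or.inl ⟨rfl, fun Q hQ => ?_⟩
    by_cases hQs : s.1 = Q
    · rw [hQs]; exact ssubset_irrefl _
    rw [← odd_preceding_iff hQs (hn hsP hQ) hact]
    have hempty : preceding Q s.minX s = ∅ := by
      refine Set.eq_empty_iff_forall_notMem.2 fun T hT => ?_
      have := (hmem ⟨Q, T⟩).2 ⟨hQ, hT.1, hT.2⟩
      rw [hk] at this
      exact List.not_mem_nil this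
    rw [hempty]
    simp
  · rw [hpred, hk]
    have hkmem := List.mem_of_getLast? hk
    obtain ⟨hkP, hkact, hks⟩ := (hmem k).1 hkmem
    have hsortf : (st.tree.filter fun t => Before s.minX t s).Pairwise (Before s.minX) := by
      refine (hinv.sorted.filter _).imp_of_mem fun {a b} ha hb h => h _ ?_ ?_
      · exact ((hmem a).1 ha).2.1
      · exact ((hmem b).1 hb).2.1
    obtain ⟨h1, h2⟩ := ssubset_iff_of_pred hdistinct hoverlap hs hfirst hkP hkact hks
      fun t htP ht hts => List.eq_or_of_getLast?_eq_some hsortf hk ((hmem t).2 ⟨htP, ht, hts⟩)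
    by_cases hp : k.parity = 1
    · simp only [if_pos hp, Function.update_self]
      refine Or.inr ⟨k.1, hkP, rfl, h1.2 hp, ?_⟩
      rintro ⟨R, hR, h3, h4⟩
      have hRk : R ≠ k.1 := fun h => by rw [h] at h4; exact ssubset_irrefl _ h4
      -- A polygon strictly between would also enclose the polygon of `k`, although it is enclosed
      -- by it.
      exact ssubset_irrefl _ (h4.trans ((h2 R hR hRk).1 h3))
    · simp only [if_neg hp, Function.update_self]
      -- With parity `0`, the two polygons are enclosed by the same polygons and so have the same
      -- parent. It is already known, because the first segment of the polygon of `k` was inserted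
      -- before `s`.
      obtain ⟨f, hf, hfk, hff⟩ := exists_isFirst hkP
      have hfk' := isFirst_iff.1 hff k (mem_allSegs.2 ⟨hkP, hkact.1⟩) hfk.symm
      have hfpre := insert_mem_pre hev hf (hfk'.trans_lt (key_lt_of_before hkact hks))
      have hcor := hinv.correct f hfpre hff
      rw [hfk] at hcor
      refine hcor.congr fun Q hQ => ?_
      by_cases hQk : Q = k.1
      · subst hQk
        rw [h1]
        exact iff_of_false hp (ssubset_irrefl _)
      · exact h2 Q hQ hQk

theorem step_insert_tree (st : State) :
    (step Ps st (.insert s)).tree = treeInsert s.minX s st.tree := by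
  simp only [step]
  split_ifs
  · split
    · rfl
    · split_ifs <;> rfl
  · rfl

theorem step_insert_parent_of_ne (st : State) {P : SimplePolygon} (hP : P ≠ s.1) :
    (step Ps st (.insert s)).parent P = st.parent P := by
  simp only [step]
  split_ifs
  · split
    · simp [hP]
    · split_ifs <;> simp [hP]
  · rfl

theorem step_insert_parent_of_not_first (st : State) (h : ¬ IsFirst Ps s) :
    (step Ps st (.insert s)).parent = st.parent := by
  simp only [step, if_neg h]

theorem Invariant.insert (hdistinct : (Ps.map SimplePolygon.inside).Nodup)
    (hoverlap : OverlapFree Ps) (hev : events Ps = pre ++ Event.insert s :: post)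
    {st : State} (hinv : Invariant Ps pre st) :
    Invariant Ps (pre ++ [Event.insert s]) (step Ps st (.insert s)) where
  mem_tree t := by
    rw [step_insert_tree, mem_treeInsert, hinv.mem_tree]
    have hpw := pairwise_events Ps
    rw [hev, List.pairwise_append] at hpw
    have hs : Event.remove s ∉ pre := fun h => by
      have h1 : s.maxX ≤ s.minX := hpw.2.2 _ h _ List.mem_cons_self
      exact absurd (minX_lt_maxX _ (mem_allSegs.1 (mem_of_events hev)).2) (not_lt.2 h1)
    simp only [List.mem_append, List.mem_singleton, Event.insert.injEq, reduceCtorEq, or_false]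
    constructor
    · rintro (⟨h1, h2⟩ | rfl)
      · exact ⟨Or.inl h1, h2⟩
      · exact ⟨Or.inr rfl, hs⟩
    · rintro ⟨h1 | h1, h2⟩
      · exact Or.inl ⟨h1, h2⟩
      · exact Or.inr h1
  sorted := by
    rw [step_insert_tree]
    exact sorted_treeInsert hdistinct hoverlap hev hinv
  correct t ht hft := by
    by_cases hts : t.1 = s.1
    -- If `s` is first, the value just assigned is correct for its polygon whether or not `t = s`;
    -- so first segments need not be shown unique.
    · by_cases hfs : IsFirst Ps s
      · rw [hts]
        exact isParent_step hdistinct hoverlap hev hinv hfs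
      · rw [step_insert_parent_of_not_first st hfs]
        rcases List.mem_append.1 ht with h | h
        · exact hinv.correct t h hft
        · simp only [List.mem_singleton, Event.insert.injEq] at h
          exact absurd (h ▸ hft) hfs
    · rw [step_insert_parent_of_ne st hts]
      rcases List.mem_append.1 ht with h | h
      · exact hinv.correct t h hft
      · simp only [List.mem_singleton, Event.insert.injEq] at h
        exact absurd (congrArg Sigma.fst h) hts

theorem Invariant.remove {st : State} (hinv : Invariant Ps pre st) :
    Invariant Ps (pre ++ [Event.remove s]) (step Ps st (.remove s)) where
  mem_tree t := by
    simp only [step, treeDelete, List.mem_filter, hinv.mem_tree, List.mem_append,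
      List.mem_singleton, Event.remove.injEq, reduceCtorEq, or_false, decide_eq_true_iff, ne_eq]
    tauto
  sorted := hinv.sorted.filter _
  correct t ht hft := by
    refine hinv.correct t ?_ hft
    simpa using ht

end Step

theorem invariant_foldl {Ps : List SimplePolygon}
    (hdistinct : (Ps.map SimplePolygon.inside).Nodup) (hoverlap : OverlapFree Ps) :
    ∀ (post pre : List Event) (st : State), events Ps = pre ++ post → Invariant Ps pre st →
      Invariant Ps (pre ++ post) (post.foldl (step Ps) st)
  | [], pre, st, _, hinv => by simpa using hinv
  | e :: post, pre, st, hev, hinv => by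
    have hev' : events Ps = (pre ++ [e]) ++ post := by simpa using hev
    have hinv' : Invariant Ps (pre ++ [e]) (step Ps st e) := by
      cases e with
      | remove s => exact hinv.remove
      | insert s => exact hinv.insert hdistinct hoverlap hev
    have := invariant_foldl hdistinct hoverlap post (pre ++ [e]) _ hev' hinv'
    simpa using this

theorem isParent_parent {Ps : List SimplePolygon}
    (hdistinct : (Ps.map SimplePolygon.inside).Nodup) (hoverlap : OverlapFree Ps)
    {P : SimplePolygon} (hP : P ∈ Ps) : IsParent Ps P (parent Ps P) := by
  have hstart : Invariant Ps [] ⟨[], fun _ => none⟩ := ⟨by simp, by simp, by simp⟩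
  have hinv := invariant_foldl hdistinct hoverlap (events Ps) [] _ rfl hstart
  obtain ⟨s, hs, rfl, hfirst⟩ := exists_isFirst hP
  exact hinv.correct s (by simpa using insert_mem_events.2 hs) hfirst

/-! ### The returned forest -/

/-- Two polygons enclosing `P` have intersecting interiors, hence are nested, and minimality forbids
strict nesting. This uniqueness lets the computed parent be compared with the covering relation. -/
theorem eq_of_parent {Ps : List SimplePolygon} (hdistinct : (Ps.map SimplePolygon.inside).Nodup)
    (hoverlap : OverlapFree Ps) {P Q R : SimplePolygon} (hQ : Q ∈ Ps) (hR : R ∈ Ps)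
    (hPQ : P.inside ⊂ Q.inside) (hPR : P.inside ⊂ R.inside)
    (hQmin : ¬ ∃ T ∈ Ps, P.inside ⊂ T.inside ∧ T.inside ⊂ Q.inside)
    (hRmin : ¬ ∃ T ∈ Ps, P.inside ⊂ T.inside ∧ T.inside ⊂ R.inside) : Q = R := by
  have hdisj : ¬ Disjoint Q.inside R.inside := fun h => by
    obtain ⟨p, hp⟩ := P.inside_nonempty
    exact Set.disjoint_left.1 h (hPQ.subset hp) (hPR.subset hp)
  rcases nested_or_nested hdistinct hoverlap hQ hR with (h | h | h) | (h | h | h)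
  · exact h
  · exact absurd h hdisj
  · exact absurd ⟨Q, hQ, hPQ, h⟩ hRmin
  · exact h.symm
  · exact absurd h.symm hdisj
  · exact absurd ⟨R, hR, hPR, h⟩ hQmin

theorem toInside_lt_iff {Ps : List SimplePolygon} {P Q : {P : SimplePolygon // P ∈ Ps}} :
    toInside Ps P < toInside Ps Q ↔ P.1.inside ⊂ Q.1.inside :=
  Iff.rfl

theorem toInside_covBy_iff {Ps : List SimplePolygon} {P Q : {P : SimplePolygon // P ∈ Ps}} :
    toInside Ps P ⋖ toInside Ps Q ↔ P.1.inside ⊂ Q.1.inside ∧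
      ¬ ∃ R ∈ Ps, P.1.inside ⊂ R.inside ∧ R.inside ⊂ Q.1.inside := by
  unfold CovBy
  rw [toInside_lt_iff]
  refine and_congr_right fun _ => ?_
  constructor
  · rintro h ⟨R, hR, h1, h2⟩
    exact h (c := toInside Ps ⟨R, hR⟩) h1 h2
  · rintro h ⟨_, R, hR, rfl⟩ h1 h2
    exact h ⟨R, hR, h1, h2⟩

theorem parent_eq_some_some_iff {Ps : List SimplePolygon}
    (hdistinct : (Ps.map SimplePolygon.inside).Nodup) (hoverlap : OverlapFree Ps)
    {P Q : {P : SimplePolygon // P ∈ Ps}} :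
    parent Ps P.1 = some (some Q.1) ↔ toInside Ps P ⋖ toInside Ps Q := by
  rw [toInside_covBy_iff]
  rcases isParent_parent hdistinct hoverlap P.2 with ⟨h1, h2⟩ | ⟨R, hR, h1, h2, h3⟩
  · rw [h1]
    refine iff_of_false (by simp) fun h => h2 Q.1 Q.2 h.1
  · rw [h1]
    simp only [Option.some.injEq]
    constructor
    · rintro rfl
      exact ⟨h2, h3⟩
    · rintro ⟨h4, h5⟩
      exact eq_of_parent hdistinct hoverlap hR Q.2 h2 h4 h3 h5

theorem parent_eq_some_none_iff {Ps : List SimplePolygon}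
    (hdistinct : (Ps.map SimplePolygon.inside).Nodup) (hoverlap : OverlapFree Ps)
    {P : {P : SimplePolygon // P ∈ Ps}} :
    parent Ps P.1 = some none ↔ IsMax (toInside Ps P) := by
  have hmax : IsMax (toInside Ps P) ↔ ∀ Q ∈ Ps, ¬ P.1.inside ⊂ Q.inside := by
    rw [isMax_iff_forall_not_lt]
    constructor
    · intro h Q hQ hlt
      exact h (toInside Ps ⟨Q, hQ⟩) hlt
    · rintro h ⟨_, Q, hQ, rfl⟩ hlt
      exact h Q hQ hlt
  rw [hmax]
  rcases isParent_parent hdistinct hoverlap P.2 with ⟨h1, h2⟩ | ⟨R, hR, h1, h2, h3⟩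
  · exact iff_of_true h1 h2
  · rw [h1]
    exact iff_of_false (by simp) fun h => h R hR h2

theorem output_eq_nestingForest {Ps : List SimplePolygon}
    (hdistinct : (Ps.map SimplePolygon.inside).Nodup) (hoverlap : OverlapFree Ps) :
    output Ps = nestingForest Ps := by
  apply RootedGraph.ext
  · ext P Q
    simp only [output, nestingForest, hasseDiagram, SimpleGraph.fromRel_adj,
      SimpleGraph.comap_adj, SimpleGraph.hasse_adj,
      parent_eq_some_some_iff hdistinct hoverlap]
    -- `SimpleGraph.fromRel` demands distinct ends, which the covering relation provides.
    refine and_iff_right_of_imp ?_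
    rintro (h | h) rfl
    · exact h.ne rfl
    · exact h.ne rfl
  · ext P
    exact parent_eq_some_none_iff hdistinct hoverlap

end NestingForest

/-- The algorithm, run on a list of polygons with pairwise different interiors such that no two
interiors overlap, returns the nesting forest; and the function `parent` that it computes is
defined on every polygon of the list, is `∅` exactly at the roots, and is the parent in the nesting
forest elsewhere. -/
theorem mainTheorem1 (Ps : List SimplePolygon)
    (hdistinct : (Ps.map SimplePolygon.inside).Nodup) (hoverlap : OverlapFree Ps) :
    NestingForest.output Ps = nestingForest Ps ∧
      ∀ P ∈ Ps,
        (NestingForest.parent Ps P = some none ∧ ∀ Q ∈ Ps, ¬ P.inside ⊂ Q.inside) ∨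
        (∃ Q ∈ Ps, NestingForest.parent Ps P = some (some Q) ∧ P.inside ⊂ Q.inside ∧
          ¬ ∃ R ∈ Ps, P.inside ⊂ R.inside ∧ R.inside ⊂ Q.inside) :=
  ⟨NestingForest.output_eq_nestingForest hdistinct hoverlap,
    fun _ hP => NestingForest.isParent_parent hdistinct hoverlap hP⟩
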